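/- Let $k$ be an algebraically closed field of characteristic $0$ and let $n\ge 1$. Let $p_1,\dots,p_{n+2}\in\mathbb P^n\times\mathbb P^{n+1}$ be points in general position; precisely, assume that the projections of any $n+1$ of them to $\mathbb P^n$ are linearly independent and that the projections of all $n+2$ of them to $\mathbb P^{n+1}$ are linearly independent. Let $X=X^{n,n+1}_{n+2}$ be the blow-up of $\mathbb P^n\times\mathbb P^{n+1}$ at $p_1,\dots,p_{n+2}$. Let $H_1,H_2$ be the pullbacks to $X$ of the hyperplane classes of $\mathbb P^n$ and $\mathbb P^{n+1}$, and let $E_i$ be the class of the exceptional divisor over $p_i$. A divisor on $X$ is called movable if its complete linear system is nonempty and has base locus of codimension at least two, and the movable cone $\operatorname{Mov}(X)$ is the convex cone generated by the classes of movable divisors in the real vector space $N^1(X)=\operatorname{Pic}(X)\otimes\mathbb R$ of divisor classes. Then the classes $H_1,H_2,E_1,\dots,E_{n+2}$ form a basis of $N^1(X)$, the cone $\operatorname{Mov}(X)$ is closed, and for real numbers $d_1,d_2,m_1,\dots,m_{n+2}$ the class $d_1H_1+d_2H_2-\sum_{i=1}^{n+2}m_iE_i$ lies in $\operatorname{Mov}(X)$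 if and only if all of the following inequalities hold: \begin{itemize} \item[$(\mathcal I_0)$] $d_1\ge 0$ and $d_2\ge 0$; \item[$(\mathcal I_1)$] $d_1+d_2\ge m_i$ for every $i\in\{1,\dots,n+2\}$; \item[$(\mathcal I_2)$] $nd_1+(n+1)d_2\ge\sum_{i\in I}m_i$ for every $I\subseteq\{1,\dots,n+2\}$ with $|I|\in\{n+1,n+2\}$; \item[$(\mathcal{II}_0)$] $m_i\ge 0$ for every $i\in\{1,\dots,n+2\}$; \item[$(\mathcal{II}_1)$] $(n-1)d_1+nd_2\ge\sum_{i\in I}m_i$ for every $I\subset\{1,\dots,n+2\}$ with $|I|=n$; \item[$(\mathcal{II}_2)$] $n(d_1+d_2)\ge\sum_{i\in I}m_i$ for every $I\subset\{1,\dots,n+2\}$ with $|I|=n+1$. \end{itemize} -/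

import Mathlib

open scoped LinearAlgebra.Projectivization Topology

/-! Blow-ups of `ℙⁿ × ℙᵐ` at closed points, in the language of models: an integral separated
scheme over `k` with function field `F` is described by the set of local rings of its points,
which are local subrings of `F`. Here `F` is the field of bihomogeneous fractions of bidegree
`(0, 0)` in the homogeneous coordinates of `ℙⁿ × ℙᵐ`. -/

namespace BlowupModel

noncomputable section

/-- The bihomogeneous coordinate ring `k[x₀,…,xₙ; y₀,…,yₘ]` of `ℙⁿ × ℙᵐ`. -/
abbrev CoordRing (k : Type*) [Field k] (n m : ℕ) : Type _ :=
  MvPolynomial (Fin (n + 1) ⊕ Fin (m + 1)) k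

/-- The bigrading: the `xᵢ` have bidegree `(1, 0)` and the `yⱼ` have bidegree `(0, 1)`. -/
def biweight (n m : ℕ) : Fin (n + 1) ⊕ Fin (m + 1) → ℕ × ℕ :=
  Sum.elim (fun _ => (1, 0)) (fun _ => (0, 1))

/-- The forms of bidegree `d`. -/
abbrev biForms (k : Type*) [Field k] (n m : ℕ) (d : ℕ × ℕ) : Submodule k (CoordRing k n m) :=
  MvPolynomial.weightedHomogeneousSubmodule k (biweight n m) d

/-- The fraction field of the coordinate ring; all local rings below are subrings of it. -/
abbrev CoordField (k : Type*) [Field k] (n m : ℕ) : Type _ :=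
  FractionRing (CoordRing k n m)

section Field

variable {k : Type*} [Field k] {n m : ℕ}

/-- The quotient `G / H` of two polynomials. -/
def quot (G H : CoordRing k n m) : CoordField k n m :=
  algebraMap (CoordRing k n m) (CoordField k n m) G /
    algebraMap (CoordRing k n m) (CoordField k n m) H

/-- The ring of all fractions `G / H` of forms of equal bidegree with `H ∉ P`
(bihomogeneous localization at the prime `P`, part of bidegree `(0, 0)`). -/
def homLocalization (P : Ideal (CoordRing k n m)) [hP : P.IsPrime] :
    Subring (CoordField k n m) where
  carrier := {f | ∃ d : ℕ × ℕ, ∃ G ∈ biForms k n m d, ∃ H ∈ biForms k n m d,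
    H ∉ P ∧ f = quot G H}
  mul_mem' := by
    rintro _ _ ⟨d, G, hG, H, hH, hHP, rfl⟩ ⟨d', G', hG', H', hH', hHP', rfl⟩
    refine ⟨d + d', G * G', MvPolynomial.IsWeightedHomogeneous.mul hG hG', H * H',
      MvPolynomial.IsWeightedHomogeneous.mul hH hH', fun h => (hP.mem_or_mem h).elim hHP hHP', ?_⟩
    simp only [quot, map_mul]
    rw [div_mul_div_comm]
  one_mem' := by
    refine ⟨0, 1, MvPolynomial.isWeightedHomogeneous_one _ _, 1,
      MvPolynomial.isWeightedHomogeneous_one _ _, fun h => hP.ne_top (P.eq_top_of_isUnit_mem h isUnit_one), ?_⟩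
    simp [quot]
  add_mem' := by
    rintro _ _ ⟨d, G, hG, H, hH, hHP, rfl⟩ ⟨d', G', hG', H', hH', hHP', rfl⟩
    refine ⟨d + d', G * H' + H * G', Submodule.add_mem _
      (MvPolynomial.IsWeightedHomogeneous.mul hG hH')
      (MvPolynomial.IsWeightedHomogeneous.mul hH hG'), H * H',
      MvPolynomial.IsWeightedHomogeneous.mul hH hH', fun h => (hP.mem_or_mem h).elim hHP hHP', ?_⟩
    have h0 : algebraMap (CoordRing k n m) (CoordField k n m) H ≠ 0 := fun h =>
      hHP (by rw [(IsFractionRing.to_map_eq_zero_iff).1 h]; exact P.zero_mem)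
    have h0' : algebraMap (CoordRing k n m) (CoordField k n m) H' ≠ 0 := fun h =>
      hHP' (by rw [(IsFractionRing.to_map_eq_zero_iff).1 h]; exact P.zero_mem)
    simp only [quot, map_add, map_mul]
    rw [div_add_div _ _ h0 h0']
  zero_mem' := by
    refine ⟨0, 0, Submodule.zero_mem _, 1,
      MvPolynomial.isWeightedHomogeneous_one _ _, fun h => hP.ne_top (P.eq_top_of_isUnit_mem h isUnit_one), ?_⟩
    simp [quot]
  neg_mem' := by
    rintro _ ⟨d, G, hG, H, hH, hHP, rfl⟩
    refine ⟨d, -G, Submodule.neg_mem _ hG, H, hH, hHP, ?_⟩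
    simp [quot, neg_div]

/-- The function field of `ℙⁿ × ℙᵐ`: all fractions of forms of equal bidegree. -/
def functionField (k : Type*) [Field k] (n m : ℕ) : Subring (CoordField k n m) :=
  homLocalization ⊥

/-- `P` contains the bihomogeneous components of each of its elements. -/
def IsBihomogeneous (P : Ideal (CoordRing k n m)) : Prop :=
  ∀ f ∈ P, ∀ d : ℕ × ℕ, MvPolynomial.weightedHomogeneousComponent (biweight n m) d f ∈ P

/-- `P` contains neither all the `xᵢ` nor all the `yⱼ`. -/
def IsRelevant (P : Ideal (CoordRing k n m)) : Prop :=
  (∃ i, MvPolynomial.X (Sum.inl i) ∉ P) ∧ (∃ j, MvPolynomial.X (Sum.inr j) ∉ P)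

/-- The local rings of all (scheme-theoretic) points of `ℙⁿ × ℙᵐ`, the biprojective spectrum of
the coordinate ring. -/
def productModel (k : Type*) [Field k] (n m : ℕ) : Set (Subring (CoordField k n m)) :=
  {R | ∃ (P : Ideal (CoordRing k n m)) (_ : P.IsPrime),
    IsBihomogeneous P ∧ IsRelevant P ∧ R = homLocalization P}

/-- The set of `k`-points of `ℙⁿ × ℙᵐ`. -/
abbrev ProdPoint (k : Type*) [Field k] (n m : ℕ) : Type _ :=
  ℙ k (Fin (n + 1) → k) × ℙ k (Fin (m + 1) → k)

/-- The local ring of `ℙⁿ × ℙᵐ` at a `k`-point `p`: all fractions `G / H` of forms of equal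
bidegree with `H(p) ≠ 0`. -/
def localRingAt (p : ProdPoint k n m) : Subring (CoordField k n m) :=
  homLocalization (RingHom.ker (MvPolynomial.eval (Sum.elim p.1.rep p.2.rep)))
    (hP := RingHom.ker_isPrime _)

/-- For a local ring `R` with maximal ideal `𝔪` and `0 ≠ t ∈ 𝔪`, the ring `R[𝔪/t]`, whose
spectrum is the standard affine chart `D₊(t)` of the blow-up `Proj (⨁ 𝔪ᵈ)` of `Spec R` at its
closed point. -/
def blowupChart (R : Subring (CoordField k n m)) (t : CoordField k n m) :
    Subring (CoordField k n m) :=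
  Subring.closure ((R : Set (CoordField k n m)) ∪ {f | ∃ a ∈ nonunits R, f = (a : CoordField k n m) / t})

/-- The blow-up `X` of `ℙⁿ × ℙᵐ` at the points `p₁, …, pₛ`, given by the local rings of all its
points: those of `ℙⁿ × ℙᵐ` other than the `pᵢ`, together with those of the blow-ups of the
`Spec 𝒪_{pᵢ}` at their closed points (glued along the `Spec 𝒪_{pᵢ} ∖ {pᵢ}`). -/
def blowup {s : ℕ} (p : Fin s → ProdPoint k n m) : Set (Subring (CoordField k n m)) :=
  {R | R ∈ productModel k n m ∧ ∀ i, R ≠ localRingAt (p i)} ∪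
  {R | ∃ (i : Fin s) (t : localRingAt (p i)) (_ : t ∈ nonunits (localRingAt (p i))) (_ : t ≠ 0)
    (q : Ideal (blowupChart (localRingAt (p i)) (t : CoordField k n m))) (_ : q.IsPrime),
    R = (LocalSubring.ofPrime (blowupChart (localRingAt (p i)) (t : CoordField k n m)) q).toSubring}

section Blowup

variable {s : ℕ}

/-- Prime divisors of `X`, i.e. its points of codimension one. As `X` is regular, they are the
points whose local ring is a discrete valuation ring. -/
def PrimeDivisor (p : Fin s → ProdPoint k n m) : Type _ :=
  {R : Subring (CoordField k n m) // R ∈ blowup p ∧ IsDiscreteValuationRing R}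

/-- `f = u ϖʳ` with `u` a unit and `ϖ` a uniformizer of the discrete valuation ring `R`. -/
def HasOrd (R : Subring (CoordField k n m)) (f : CoordField k n m) (r : ℤ) : Prop :=
  ∃ (u : Rˣ) (ϖ : R), Irreducible ϖ ∧ f = ((u : R) : CoordField k n m) * (ϖ : CoordField k n m) ^ r

open Classical in
/-- The order of vanishing of a nonzero rational function along a prime divisor. -/
def ordAlong {p : Fin s → ProdPoint k n m} (P : PrimeDivisor p) (f : CoordField k n m) : ℤ :=
  if h : ∃ r, HasOrd P.1 f r then h.choose else 0

/-- The group of (Weil) divisors on `X`. -/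
abbrev WeilDivisor (p : Fin s → ProdPoint k n m) : Type _ := PrimeDivisor p →₀ ℤ

/-- `D` is the divisor of a nonzero rational function. -/
def IsPrincipal {p : Fin s → ProdPoint k n m} (D : WeilDivisor p) : Prop :=
  ∃ f ∈ functionField k n m, f ≠ 0 ∧ ∀ P, D P = ordAlong P f

/-- The complete linear system `|D|`: all effective divisors linearly equivalent to `D`. -/
def linearSystem {p : Fin s → ProdPoint k n m} (D : WeilDivisor p) : Set (WeilDivisor p) :=
  {D' | 0 ≤ D' ∧ IsPrincipal (D' - D)}

/-- `D` is movable: `|D|` is nonempty and its base locus has codimension at least two, i.e. no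
prime divisor is contained in all members of `|D|`. -/
def IsMovable {p : Fin s → ProdPoint k n m} (D : WeilDivisor p) : Prop :=
  (linearSystem D).Nonempty ∧ ∀ P, ∃ D' ∈ linearSystem D, D' P = 0

/-- A divisor as a divisor with real coefficients. -/
def toReal {p : Fin s → ProdPoint k n m} (D : WeilDivisor p) : PrimeDivisor p →₀ ℝ :=
  D.mapRange (fun a : ℤ => (a : ℝ)) Int.cast_zero

/-- The real vector space `N¹(X)` of divisor classes: real divisors modulo the real span of the
principal divisors, i.e. `Pic(X) ⊗ ℝ`. (On the smooth projective rational variety `X`, a divisor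
class is numerically trivial only if it is zero, so this is also the space of numerical classes.) -/
abbrev N1 (p : Fin s → ProdPoint k n m) : Type _ :=
  (PrimeDivisor p →₀ ℝ) ⧸
    Submodule.span ℝ {D : PrimeDivisor p →₀ ℝ | ∃ D₀ : WeilDivisor p, IsPrincipal D₀ ∧ D = toReal D₀}

/-- The class of a divisor in `N¹(X)`. -/
def divClass {p : Fin s → ProdPoint k n m} (D : WeilDivisor p) : N1 p :=
  Submodule.Quotient.mk (toReal D)

/-- `Mov(X)`: the convex cone in `N¹(X)` generated by the classes of movable divisors. -/
def movableCone (p : Fin s → ProdPoint k n m) : PointedCone ℝ (N1 p) :=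
  PointedCone.hull ℝ {c | ∃ D : WeilDivisor p, IsMovable D ∧ c = divClass D}

open Classical in
/-- For a form `F ≠ 0` of bidegree `d`, the multiplicity along `P` of the pullback to `X` of the
Cartier divisor `F = 0` of `ℙⁿ × ℙᵐ`: the order along `P` of the local equation `F / G`, where
`G` is a form of bidegree `d` that generates `𝒪(d)` at the image of `P`. -/
def pullbackOrd {p : Fin s → ProdPoint k n m} (d : ℕ × ℕ) (F : CoordRing k n m)
    (P : PrimeDivisor p) : ℤ :=
  if h : ∃ G ∈ biForms k n m d, G ≠ 0 ∧ ∀ G' ∈ biForms k n m d, quot G' G ∈ P.1 then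
    ordAlong P (quot F h.choose)
  else 0

/-- The pullback to `X` of the divisor `F = 0`, for a form `F ≠ 0` of bidegree `d`. -/
def pullbackDivisor (p : Fin s → ProdPoint k n m) (d : ℕ × ℕ) (F : CoordRing k n m) :
    WeilDivisor p :=
  ∑ᶠ P : PrimeDivisor p, Finsupp.single P (pullbackOrd d F P)

/-- `H₁`, the class of the pullback of a hyperplane of `ℙⁿ`. -/
def H₁ (p : Fin s → ProdPoint k n m) : N1 p :=
  divClass (pullbackDivisor p (1, 0) (MvPolynomial.X (Sum.inl 0)))

/-- `H₂`, the class of the pullback of a hyperplane of `ℙᵐ`. -/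
def H₂ (p : Fin s → ProdPoint k n m) : N1 p :=
  divClass (pullbackDivisor p (0, 1) (MvPolynomial.X (Sum.inr 0)))

/-- The image of the prime divisor `P` in `ℙⁿ × ℙᵐ` is the point `x`: the local ring of `X` along
`P` dominates the local ring at `x`. -/
def LiesOver {p : Fin s → ProdPoint k n m} (P : PrimeDivisor p) (x : ProdPoint k n m) : Prop :=
  ∃ h : localRingAt x ≤ P.1, IsLocalHom (Subring.inclusion h)

/-- `Eᵢ`, the class of the exceptional divisor over `pᵢ`: the (only) prime divisor over `pᵢ`. -/
def E (p : Fin s → ProdPoint k n m) (i : Fin s) : N1 p :=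
  divClass (∑ᶠ (P : PrimeDivisor p) (_ : LiesOver P (p i)), Finsupp.single P 1)

/-- The points are in linearly general position in both factors: the projections to `ℙⁿ` of any
at most `n + 1` of them are linearly independent, and the projections to `ℙᵐ` of any at most
`m + 1` of them are linearly independent. -/
def LinearlyGeneral (p : Fin s → ProdPoint k n m) : Prop :=
  (∀ I : Finset (Fin s), I.card ≤ n + 1 →
    Projectivization.Independent (fun i : I => (p i).1)) ∧
  (∀ I : Finset (Fin s), I.card ≤ m + 1 →
    Projectivization.Independent (fun i : I => (p i).2))

end Blowup

end Field

end

end BlowupModel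

/-!
# The movable cone of the blow-up of `ℙⁿ × ℙⁿ⁺¹` at `n + 2` general points

**Divisors.** Points in general position admit adapted coordinates (`Frame`): the vectors `qᵢ` of
the second factor form a basis, and the vectors `aᵢ` of the first factor satisfy a single relation
`∑ cᵢ aᵢ = 0`, all of whose coefficients are nonzero. Pulling forms back along
`(u, y) ↦ (∑ uᵢ aᵢ, ∑ yᵢ qᵢ)` makes the multiplicity at `pᵢ` visible on monomials: it is the
smallest number of factors other than `uᵢ`, `yᵢ`. The prime divisors of the blow-up are the strict
transforms of irreducible hypersurfaces and the exceptional divisors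
(`Represents.eq_ring_of_mem_blowup`). Every discrete valuation ring occurring as a local ring is
compared with one of these by the maximality of discrete valuation rings
(`FormValuation.eq_ring_of_le`). As the coordinate ring is factorial, a divisor is principal exactly
if its degree `(d₁, d₂, μ)` vanishes (`Represents.isPrincipal_iff_deg`), which gives the basis of
`N¹(X)` and shows that the degree determines the complete linear system.

**Necessity.** If a movable divisor avoids a prime divisor `P`, a linear functional nonnegative on
all other prime divisors is nonnegative on its class. The inequality `μᵢ ≥ 0` comes from `P = Eᵢ`.
The strict transform of the hyperplane of `ℙⁿ` through all points but `pᵢ, pⱼ` gives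
`∑_{l ≠ i, j} μₗ ≤ (n - 1) d₁ + n d₂`, because a form it does not divide has a monomial free of
`uᵢ, uⱼ`. The hyperplane of `ℙⁿ⁺¹` through all points but `pᵢ` gives
`∑_{l ≠ i} μₗ ≤ n (d₁ + d₂)` in the same way. The bound `∑ μᵢ ≤ n d₁ + (n + 1) d₂` holds for all
effective divisors, since a general curve of bidegree `(n, n + 1)` through all points
meets them nonnegatively (`Frame.sum_ord_le`).

**Sufficiency.** Let `(d₁, d₂, μ)` be integral and satisfy the inequalities. The hyperplanes above
are the edges of the complete graph on `{1, …, n + 2} ∪ {*}`, where `{i, *}` stands for the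
hyperplane of `ℙⁿ⁺¹`. A multigraph with `D` edges and vertex degrees `a` gives an effective divisor
of degree `(D - a_*, a_*, D - aᵢ)`. With `D = d₁ + d₂`, `a_* = d₂`, `aᵢ ≤ D - μᵢ` and multiples of
the `Eᵢ` added, this has degree `(d₁, d₂, μ)`. A loopless multigraph with degrees `a` that avoids
an edge `{x, y}` exists as soon as `∑ a = 2 D`, all `aᵥ ≤ D` and `aₓ + a_y ≤ D`
(`mem_closure_edges`). The inequalities say exactly that the `aᵢ` can be chosen so as to avoid any
given prime divisor (`Represents.exists_avoiding`).

**Real classes.** A cone cut out by finitely many integral functionals is generated by its lattice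
points (`IsIntegralCone.mem_hull`). Hence `Mov(X)` is the whole cone of the inequalities, and it is
closed.
-/

namespace BlowupModel

/-! ### Gradings by weights, and factors of bihomogeneous polynomials -/

section Weights

open MvPolynomial

variable {k : Type*} [Field k] {σ : Type*}

/-- The substitution `Xᵢ ↦ Xᵢ · T ^ wᵢ`; the coefficient of `T ^ r` of the image of `f` is the
component of `f` of weight `r`. -/
noncomputable def weightHom (w : σ → ℕ) :
    MvPolynomial σ k →ₐ[k] Polynomial (MvPolynomial σ k) :=
  aeval fun i => Polynomial.C (X i) * Polynomial.X ^ w i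

@[simp] lemma weightHom_X (w : σ → ℕ) (i : σ) :
    weightHom w (X i : MvPolynomial σ k) = Polynomial.C (X i) * Polynomial.X ^ w i := by
  simp [weightHom]

lemma eval_one_weightHom (w : σ → ℕ) (f : MvPolynomial σ k) :
    Polynomial.eval 1 (weightHom w f) = f := by
  induction f using MvPolynomial.induction_on with
  | C a =>
    rw [← MvPolynomial.algebraMap_eq, AlgHom.commutes]
    simp [Polynomial.algebraMap_apply]
  | add p q hp hq => simp [hp, hq]
  | mul_X p i hp => simp [hp]

lemma weightHom_injective (w : σ → ℕ) :
    Function.Injective (weightHom w : MvPolynomial σ k →ₐ[k] _) :=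
  Function.LeftInverse.injective (g := Polynomial.eval 1) (eval_one_weightHom w)

lemma weightHom_monomial (w : σ → ℕ) (s : σ →₀ ℕ) (a : k) :
    weightHom w (monomial s a) = Polynomial.monomial (Finsupp.weight w s) (monomial s a) := by
  rw [weightHom, aeval_monomial, Finsupp.weight_apply, Polynomial.algebraMap_apply,
    MvPolynomial.algebraMap_eq, monomial_eq, ← Polynomial.C_mul_X_pow_eq_monomial, map_mul,
    Finsupp.prod, Finsupp.prod, Finsupp.sum, map_prod]
  simp only [mul_pow, Finset.prod_mul_distrib, ← pow_mul, Finset.prod_pow_eq_pow_sum, map_pow,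
    smul_eq_mul]
  rw [mul_assoc]
  simp only [mul_comm (w _)]

lemma weight_eq_sum [Fintype σ] (w : σ → ℕ) (s : σ →₀ ℕ) :
    Finsupp.weight w s = ∑ i, s i * w i := by
  rw [Finsupp.weight_apply, Finsupp.sum_fintype _ _ (by simp)]
  simp only [smul_eq_mul]

lemma coeff_weightHom (w : σ → ℕ) (f : MvPolynomial σ k) (r : ℕ) :
    (weightHom w f).coeff r = weightedHomogeneousComponent w r f := by
  classical
  induction f using MvPolynomial.induction_on' with
  | monomial s a =>
    rw [weightHom_monomial, Polynomial.coeff_monomial]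
    ext t
    rw [coeff_weightedHomogeneousComponent]
    split_ifs with h1 h2 h2 <;> simp_all [coeff_monomial]
    all_goals rintro rfl; simp_all
  | add p q hp hq => simp [hp, hq]

lemma X_pow_dvd_weightHom_iff (w : σ → ℕ) (f : MvPolynomial σ k) (N : ℕ) :
    Polynomial.X ^ N ∣ weightHom w f ↔ ∀ s ∈ f.support, N ≤ Finsupp.weight w s := by
  classical
  rw [Polynomial.X_pow_dvd_iff]
  simp only [coeff_weightHom]
  constructor
  · intro h s hs
    by_contra! hlt
    have := congrArg (coeff s) (h _ hlt)
    rw [coeff_weightedHomogeneousComponent, if_pos rfl, coeff_zero] at this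
    exact (mem_support_iff.1 hs) this
  · intro h d hd
    refine weightedHomogeneousComponent_eq_zero' _ _ fun s hs he => ?_
    have := h s hs
    omega

lemma isWeightedHomogeneous_iff_weightHom (w : σ → ℕ) (f : MvPolynomial σ k) (d : ℕ) :
    IsWeightedHomogeneous w f d ↔ weightHom w f = Polynomial.monomial d f := by
  classical
  constructor
  · intro h
    ext1 r
    rw [coeff_weightHom, Polynomial.coeff_monomial]
    split_ifs with hr
    · rw [← hr]; exact h.weightedHomogeneousComponent_same
    · exact h.weightedHomogeneousComponent_ne _ (Ne.symm hr)
  · intro h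
    have := congrArg (fun q => Polynomial.coeff q d) h
    simp only [coeff_weightHom, Polynomial.coeff_monomial_same] at this
    rw [← this]
    exact weightedHomogeneousComponent_isWeightedHomogeneous ..

/-- In a domain the top and the bottom degrees of a product are the sums of those of the factors,
so that a factor of a homogeneous polynomial is homogeneous. -/
lemma isWeightedHomogeneous_of_mul (w : σ → ℕ) {f g : MvPolynomial σ k} (hf : f ≠ 0)
    (hg : g ≠ 0) {d : ℕ} (h : IsWeightedHomogeneous w (f * g) d) :
    ∃ e, IsWeightedHomogeneous w f e := by
  rw [isWeightedHomogeneous_iff_weightHom, map_mul] at h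
  have hf' : weightHom w f ≠ 0 := (map_ne_zero_iff _ (weightHom_injective w)).2 hf
  have hg' : weightHom w g ≠ 0 := (map_ne_zero_iff _ (weightHom_injective w)).2 hg
  have hfg : f * g ≠ 0 := mul_ne_zero hf hg
  have h1 := congrArg Polynomial.natDegree h
  have h2 := congrArg Polynomial.natTrailingDegree h
  rw [Polynomial.natDegree_mul hf' hg', Polynomial.natDegree_monomial_eq _ hfg] at h1
  rw [Polynomial.natTrailingDegree_mul hf' hg', Polynomial.natTrailingDegree_monomial hfg] at h2
  have h3 := Polynomial.natTrailingDegree_le_natDegree (weightHom w f)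
  have h4 := Polynomial.natTrailingDegree_le_natDegree (weightHom w g)
  refine ⟨(weightHom w f).natDegree, ?_⟩
  rw [isWeightedHomogeneous_iff_weightHom]
  -- the top and the bottom degree of `weightHom w f` agree, so it is a monomial in `T`
  have h5 : weightHom w f = Polynomial.monomial (weightHom w f).natDegree
      ((weightHom w f).coeff (weightHom w f).natDegree) := by
    ext1 r
    rw [Polynomial.coeff_monomial]
    split_ifs with hr
    · rw [hr]
    · rcases lt_or_gt_of_ne hr with h | h
      · exact Polynomial.coeff_eq_zero_of_natDegree_lt h
      · exact Polynomial.coeff_eq_zero_of_lt_natTrailingDegree (by omega)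
  have h6 := congrArg (Polynomial.eval 1) h5
  rw [eval_one_weightHom, Polynomial.eval_monomial, one_pow, mul_one] at h6
  rw [← h6] at h5
  exact h5

variable {n m : ℕ}

/-- The degrees in the `xᵢ`. -/
def weightX (n m : ℕ) : Fin (n + 1) ⊕ Fin (m + 1) → ℕ := Sum.elim (fun _ => 1) (fun _ => 0)

/-- The degrees in the `yⱼ`. -/
def weightY (n m : ℕ) : Fin (n + 1) ⊕ Fin (m + 1) → ℕ := Sum.elim (fun _ => 0) (fun _ => 1)

lemma weight_biweight (s : Fin (n + 1) ⊕ Fin (m + 1) →₀ ℕ) :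
    Finsupp.weight (biweight n m) s =
      (Finsupp.weight (weightX n m) s, Finsupp.weight (weightY n m) s) := by
  simp only [Finsupp.weight_apply, Finsupp.sum_fintype, zero_smul, implies_true,
    Fintype.sum_sum_type, biweight, weightX, weightY, Sum.elim_inl, Sum.elim_inr]
  ext <;> simp [Prod.fst_sum, Prod.snd_sum]

lemma mem_biForms_iff {f : CoordRing k n m} {d : ℕ × ℕ} :
    f ∈ biForms k n m d ↔ IsWeightedHomogeneous (weightX n m) f d.1 ∧
      IsWeightedHomogeneous (weightY n m) f d.2 := by
  rw [mem_weightedHomogeneousSubmodule]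
  simp only [IsWeightedHomogeneous, weight_biweight, Prod.ext_iff]
  exact ⟨fun h => ⟨fun s hs => (h hs).1, fun s hs => (h hs).2⟩, fun h s hs => ⟨h.1 hs, h.2 hs⟩⟩

lemma mul_mem_biForms {f g : CoordRing k n m} {d e : ℕ × ℕ} (hf : f ∈ biForms k n m d)
    (hg : g ∈ biForms k n m e) : f * g ∈ biForms k n m (d + e) :=
  IsWeightedHomogeneous.mul hf hg

lemma pow_mem_biForms {f : CoordRing k n m} {d : ℕ × ℕ} (hf : f ∈ biForms k n m d) (r : ℕ) :
    f ^ r ∈ biForms k n m (r • d) :=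
  IsWeightedHomogeneous.pow hf r

lemma one_mem_biForms : (1 : CoordRing k n m) ∈ biForms k n m 0 :=
  isWeightedHomogeneous_one _ _

lemma biForms_degree_unique {f : CoordRing k n m} (h0 : f ≠ 0) {d e : ℕ × ℕ}
    (hd : f ∈ biForms k n m d) (he : f ∈ biForms k n m e) : d = e :=
  IsWeightedHomogeneous.inj_right h0 hd he

lemma exists_mem_biForms_of_dvd {f g : CoordRing k n m} (hg : g ≠ 0) (h : f ∣ g) {d : ℕ × ℕ}
    (hd : g ∈ biForms k n m d) : ∃ e, f ∈ biForms k n m e := by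
  obtain ⟨c, rfl⟩ := h
  obtain ⟨h1, h2⟩ := mem_biForms_iff.1 hd
  obtain ⟨e1, he1⟩ := isWeightedHomogeneous_of_mul _ (left_ne_zero_of_mul hg)
    (right_ne_zero_of_mul hg) h1
  obtain ⟨e2, he2⟩ := isWeightedHomogeneous_of_mul _ (left_ne_zero_of_mul hg)
    (right_ne_zero_of_mul hg) h2
  exact ⟨(e1, e2), mem_biForms_iff.2 ⟨he1, he2⟩⟩

lemma exists_mem_biForms_of_mul {f g : CoordRing k n m} (hf : f * g ≠ 0) {d : ℕ × ℕ}
    (hd : f * g ∈ biForms k n m d) :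
    ∃ e e', f ∈ biForms k n m e ∧ g ∈ biForms k n m e' ∧ e + e' = d := by
  obtain ⟨e, he⟩ := exists_mem_biForms_of_dvd hf (dvd_mul_right f g) hd
  obtain ⟨e', he'⟩ := exists_mem_biForms_of_dvd hf (dvd_mul_left g f) hd
  exact ⟨e, e', he, he', biForms_degree_unique hf (mul_mem_biForms he he') hd⟩

lemma eq_C_of_mem_biForms_zero {f : CoordRing k n m} (h : f ∈ biForms k n m 0) :
    ∃ a, f = C a := by
  refine ⟨coeff 0 f, ?_⟩
  ext s
  rw [coeff_C]
  split_ifs with hs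
  · rw [hs]
  · by_contra hne
    apply hs
    have h1 := h hne
    rw [weight_biweight, Prod.ext_iff] at h1
    obtain ⟨h1, h2⟩ := h1
    simp only [weight_eq_sum, Fintype.sum_sum_type, weightX, weightY, Sum.elim_inl, Sum.elim_inr,
      mul_one, mul_zero, Finset.sum_const_zero, add_zero, zero_add, Prod.fst_zero, Prod.snd_zero,
      Finset.sum_eq_zero_iff, Finset.mem_univ, forall_const] at h1 h2
    ext i
    rcases i with i | i
    · simp [h1 i]
    · simp [h2 i]

lemma isUnit_of_mem_biForms_zero {f : CoordRing k n m} (h0 : f ≠ 0)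
    (h : f ∈ biForms k n m 0) : IsUnit f := by
  obtain ⟨a, rfl⟩ := eq_C_of_mem_biForms_zero h
  exact (isUnit_iff_ne_zero.2 fun ha => h0 (by rw [ha, C_0])).map C

lemma C_mem_biForms (a : k) : (C a : CoordRing k n m) ∈ biForms k n m 0 :=
  isWeightedHomogeneous_C _ _

lemma X_inl_mem_biForms (i : Fin (n + 1)) :
    (X (Sum.inl i) : CoordRing k n m) ∈ biForms k n m (1, 0) :=
  isWeightedHomogeneous_X k _ _

lemma X_inr_mem_biForms (j : Fin (m + 1)) :
    (X (Sum.inr j) : CoordRing k n m) ∈ biForms k n m (0, 1) :=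
  isWeightedHomogeneous_X k _ _

/-- A nonzero linear form is irreducible, as one of the bidegrees of two factors is `(0, 0)`. -/
lemma irreducible_of_mem_biForms {f : CoordRing k n m} (h0 : f ≠ 0) {d : ℕ × ℕ}
    (hd : d.1 + d.2 = 1) (hf : f ∈ biForms k n m d) : Irreducible f := by
  refine ⟨fun hu => ?_, fun a b hab => ?_⟩
  · obtain ⟨g, hg⟩ := hu.dvd (a := 1)
    obtain ⟨e, e', he, he', h⟩ := exists_mem_biForms_of_mul (f := f) (g := g) (d := 0)
      (hg ▸ one_ne_zero) (hg ▸ one_mem_biForms)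
    obtain rfl := biForms_degree_unique h0 he hf
    have h1 := congrArg Prod.fst h
    have h2 := congrArg Prod.snd h
    simp only [Prod.fst_add, Prod.snd_add, Prod.fst_zero, Prod.snd_zero] at h1 h2
    omega
  · subst hab
    obtain ⟨e, e', he, he', h⟩ := exists_mem_biForms_of_mul h0 hf
    have h1 := congrArg Prod.fst h
    have h2 := congrArg Prod.snd h
    simp only [Prod.fst_add, Prod.snd_add] at h1 h2
    rcases Nat.eq_zero_or_pos (e.1 + e.2) with h3 | h3
    · exact Or.inl (isUnit_of_mem_biForms_zero (left_ne_zero_of_mul h0)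
        ((show e = 0 from Prod.ext (by simp; omega) (by simp; omega)) ▸ he))
    · exact Or.inr (isUnit_of_mem_biForms_zero (right_ne_zero_of_mul h0)
        ((show e' = 0 from Prod.ext (by simp; omega) (by simp; omega)) ▸ he'))

/-- Induction on forms along their factorization. -/
lemma form_induction {motive : (f : CoordRing k n m) → (d : ℕ × ℕ) → Prop}
    (unit : ∀ f, f ≠ 0 → f ∈ biForms k n m 0 → motive f 0)
    (mul : ∀ f g d e, Irreducible f → f ∈ biForms k n m d → g ≠ 0 → g ∈ biForms k n m e →
      motive g e → motive (f * g) (d + e))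
    {f : CoordRing k n m} {d : ℕ × ℕ} (h0 : f ≠ 0) (hf : f ∈ biForms k n m d) : motive f d := by
  induction f using WfDvdMonoid.induction_on_irreducible generalizing d with
  | zero => exact absurd rfl h0
  | unit u hu =>
    obtain ⟨g, hg⟩ := hu.dvd (a := 1)
    obtain ⟨e, e', he, he', h⟩ := exists_mem_biForms_of_mul (f := u) (g := g) (d := 0)
      (hg ▸ one_ne_zero) (hg ▸ one_mem_biForms)
    have h1 := congrArg Prod.fst h
    have h2 := congrArg Prod.snd h
    simp only [Prod.fst_add, Prod.snd_add, Prod.fst_zero, Prod.snd_zero] at h1 h2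
    have := biForms_degree_unique h0 hf he
    subst this
    have : d = 0 := Prod.ext (by simp; omega) (by simp; omega)
    subst this
    exact unit _ h0 hf
  | mul a i ha hi ih =>
    obtain ⟨e, e', he, he', h⟩ := exists_mem_biForms_of_mul h0 hf
    subst h
    exact mul _ _ _ _ hi he ha he' (ih ha he')

end Weights

/-! ### Valuations on forms and their valuation rings -/

section FormValuations

open MvPolynomial

variable {k : Type*} [Field k] {n m : ℕ}

lemma algebraMap_coord_ne_zero {H : CoordRing k n m} (hH : H ≠ 0) :
    algebraMap (CoordRing k n m) (CoordField k n m) H ≠ 0 :=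
  fun h => hH (IsFractionRing.to_map_eq_zero_iff.1 h)

lemma quot_eq_quot_iff {G H G' H' : CoordRing k n m} (hH : H ≠ 0) (hH' : H' ≠ 0) :
    quot G H = quot G' H' ↔ G * H' = G' * H := by
  rw [quot, quot, div_eq_div_iff (algebraMap_coord_ne_zero hH) (algebraMap_coord_ne_zero hH'),
    ← map_mul, ← map_mul]
  exact (IsFractionRing.injective (CoordRing k n m) (CoordField k n m)).eq_iff

lemma quot_mul_quot (G H G' H' : CoordRing k n m) :
    quot G H * quot G' H' = quot (G * G') (H * H') := by
  simp only [quot, map_mul, div_mul_div_comm]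

lemma quot_inv (G H : CoordRing k n m) : (quot G H)⁻¹ = quot H G := by
  simp only [quot, inv_div]

lemma quot_ne_zero {G H : CoordRing k n m} (hG : G ≠ 0) (hH : H ≠ 0) : quot G H ≠ 0 :=
  div_ne_zero (algebraMap_coord_ne_zero hG) (algebraMap_coord_ne_zero hH)

lemma ne_zero_of_quot_ne_zero {G H : CoordRing k n m} (h : quot G H ≠ 0) : G ≠ 0 := by
  rintro rfl
  simp [quot] at h

lemma quot_self {G : CoordRing k n m} (hG : G ≠ 0) : quot G G = 1 :=
  div_self (algebraMap_coord_ne_zero hG)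

lemma quot_div_quot {F G : CoordRing k n m} {H : CoordRing k n m} (hH : H ≠ 0) :
    quot F H / quot G H = quot F G := by
  simp only [quot]
  rw [div_div_div_cancel_right₀ (algebraMap_coord_ne_zero hH)]

/-- A discrete valuation on the coordinate ring that is nonnegative on forms, is normalized to
take the value `0` on some form of every bidegree, and takes the value `1` on some fraction of
forms of equal bidegree. The value at `0` carries no meaning. -/
structure FormValuation (k : Type*) [Field k] (n m : ℕ) where
  /-- the order of a nonzero polynomial -/
  ord : CoordRing k n m → ℕ
  ord_mul : ∀ {F G}, F ≠ 0 → G ≠ 0 → ord (F * G) = ord F + ord G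
  min_le_ord_add : ∀ {F G}, F ≠ 0 → G ≠ 0 → F + G ≠ 0 → min (ord F) (ord G) ≤ ord (F + G)
  exists_x : ∃ g ∈ biForms k n m (1, 0), g ≠ 0 ∧ ord g = 0
  exists_y : ∃ g ∈ biForms k n m (0, 1), g ≠ 0 ∧ ord g = 0
  exists_uniformizer : ∃ d, ∃ G ∈ biForms k n m d, ∃ H ∈ biForms k n m d,
    G ≠ 0 ∧ H ≠ 0 ∧ ord G = ord H + 1

namespace FormValuation

variable (v : FormValuation k n m)

lemma ord_one : v.ord 1 = 0 := by
  have := v.ord_mul (F := 1) (G := 1) one_ne_zero one_ne_zero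
  rw [mul_one] at this
  omega

lemma ord_neg (F : CoordRing k n m) (hF : F ≠ 0) : v.ord (-F) = v.ord F := by
  have h0 : (-1 : CoordRing k n m) ≠ 0 := neg_ne_zero.2 one_ne_zero
  have := v.ord_mul h0 h0
  rw [neg_one_mul, neg_neg, v.ord_one] at this
  rw [← neg_one_mul, v.ord_mul h0 hF]
  omega

lemma ord_pow {F : CoordRing k n m} (hF : F ≠ 0) (r : ℕ) : v.ord (F ^ r) = r * v.ord F := by
  induction r with
  | zero => rw [pow_zero, v.ord_one, zero_mul]
  | succ r ih => rw [pow_succ, v.ord_mul (pow_ne_zero _ hF) hF, ih]; ring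

lemma ord_of_isUnit {F : CoordRing k n m} (hF : IsUnit F) : v.ord F = 0 := by
  obtain ⟨G, hG⟩ := hF.dvd (a := 1)
  have := v.ord_mul (F := F) (G := G) (left_ne_zero_of_mul (hG ▸ one_ne_zero))
    (right_ne_zero_of_mul (hG ▸ one_ne_zero))
  rw [← hG, v.ord_one] at this
  omega

lemma exists_ord_eq_zero (d : ℕ × ℕ) : ∃ g ∈ biForms k n m d, g ≠ 0 ∧ v.ord g = 0 := by
  obtain ⟨g, hg, hg0, hgv⟩ := v.exists_x
  obtain ⟨g', hg', hg0', hgv'⟩ := v.exists_y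
  refine ⟨g ^ d.1 * g' ^ d.2, ?_, mul_ne_zero (pow_ne_zero _ hg0) (pow_ne_zero _ hg0'), ?_⟩
  · have := mul_mem_biForms (pow_mem_biForms hg d.1) (pow_mem_biForms hg' d.2)
    simpa using this
  · rw [v.ord_mul (pow_ne_zero _ hg0) (pow_ne_zero _ hg0'), v.ord_pow hg0, v.ord_pow hg0', hgv,
      hgv', mul_zero, mul_zero, add_zero]

/-- `f` is a fraction of forms of equal bidegree whose orders differ by `r`. -/
def HasVal (f : CoordField k n m) (r : ℤ) : Prop :=
  ∃ d, ∃ G ∈ biForms k n m d, ∃ H ∈ biForms k n m d,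
    G ≠ 0 ∧ H ≠ 0 ∧ f = quot G H ∧ r = (v.ord G : ℤ) - v.ord H

variable {v}

lemma hasVal_quot {d : ℕ × ℕ} {G H : CoordRing k n m} (hG : G ∈ biForms k n m d)
    (hH : H ∈ biForms k n m d) (hG0 : G ≠ 0) (hH0 : H ≠ 0) :
    v.HasVal (quot G H) ((v.ord G : ℤ) - v.ord H) :=
  ⟨d, G, hG, H, hH, hG0, hH0, rfl, rfl⟩

lemma HasVal.ne_zero {f : CoordField k n m} {r : ℤ} (h : v.HasVal f r) : f ≠ 0 := by
  obtain ⟨d, G, hG, H, hH, hG0, hH0, rfl, rfl⟩ := h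
  exact quot_ne_zero hG0 hH0

lemma HasVal.unique {f : CoordField k n m} {r s : ℤ} (h : v.HasVal f r) (h' : v.HasVal f s) :
    r = s := by
  obtain ⟨d, G, hG, H, hH, hG0, hH0, rfl, rfl⟩ := h
  obtain ⟨d', G', hG', H', hH', hG0', hH0', he, rfl⟩ := h'
  rw [quot_eq_quot_iff hH0 hH0'] at he
  have h1 := v.ord_mul hG0 hH0'
  have h2 := v.ord_mul hG0' hH0
  rw [he] at h1
  omega

lemma HasVal.mul {f g : CoordField k n m} {r s : ℤ} (h : v.HasVal f r) (h' : v.HasVal g s) :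
    v.HasVal (f * g) (r + s) := by
  obtain ⟨d, G, hG, H, hH, hG0, hH0, rfl, rfl⟩ := h
  obtain ⟨d', G', hG', H', hH', hG0', hH0', rfl, rfl⟩ := h'
  refine ⟨d + d', _, mul_mem_biForms hG hG', _, mul_mem_biForms hH hH', mul_ne_zero hG0 hG0',
    mul_ne_zero hH0 hH0', quot_mul_quot .., ?_⟩
  rw [v.ord_mul hG0 hG0', v.ord_mul hH0 hH0']
  push_cast
  ring

lemma HasVal.inv {f : CoordField k n m} {r : ℤ} (h : v.HasVal f r) : v.HasVal f⁻¹ (-r) := by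
  obtain ⟨d, G, hG, H, hH, hG0, hH0, rfl, rfl⟩ := h
  exact ⟨d, H, hH, G, hG, hH0, hG0, quot_inv .., by ring⟩

variable (v) in
lemma hasVal_one : v.HasVal 1 0 :=
  ⟨0, 1, one_mem_biForms, 1, one_mem_biForms, one_ne_zero, one_ne_zero,
    (quot_self one_ne_zero).symm, by simp⟩

lemma HasVal.pow {f : CoordField k n m} {r : ℤ} (h : v.HasVal f r) (N : ℕ) :
    v.HasVal (f ^ N) (N * r) := by
  induction N with
  | zero => simpa using v.hasVal_one
  | succ N ih =>
    rw [pow_succ]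
    convert ih.mul h using 1
    push_cast
    ring

lemma HasVal.zpow {f : CoordField k n m} {r : ℤ} (h : v.HasVal f r) (N : ℤ) :
    v.HasVal (f ^ N) (N * r) := by
  obtain ⟨N, rfl | rfl⟩ := N.eq_nat_or_neg
  · rw [zpow_natCast]; exact h.pow N
  · rw [zpow_neg, zpow_natCast]
    convert (h.pow N).inv using 1
    ring

variable (v) in
lemma exists_hasVal {f : CoordField k n m} (hf : f ∈ functionField k n m) (h0 : f ≠ 0) :
    ∃ r, v.HasVal f r := by
  obtain ⟨d, G, hG, H, hH, hH0, rfl⟩ := hf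
  exact ⟨_, hasVal_quot hG hH (ne_zero_of_quot_ne_zero h0) (by simpa using hH0)⟩

variable (v)

/-- The valuation ring of `v` in the function field. -/
def ring : Subring (CoordField k n m) where
  carrier := {f | ∃ d, ∃ G ∈ biForms k n m d, ∃ H ∈ biForms k n m d,
    H ≠ 0 ∧ (G ≠ 0 → v.ord H ≤ v.ord G) ∧ f = quot G H}
  mul_mem' := by
    rintro _ _ ⟨d, G, hG, H, hH, hH0, hle, rfl⟩ ⟨d', G', hG', H', hH', hH0', hle', rfl⟩
    refine ⟨d + d', _, mul_mem_biForms hG hG', _, mul_mem_biForms hH hH', mul_ne_zero hH0 hH0',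
      fun h => ?_, quot_mul_quot ..⟩
    rw [v.ord_mul (left_ne_zero_of_mul h) (right_ne_zero_of_mul h), v.ord_mul hH0 hH0']
    exact add_le_add (hle (left_ne_zero_of_mul h)) (hle' (right_ne_zero_of_mul h))
  one_mem' := ⟨0, 1, one_mem_biForms, 1, one_mem_biForms, one_ne_zero, fun _ => le_rfl,
    (quot_self one_ne_zero).symm⟩
  add_mem' := by
    rintro _ _ ⟨d, G, hG, H, hH, hH0, hle, rfl⟩ ⟨d', G', hG', H', hH', hH0', hle', rfl⟩
    refine ⟨d + d', G * H' + H * G', Submodule.add_mem _ (mul_mem_biForms hG hH')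
      (mul_mem_biForms hH hG'), _, mul_mem_biForms hH hH', mul_ne_zero hH0 hH0', fun h => ?_, ?_⟩
    · rw [v.ord_mul hH0 hH0']
      by_cases hG0 : G = 0
      · subst hG0
        simp only [zero_mul, zero_add] at h ⊢
        rw [v.ord_mul hH0 (right_ne_zero_of_mul h)]
        exact Nat.add_le_add_left (hle' (right_ne_zero_of_mul h)) _
      by_cases hG0' : G' = 0
      · subst hG0'
        simp only [mul_zero, add_zero] at h ⊢
        rw [v.ord_mul hG0 hH0']
        exact Nat.add_le_add_right (hle hG0) _
      have h1 := v.min_le_ord_add (mul_ne_zero hG0 hH0') (mul_ne_zero hH0 hG0') h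
      rw [v.ord_mul hG0 hH0', v.ord_mul hH0 hG0'] at h1
      have h2 := hle hG0
      have h3 := hle' hG0'
      omega
    · simp only [quot, map_add, map_mul]
      rw [div_add_div _ _ (algebraMap_coord_ne_zero hH0) (algebraMap_coord_ne_zero hH0')]
  zero_mem' := ⟨0, 0, Submodule.zero_mem _, 1, one_mem_biForms, one_ne_zero,
    fun h => absurd rfl h, by simp [quot]⟩
  neg_mem' := by
    rintro _ ⟨d, G, hG, H, hH, hH0, hle, rfl⟩
    refine ⟨d, -G, Submodule.neg_mem _ hG, H, hH, hH0, fun h => ?_, by simp [quot, neg_div]⟩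
    rw [v.ord_neg _ (neg_ne_zero.1 h)]
    exact hle (neg_ne_zero.1 h)

variable {v}

lemma HasVal.mem_ring_iff {f : CoordField k n m} {r : ℤ} (h : v.HasVal f r) :
    f ∈ v.ring ↔ 0 ≤ r := by
  constructor
  · rintro ⟨d, G, hG, H, hH, hH0, hle, rfl⟩
    have hG0 := ne_zero_of_quot_ne_zero h.ne_zero
    have h1 := h.unique (hasVal_quot hG hH hG0 hH0)
    have h2 := hle hG0
    omega
  · obtain ⟨d, G, hG, H, hH, hG0, hH0, rfl, rfl⟩ := h
    intro h
    exact ⟨d, G, hG, H, hH, hH0, fun _ => by omega, rfl⟩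

lemma quot_mem_ring_iff {d : ℕ × ℕ} {G H : CoordRing k n m} (hG : G ∈ biForms k n m d)
    (hH : H ∈ biForms k n m d) (hG0 : G ≠ 0) (hH0 : H ≠ 0) :
    quot G H ∈ v.ring ↔ v.ord H ≤ v.ord G := by
  rw [(hasVal_quot hG hH hG0 hH0).mem_ring_iff]
  omega

variable (v) in
lemma ring_le_functionField : v.ring ≤ functionField k n m := by
  rintro _ ⟨d, G, hG, H, hH, hH0, hle, rfl⟩
  exact ⟨d, G, hG, H, hH, by simpa using hH0, rfl⟩

lemma exists_hasVal_nonneg {x : v.ring} (hx : x ≠ 0) :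
    ∃ r : ℕ, v.HasVal (x : CoordField k n m) r := by
  have hx' : (x : CoordField k n m) ≠ 0 := fun h => hx (Subtype.ext h)
  obtain ⟨r, hr⟩ := v.exists_hasVal (v.ring_le_functionField x.2) hx'
  have := hr.mem_ring_iff.1 x.2
  obtain ⟨r, rfl⟩ := Int.eq_ofNat_of_zero_le this
  exact ⟨r, hr⟩

lemma HasVal.isUnit_iff {x : v.ring} {r : ℤ} (h : v.HasVal (x : CoordField k n m) r) :
    IsUnit x ↔ r = 0 := by
  constructor
  · intro hu
    obtain ⟨y, hy⟩ := hu.dvd (a := 1)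
    have hy' : (1 : CoordField k n m) = x * y := congrArg Subtype.val hy
    have hyx : (y : CoordField k n m) = (x : CoordField k n m)⁻¹ :=
      eq_inv_of_mul_eq_one_right hy'.symm
    have h1 := h.mem_ring_iff.1 x.2
    have h2 := h.inv.mem_ring_iff.1 (hyx ▸ y.2)
    omega
  · rintro rfl
    refine IsUnit.of_mul_eq_one ⟨_, h.inv.mem_ring_iff.2 (by simp)⟩ (Subtype.ext ?_)
    exact mul_inv_cancel₀ h.ne_zero

variable (v) in
lemma exists_hasVal_one : ∃ f, v.HasVal f 1 := by
  obtain ⟨d, G, hG, H, hH, hG0, hH0, h⟩ := v.exists_uniformizer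
  refine ⟨_, d, G, hG, H, hH, hG0, hH0, rfl, by omega⟩

lemma HasVal.irreducible {x : v.ring} (h : v.HasVal (x : CoordField k n m) 1) :
    Irreducible x := by
  refine ⟨fun hu => by simpa using h.isUnit_iff.1 hu, fun a b hab => ?_⟩
  subst hab
  have hne : a * b ≠ 0 := fun h0 => h.ne_zero (congrArg Subtype.val h0)
  obtain ⟨r, hr⟩ := exists_hasVal_nonneg (left_ne_zero_of_mul hne)
  obtain ⟨s, hs⟩ := exists_hasVal_nonneg (right_ne_zero_of_mul hne)
  have := h.unique (hr.mul hs)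
  rcases Nat.eq_zero_or_pos r with h0 | h0
  · exact Or.inl (hr.isUnit_iff.2 (by omega))
  · exact Or.inr (hs.isUnit_iff.2 (by omega))

lemma hasVal_of_irreducible {x : v.ring} (h : Irreducible x) :
    v.HasVal (x : CoordField k n m) 1 := by
  obtain ⟨r, hr⟩ := exists_hasVal_nonneg h.ne_zero
  obtain ⟨f, hf⟩ := v.exists_hasVal_one
  have hr0 : r ≠ 0 := fun h0 => h.not_isUnit (hr.isUnit_iff.2 (by omega))
  have h1 : v.HasVal (x / f) (r - 1) := by
    rw [div_eq_mul_inv]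
    exact hr.mul hf.inv
  have hfm := hf.mem_ring_iff.2 (by norm_num)
  have h2 : x = ⟨f, hfm⟩ * ⟨x / f, h1.mem_ring_iff.2 (by omega)⟩ :=
    Subtype.ext (mul_div_cancel₀ _ hf.ne_zero).symm
  rcases h.isUnit_or_isUnit h2 with h3 | h3
  · have := (HasVal.isUnit_iff (x := ⟨f, hfm⟩) hf).1 h3
    omega
  · have := (HasVal.isUnit_iff (v := v) (x := ⟨x / f, _⟩) h1).1 h3
    rwa [show (r : ℤ) = 1 by omega] at hr

variable (v) in
lemma isDiscreteValuationRing_ring : IsDiscreteValuationRing v.ring := by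
  apply IsDiscreteValuationRing.ofHasUnitMulPowIrreducibleFactorization
  obtain ⟨f, hf⟩ := v.exists_hasVal_one
  have hfm := hf.mem_ring_iff.2 (by norm_num)
  refine ⟨⟨f, hfm⟩, HasVal.irreducible hf, fun {x} hx => ?_⟩
  obtain ⟨r, hr⟩ := exists_hasVal_nonneg hx
  have h1 : v.HasVal (x / f ^ r) 0 := by
    rw [div_eq_mul_inv]
    convert hr.mul (hf.pow r).inv using 1
    ring
  have h1m := h1.mem_ring_iff.2 le_rfl
  have hu : IsUnit (⟨x / f ^ r, h1m⟩ : v.ring) := HasVal.isUnit_iff (v := v) h1 |>.2 rfl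
  refine ⟨r, hu.unit, Subtype.ext ?_⟩
  simp only [IsUnit.unit_spec]
  exact mul_div_cancel₀ _ (pow_ne_zero _ hf.ne_zero)

lemma hasOrd_ring_iff {f : CoordField k n m} {r : ℤ} : HasOrd v.ring f r ↔ v.HasVal f r := by
  constructor
  · rintro ⟨u, ϖ, hϖ, rfl⟩
    obtain ⟨s, hs⟩ := exists_hasVal_nonneg u.ne_zero
    have := hs.isUnit_iff.1 u.isUnit
    rw [this] at hs
    convert hs.mul ((hasVal_of_irreducible hϖ).zpow r) using 1
    ring
  · intro h
    obtain ⟨f₁, hf⟩ := v.exists_hasVal_one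
    have hfm := hf.mem_ring_iff.2 (by norm_num)
    have h1 : v.HasVal (f / f₁ ^ r) 0 := by
      rw [div_eq_mul_inv]
      convert h.mul (hf.zpow r).inv using 1
      ring
    have h1m := h1.mem_ring_iff.2 le_rfl
    have hu : IsUnit (⟨f / f₁ ^ r, h1m⟩ : v.ring) := HasVal.isUnit_iff (v := v) h1 |>.2 rfl
    refine ⟨hu.unit, ⟨f₁, hfm⟩, HasVal.irreducible hf, ?_⟩
    simp only [IsUnit.unit_spec]
    exact (div_mul_cancel₀ _ (zpow_ne_zero _ hf.ne_zero)).symm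

/-- A form valuation is determined by its valuation ring. -/
lemma ord_eq_of_ring_eq {w : FormValuation k n m} (h : v.ring = w.ring) {d : ℕ × ℕ}
    {G : CoordRing k n m} (hG : G ∈ biForms k n m d) (hG0 : G ≠ 0) : v.ord G = w.ord G := by
  have key : ∀ (v w : FormValuation k n m), v.ring = w.ring → v.ord G ≤ w.ord G := by
    intro v w h
    obtain ⟨g, hg, hg0, hgv⟩ := v.exists_ord_eq_zero d
    have h1 := hasVal_quot (v := v) hG hg hG0 hg0
    rw [← hasOrd_ring_iff, h, hasOrd_ring_iff] at h1
    have h2 := h1.unique (hasVal_quot hG hg hG0 hg0)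
    omega
  exact le_antisymm (key v w h) (key w v h.symm)

/-- Discrete valuation rings of the function field are maximal subrings: a function of the larger
ring is a unit of `R` times a power of the uniformizer, and the exponent is nonnegative because the
uniformizer has positive value. -/
lemma eq_ring_of_le {R : Subring (CoordField k n m)} (hR : IsDiscreteValuationRing R)
    (hle : R ≤ v.ring)
    (hfrac : ∀ f ∈ functionField k n m, ∃ a ∈ R, ∃ b ∈ R, b ≠ 0 ∧ f = a / b) : R = v.ring := by
  obtain ⟨ϖ, hϖ⟩ := IsDiscreteValuationRing.exists_irreducible R
  have hne : ∀ x : R, x ≠ 0 → (x : CoordField k n m) ≠ 0 := fun x hx h => hx (Subtype.ext h)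
  have hval : ∀ x : R, x ≠ 0 → ∃ r : ℤ, 0 ≤ r ∧ v.HasVal (x : CoordField k n m) r := fun x hx => by
    obtain ⟨r, hr⟩ := v.exists_hasVal (v.ring_le_functionField (hle x.2)) (hne x hx)
    exact ⟨r, hr.mem_ring_iff.1 (hle x.2), hr⟩
  have hunit : ∀ u : Rˣ, v.HasVal ((u : R) : CoordField k n m) 0 := fun u => by
    obtain ⟨r, hr0, hr⟩ := hval u u.ne_zero
    obtain ⟨s, hs0, hs⟩ := hval (u⁻¹ : Rˣ) (u⁻¹).ne_zero
    have h1 := hr.mul hs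
    have h2 : ((u : R) : CoordField k n m) * ((u⁻¹ : Rˣ) : R) = 1 := by
      rw [← Subring.coe_mul, Units.mul_inv, Subring.coe_one]
    rw [h2] at h1
    have := h1.unique v.hasVal_one
    rwa [show r = 0 by omega] at hr
  obtain ⟨s, hs0, hs⟩ := hval ϖ hϖ.ne_zero
  -- every nonzero function is a unit of `R` times a power of `ϖ`
  have hform : ∀ f ∈ functionField k n m, f ≠ 0 → ∃ (u u' : Rˣ) (i j : ℕ),
      f = ((u : R) : CoordField k n m) * (ϖ : CoordField k n m) ^ i /
        (((u' : R) : CoordField k n m) * (ϖ : CoordField k n m) ^ j) := by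
    intro f hf hf0
    obtain ⟨a, ha, b, hb, hb0, rfl⟩ := hfrac f hf
    have ha0 : a ≠ 0 := by rintro rfl; simp at hf0
    obtain ⟨i, u, hu⟩ := IsDiscreteValuationRing.eq_unit_mul_pow_irreducible
      (x := (⟨a, ha⟩ : R)) (fun h => ha0 (congrArg Subtype.val h)) hϖ
    obtain ⟨j, u', hu'⟩ := IsDiscreteValuationRing.eq_unit_mul_pow_irreducible
      (x := (⟨b, hb⟩ : R)) (fun h => hb0 (congrArg Subtype.val h)) hϖ
    refine ⟨u, u', i, j, ?_⟩
    have h1 := congrArg Subtype.val hu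
    have h2 := congrArg Subtype.val hu'
    simp only [Subring.coe_mul, Subring.coe_pow] at h1 h2
    rw [← h1, ← h2]
  have hformval : ∀ (u u' : Rˣ) (i j : ℕ),
      v.HasVal (((u : R) : CoordField k n m) * (ϖ : CoordField k n m) ^ i /
        (((u' : R) : CoordField k n m) * (ϖ : CoordField k n m) ^ j)) (s * (i - j)) := by
    intro u u' i j
    rw [div_eq_mul_inv]
    convert ((hunit u).mul (hs.pow i)).mul ((hunit u').mul (hs.pow j)).inv using 1
    ring
  -- `v` takes the value `1`, so the uniformizer `ϖ` of `R` has nonzero value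
  have hspos : 0 < s := by
    rcases hs0.lt_or_eq with h | h
    · exact h
    · subst h
      obtain ⟨d, G, hG, H, hH, hG0, hH0, hGH⟩ := v.exists_uniformizer
      have hGH' : v.HasVal (quot G H) 1 := ⟨d, G, hG, H, hH, hG0, hH0, rfl, by omega⟩
      obtain ⟨u, u', i, j, he⟩ := hform (quot G H) ⟨d, G, hG, H, hH, by simpa using hH0, rfl⟩
        (quot_ne_zero hG0 hH0)
      rw [he] at hGH'
      have := hGH'.unique (hformval u u' i j)
      omega
  refine le_antisymm hle fun f hf => ?_
  by_cases hf0 : f = 0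
  · rw [hf0]; exact R.zero_mem
  obtain ⟨u, u', i, j, rfl⟩ := hform f (v.ring_le_functionField hf) hf0
  have h1 := (hformval u u' i j).mem_ring_iff.1 hf
  have hij : j ≤ i := by
    by_contra! hlt
    have : (i : ℤ) - j < 0 := by omega
    nlinarith
  have h2 : ((u : R) : CoordField k n m) * (ϖ : CoordField k n m) ^ i /
        (((u' : R) : CoordField k n m) * (ϖ : CoordField k n m) ^ j) =
      ((u * (u'⁻¹ : Rˣ) * ϖ ^ (i - j) : R) : CoordField k n m) := by
    have h3 : ((u' : R) : CoordField k n m) * ((u'⁻¹ : Rˣ) : R) = 1 := by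
      rw [← Subring.coe_mul, Units.mul_inv, Subring.coe_one]
    have h4 := hne _ u'.ne_zero
    have h5 := hne _ hϖ.ne_zero
    obtain ⟨l, rfl⟩ := Nat.exists_eq_add_of_le hij
    rw [div_eq_iff (mul_ne_zero h4 (pow_ne_zero _ h5)), Nat.add_sub_cancel_left]
    push_cast
    rw [pow_add]
    linear_combination (-((u : R) : CoordField k n m) * (ϖ : CoordField k n m) ^ l *
      (ϖ : CoordField k n m) ^ j) * h3
  rw [h2]
  exact Subtype.prop _

/-- The valuation induced by a prime element `π` along an injective ring homomorphism. -/
noncomputable def ofPrime {C : Type*} [CommRing C] [IsDomain C] [WfDvdMonoid C]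
    (φ : CoordRing k n m →+* C) (hφ : Function.Injective φ) {π : C} (hπ : Prime π)
    (hx : ∃ g ∈ biForms k n m (1, 0), ¬ π ∣ φ g)
    (hy : ∃ g ∈ biForms k n m (0, 1), ¬ π ∣ φ g)
    (hu : ∃ d, ∃ G ∈ biForms k n m d, ∃ H ∈ biForms k n m d,
      π ∣ φ G ∧ ¬ π ^ 2 ∣ φ G ∧ ¬ π ∣ φ H) : FormValuation k n m where
  ord F := multiplicity π (φ F)
  ord_mul hF hG := by
    rw [map_mul]
    exact multiplicity_mul hπ (FiniteMultiplicity.of_not_isUnit hπ.not_isUnit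
      (mul_ne_zero ((map_ne_zero_iff _ hφ).2 hF) ((map_ne_zero_iff _ hφ).2 hG)))
  min_le_ord_add {F G} hF hG hFG := by
    rw [map_add]
    have h := FiniteMultiplicity.of_not_isUnit hπ.not_isUnit ((map_ne_zero_iff _ hφ).2 hFG)
    rw [map_add] at h
    refine h.le_multiplicity_of_pow_dvd (dvd_add ?_ ?_)
    · exact pow_dvd_of_le_multiplicity (min_le_left _ _)
    · exact pow_dvd_of_le_multiplicity (min_le_right _ _)
  exists_x := by
    obtain ⟨g, hg, hd⟩ := hx
    exact ⟨g, hg, fun h => hd (by rw [h, map_zero]; exact dvd_zero _),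
      multiplicity_eq_zero.2 hd⟩
  exists_y := by
    obtain ⟨g, hg, hd⟩ := hy
    exact ⟨g, hg, fun h => hd (by rw [h, map_zero]; exact dvd_zero _),
      multiplicity_eq_zero.2 hd⟩
  exists_uniformizer := by
    obtain ⟨d, G, hG, H, hH, h1, h2, h3⟩ := hu
    refine ⟨d, G, hG, H, hH, fun h => h2 (by rw [h, map_zero]; exact dvd_zero _),
      fun h => h3 (by rw [h, map_zero]; exact dvd_zero _), ?_⟩
    rw [multiplicity_eq_zero.2 h3, zero_add]
    exact multiplicity_eq_of_dvd_of_not_dvd (by simpa using h1) h2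

lemma le_ord_ofPrime_iff {C : Type*} [CommRing C] [IsDomain C] [WfDvdMonoid C]
    {φ : CoordRing k n m →+* C} {hφ : Function.Injective φ} {π : C} {hπ : Prime π}
    {hx : ∃ g ∈ biForms k n m (1, 0), ¬ π ∣ φ g}
    {hy : ∃ g ∈ biForms k n m (0, 1), ¬ π ∣ φ g}
    {hu : ∃ d, ∃ G ∈ biForms k n m d, ∃ H ∈ biForms k n m d,
      π ∣ φ G ∧ ¬ π ^ 2 ∣ φ G ∧ ¬ π ∣ φ H} {F : CoordRing k n m} (hF : F ≠ 0) (N : ℕ) :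
    N ≤ (ofPrime φ hφ hπ hx hy hu).ord F ↔ π ^ N ∣ φ F :=
  (FiniteMultiplicity.of_not_isUnit hπ.not_isUnit
    ((map_ne_zero_iff _ hφ).2 hF)).pow_dvd_iff_le_multiplicity.symm

end FormValuation

end FormValuations

/-! ### The valuation of a prime form -/

section PrimeForms

open MvPolynomial

variable {k : Type*} [Field k] {n m : ℕ}

lemma not_dvd_X_or_not_dvd_X {F : CoordRing k n m} (hF : Irreducible F)
    {i j : Fin (n + 1) ⊕ Fin (m + 1)} (hij : i ≠ j) :
    ¬ F ∣ (X i : CoordRing k n m) ∨ ¬ F ∣ (X j : CoordRing k n m) := by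
  by_contra! h
  have h1 : Associated F (X i) := hF.associated_of_dvd (X_prime (i := i)).irreducible h.1
  have h2 : Associated F (X j) := hF.associated_of_dvd (X_prime (i := j)).irreducible h.2
  exact hij (X_dvd_X.1 (h1.symm.trans h2).dvd)

lemma exists_not_dvd_X_inl (hn : 1 ≤ n) {F : CoordRing k n m} (hF : Irreducible F) :
    ∃ i, ¬ F ∣ (X (Sum.inl i) : CoordRing k n m) := by
  have h : (Sum.inl 0 : Fin (n + 1) ⊕ Fin (m + 1)) ≠ Sum.inl (Fin.last n) := by
    simp [Fin.ext_iff]; omega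
  rcases not_dvd_X_or_not_dvd_X hF h with h | h
  exacts [⟨_, h⟩, ⟨_, h⟩]

lemma exists_not_dvd_X_inr (hm : 1 ≤ m) {F : CoordRing k n m} (hF : Irreducible F) :
    ∃ j, ¬ F ∣ (X (Sum.inr j) : CoordRing k n m) := by
  have h : (Sum.inr 0 : Fin (n + 1) ⊕ Fin (m + 1)) ≠ Sum.inr (Fin.last m) := by
    simp [Fin.ext_iff]; omega
  rcases not_dvd_X_or_not_dvd_X hF h with h | h
  exacts [⟨_, h⟩, ⟨_, h⟩]

/-- The multiplicity of the prime form `F` as a factor. -/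
noncomputable def primeVal (hn : 1 ≤ n) (hm : 1 ≤ m) {F : CoordRing k n m} (hF : Irreducible F)
    {d : ℕ × ℕ} (hd : F ∈ biForms k n m d) : FormValuation k n m :=
  FormValuation.ofPrime (RingHom.id _) Function.injective_id hF.prime
    (by
      obtain ⟨i, hi⟩ := exists_not_dvd_X_inl hn hF
      exact ⟨_, X_inl_mem_biForms i, hi⟩)
    (by
      obtain ⟨j, hj⟩ := exists_not_dvd_X_inr hm hF
      exact ⟨_, X_inr_mem_biForms j, hj⟩)
    (by
      obtain ⟨i, hi⟩ := exists_not_dvd_X_inl hn hF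
      obtain ⟨j, hj⟩ := exists_not_dvd_X_inr hm hF
      refine ⟨d, F, hd, X (Sum.inl i) ^ d.1 * X (Sum.inr j) ^ d.2, ?_, dvd_rfl, ?_, ?_⟩
      · have := mul_mem_biForms (pow_mem_biForms (X_inl_mem_biForms (k := k) (m := m) i) d.1)
          (pow_mem_biForms (X_inr_mem_biForms (n := n) j) d.2)
        simpa using this
      · rintro ⟨c, hc⟩
        refine hF.not_isUnit (IsUnit.of_mul_eq_one c ?_)
        simp only [RingHom.id_apply] at hc
        refine mul_left_cancel₀ hF.ne_zero ?_
        rw [mul_one]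
        nth_rewrite 3 [hc]
        ring
      · intro h
        rcases hF.prime.dvd_or_dvd h with h | h
        · exact hi (hF.prime.dvd_of_dvd_pow h)
        · exact hj (hF.prime.dvd_of_dvd_pow h))

lemma le_ord_primeVal_iff {hn : 1 ≤ n} {hm : 1 ≤ m} {F : CoordRing k n m} {hF : Irreducible F}
    {d : ℕ × ℕ} {hd : F ∈ biForms k n m d} {G : CoordRing k n m} (hG : G ≠ 0) (N : ℕ) :
    N ≤ (primeVal hn hm hF hd).ord G ↔ F ^ N ∣ G :=
  FormValuation.le_ord_ofPrime_iff hG N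

lemma ord_primeVal_eq_zero_iff {hn : 1 ≤ n} {hm : 1 ≤ m} {F : CoordRing k n m}
    {hF : Irreducible F} {d : ℕ × ℕ} {hd : F ∈ biForms k n m d} {G : CoordRing k n m}
    (hG : G ≠ 0) : (primeVal hn hm hF hd).ord G = 0 ↔ ¬ F ∣ G := by
  have := le_ord_primeVal_iff (hn := hn) (hm := hm) (hF := hF) (hd := hd) hG 1
  rw [pow_one] at this
  rw [← this]
  omega

lemma ord_primeVal_self {hn : 1 ≤ n} {hm : 1 ≤ m} {F : CoordRing k n m}
    {hF : Irreducible F} {d : ℕ × ℕ} {hd : F ∈ biForms k n m d} :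
    (primeVal hn hm hF hd).ord F = 1 := by
  have h1 := le_ord_primeVal_iff (hn := hn) (hm := hm) (hF := hF) (hd := hd) hF.ne_zero 1
  have h2 := le_ord_primeVal_iff (hn := hn) (hm := hm) (hF := hF) (hd := hd) hF.ne_zero 2
  have h3 : ¬ F ^ 2 ∣ F := by
    rintro ⟨c, hc⟩
    refine hF.not_isUnit (IsUnit.of_mul_eq_one c ?_)
    refine mul_left_cancel₀ hF.ne_zero ?_
    rw [mul_one]
    nth_rewrite 3 [hc]
    ring
  rw [pow_one] at h1
  have h4 := h1.2 dvd_rfl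
  have h5 := mt h2.1 h3
  omega

/-- Fractions whose denominator lies outside a prime ideal containing `F` are regular along
`F = 0`. -/
lemma homLocalization_le_ring_primeVal {hn : 1 ≤ n} {hm : 1 ≤ m} {F : CoordRing k n m}
    {hF : Irreducible F} {d : ℕ × ℕ} {hd : F ∈ biForms k n m d} {P : Ideal (CoordRing k n m)}
    [P.IsPrime] (hFP : F ∈ P) : homLocalization P ≤ (primeVal hn hm hF hd).ring := by
  rintro _ ⟨e, G, hG, H, hH, hHP, rfl⟩
  have hH0 : H ≠ 0 := fun h => hHP (h ▸ P.zero_mem)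
  refine ⟨e, G, hG, H, hH, hH0, fun _ => ?_, rfl⟩
  rw [(ord_primeVal_eq_zero_iff hH0).2 fun h => hHP (P.mem_of_dvd h hFP)]
  exact Nat.zero_le _

lemma ring_primeVal_eq_homLocalization {hn : 1 ≤ n} {hm : 1 ≤ m} {F : CoordRing k n m}
    {hF : Irreducible F} {d : ℕ × ℕ} {hd : F ∈ biForms k n m d}
    [hP : (Ideal.span {F} : Ideal (CoordRing k n m)).IsPrime] :
    (primeVal hn hm hF hd).ring = homLocalization (Ideal.span {F}) := by
  refine le_antisymm ?_ (homLocalization_le_ring_primeVal (Ideal.mem_span_singleton_self F))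
  rintro _ ⟨e, G, hG, H, hH, hH0, hle, rfl⟩
  by_cases hG0 : G = 0
  · subst hG0
    rw [show quot (0 : CoordRing k n m) H = 0 by simp [quot]]
    exact Subring.zero_mem _
  -- cancel the power of `F` that divides the denominator
  obtain ⟨N, hN⟩ : ∃ N, N = (primeVal hn hm hF hd).ord H := ⟨_, rfl⟩
  have hle' := hN.le.trans (hle hG0)
  obtain ⟨H', rfl⟩ := (le_ord_primeVal_iff (hF := hF) (hd := hd) hH0 N).1 hN.le
  obtain ⟨G', rfl⟩ := (le_ord_primeVal_iff (hF := hF) (hd := hd) hG0 N).1 hle'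
  have hFN := left_ne_zero_of_mul hH0
  obtain ⟨e₁, e₂, h1, h2, h12⟩ := exists_mem_biForms_of_mul hH0 hH
  obtain ⟨e₁', e₂', h1', h2', h12'⟩ := exists_mem_biForms_of_mul hG0 hG
  obtain rfl := biForms_degree_unique hFN h1 h1'
  obtain rfl : e₂ = e₂' := add_left_cancel (h12.trans h12'.symm)
  refine ⟨e₂, G', h2', H', h2, fun h => ?_, ?_⟩
  · rw [Ideal.mem_span_singleton] at h
    have := (le_ord_primeVal_iff (hn := hn) (hm := hm) (hF := hF) (hd := hd) hH0 (N + 1)).2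
      (by rw [pow_succ]; exact mul_dvd_mul_left _ h)
    omega
  · rw [← quot_mul_quot, quot_self hFN, one_mul]

lemma isBihomogeneous_span {F : CoordRing k n m} {d : ℕ × ℕ} (hd : F ∈ biForms k n m d) :
    IsBihomogeneous (Ideal.span {F}) := by
  let _ := weightedGradedAlgebra k (biweight n m)
  intro f hf e
  refine weightedHomogeneousComponent_mem_of_mem k _ (Ideal.homogeneous_span _ _ ?_) hf e
  rintro x rfl
  exact ⟨d, hd⟩

lemma ring_primeVal_mem_productModel {hn : 1 ≤ n} {hm : 1 ≤ m} {F : CoordRing k n m}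
    {hF : Irreducible F} {d : ℕ × ℕ} {hd : F ∈ biForms k n m d} :
    (primeVal hn hm hF hd).ring ∈ productModel k n m := by
  have hP := (Ideal.span_singleton_prime hF.ne_zero).2 hF.prime
  refine ⟨_, hP, isBihomogeneous_span hd, ⟨?_, ?_⟩, ring_primeVal_eq_homLocalization⟩
  · obtain ⟨i, hi⟩ := exists_not_dvd_X_inl hn hF
    exact ⟨i, fun h => hi (Ideal.mem_span_singleton.1 h)⟩
  · obtain ⟨i, hi⟩ := exists_not_dvd_X_inr hm hF
    exact ⟨i, fun h => hi (Ideal.mem_span_singleton.1 h)⟩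

/-- A prime that contains a nonzero form contains one of its irreducible factors. -/
lemma exists_irreducible_form_mem {P : Ideal (CoordRing k n m)} [hP : P.IsPrime]
    {f : CoordRing k n m} (h0 : f ≠ 0) {d : ℕ × ℕ} (hf : f ∈ biForms k n m d) (hfP : f ∈ P) :
    ∃ F e, Irreducible F ∧ F ∈ biForms k n m e ∧ F ∈ P := by
  refine form_induction (motive := fun f _ => f ∈ P → ∃ F e, Irreducible F ∧
    F ∈ biForms k n m e ∧ F ∈ P) ?_ ?_ h0 hf hfP
  · intro f h0 hf hfP
    exact absurd (P.eq_top_of_isUnit_mem hfP (isUnit_of_mem_biForms_zero h0 hf)) hP.ne_top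
  · intro f g d e hf hd hg he ih h
    rcases hP.mem_or_mem h with h | h
    · exact ⟨f, d, hf, hd, h⟩
    · exact ih h

/-- The function field is the field of fractions of the local ring of any point. -/
lemma exists_eq_div_of_homLocalization_le {P : Ideal (CoordRing k n m)} [hP : P.IsPrime]
    (hrel : IsRelevant P) {R : Subring (CoordField k n m)} (hR : homLocalization P ≤ R) :
    ∀ f ∈ functionField k n m, ∃ a ∈ R, ∃ b ∈ R, b ≠ 0 ∧ f = a / b := by
  rintro _ ⟨d, G, hG, H, hH, hH0, rfl⟩
  obtain ⟨⟨i, hi⟩, ⟨j, hj⟩⟩ := hrel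
  set g : CoordRing k n m := X (Sum.inl i) ^ d.1 * X (Sum.inr j) ^ d.2 with hgdef
  have hg : g ∈ biForms k n m d := by
    have := mul_mem_biForms (pow_mem_biForms (X_inl_mem_biForms (k := k) (m := m) i) d.1)
      (pow_mem_biForms (X_inr_mem_biForms (n := n) j) d.2)
    simpa using this
  have hgP : g ∉ P := fun h => (hP.mem_or_mem h).elim (fun h => hi (hP.mem_of_pow_mem _ h))
    fun h => hj (hP.mem_of_pow_mem _ h)
  have hg0 : g ≠ 0 := fun h => hgP (h ▸ P.zero_mem)
  refine ⟨quot G g, hR ⟨d, G, hG, g, hg, hgP, rfl⟩, quot H g, hR ⟨d, H, hH, g, hg, hgP, rfl⟩,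
    quot_ne_zero (by simpa using hH0) hg0, (quot_div_quot hg0).symm⟩

/-- A point of codimension one of `ℙⁿ × ℙᵐ` is the generic point of an irreducible
hypersurface. -/
lemma exists_eq_ring_primeVal_of_mem_productModel (hn : 1 ≤ n) (hm : 1 ≤ m)
    {R : Subring (CoordField k n m)} (hR : R ∈ productModel k n m)
    (hdvr : IsDiscreteValuationRing R) :
    ∃ (F : CoordRing k n m) (d : ℕ × ℕ) (hF : Irreducible F) (hd : F ∈ biForms k n m d),
      R = (primeVal hn hm hF hd).ring := by
  obtain ⟨P, hP, hbi, hrel, rfl⟩ := hR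
  -- at the generic point the local ring is the function field
  have hex : ∃ f ∈ P, ∃ d, f ∈ biForms k n m d ∧ f ≠ 0 := by
    by_contra! h
    have hbot : P = ⊥ := by
      rw [eq_bot_iff]
      intro f hf
      rw [Ideal.mem_bot, ← finsum_weightedHomogeneousComponent (biweight n m) f]
      exact finsum_eq_zero_of_forall_eq_zero fun d =>
        h _ (hbi f hf d) d (weightedHomogeneousComponent_mem _ _ _)
    subst hbot
    refine hdvr.not_isField _ ⟨exists_pair_ne _, mul_comm, ?_⟩
    rintro ⟨_, d, G, hG, H, hH, hH0, rfl⟩ hx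
    have hG0 : G ≠ 0 := ne_zero_of_quot_ne_zero fun h => hx (Subtype.ext h)
    refine ⟨⟨quot H G, d, H, hH, G, hG, by simpa using hG0, rfl⟩, Subtype.ext ?_⟩
    change quot G H * quot H G = 1
    rw [quot_mul_quot, mul_comm H, quot_self (mul_ne_zero hG0 (by simpa using hH0))]
  obtain ⟨f, hfP, d, hf, h0⟩ := hex
  obtain ⟨F, e, hF, he, hFP⟩ := exists_irreducible_form_mem h0 hf hfP
  exact ⟨F, e, hF, he, FormValuation.eq_ring_of_le hdvr (homLocalization_le_ring_primeVal hFP)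
    (exists_eq_div_of_homLocalization_le hrel le_rfl)⟩

/-! ### Local rings at closed points -/

lemma mem_localRingAt {x : ProdPoint k n m} {f : CoordField k n m} :
    f ∈ localRingAt x ↔ ∃ d, ∃ G ∈ biForms k n m d, ∃ H ∈ biForms k n m d,
      eval (Sum.elim x.1.rep x.2.rep) H ≠ 0 ∧ f = quot G H :=
  Iff.rfl

lemma isRelevant_ker_eval (x : ProdPoint k n m) :
    IsRelevant (RingHom.ker (eval (Sum.elim x.1.rep x.2.rep) : CoordRing k n m →+* k)) := by
  constructor
  · obtain ⟨i, hi⟩ := Function.ne_iff.1 x.1.rep_nonzero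
    exact ⟨i, by simpa [RingHom.mem_ker] using hi⟩
  · obtain ⟨i, hi⟩ := Function.ne_iff.1 x.2.rep_nonzero
    exact ⟨i, by simpa [RingHom.mem_ker] using hi⟩

lemma isUnit_localRingAt_iff {x : ProdPoint k n m} {a : localRingAt x} {d : ℕ × ℕ}
    {G H : CoordRing k n m} (hG : G ∈ biForms k n m d) (hH : H ∈ biForms k n m d)
    (hHx : eval (Sum.elim x.1.rep x.2.rep) H ≠ 0) (ha : (a : CoordField k n m) = quot G H) :
    IsUnit a ↔ eval (Sum.elim x.1.rep x.2.rep) G ≠ 0 := by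
  have hH0 : H ≠ 0 := fun h => hHx (by rw [h, map_zero])
  constructor
  · intro h hGx
    obtain ⟨b, hb⟩ := h.dvd (a := 1)
    obtain ⟨e, G', hG', H', hH', hHx', hb'⟩ := mem_localRingAt.1 b.2
    have hH0' : H' ≠ 0 := fun h => hHx' (by rw [h, map_zero])
    have h1 : (1 : CoordField k n m) = a * b := congrArg Subtype.val hb
    rw [ha, hb', quot_mul_quot, ← quot_self (one_ne_zero (α := CoordRing k n m)),
      quot_eq_quot_iff one_ne_zero (mul_ne_zero hH0 hH0'), one_mul, mul_one] at h1
    have h2 := congrArg (eval (Sum.elim x.1.rep x.2.rep)) h1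
    rw [map_mul, map_mul, hGx, zero_mul] at h2
    exact mul_ne_zero hHx hHx' h2
  · intro hGx
    have hG0 : G ≠ 0 := fun h => hGx (by rw [h, map_zero])
    refine IsUnit.of_mul_eq_one ⟨quot H G, mem_localRingAt.2 ⟨d, H, hH, G, hG, hGx, rfl⟩⟩
      (Subtype.ext ?_)
    change (a : CoordField k n m) * quot H G = 1
    rw [ha, quot_mul_quot, mul_comm H, quot_self (mul_ne_zero hG0 hH0)]

lemma exists_form_eval_ne_zero (x : ProdPoint k n m) (d : ℕ × ℕ) :
    ∃ g ∈ biForms k n m d, eval (Sum.elim x.1.rep x.2.rep) g ≠ 0 := by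
  obtain ⟨i, hi⟩ := Function.ne_iff.1 x.1.rep_nonzero
  obtain ⟨j, hj⟩ := Function.ne_iff.1 x.2.rep_nonzero
  refine ⟨X (Sum.inl i) ^ d.1 * X (Sum.inr j) ^ d.2, ?_, ?_⟩
  · have := mul_mem_biForms (pow_mem_biForms (X_inl_mem_biForms (k := k) (m := m) i) d.1)
      (pow_mem_biForms (X_inr_mem_biForms (n := n) j) d.2)
    simpa using this
  · simp only [map_mul, map_pow, eval_X, Sum.elim_inl, Sum.elim_inr]
    exact mul_ne_zero (pow_ne_zero _ hi) (pow_ne_zero _ hj)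

/-- A valuation ring whose local ring dominates the local ring at `x` is positive on the forms
that vanish at `x`. -/
lemma ord_pos_of_dominates {v : FormValuation k n m} {x : ProdPoint k n m}
    (h : ∃ h : localRingAt x ≤ v.ring, IsLocalHom (Subring.inclusion h)) {d : ℕ × ℕ}
    {G : CoordRing k n m} (hG : G ∈ biForms k n m d) (hG0 : G ≠ 0)
    (hGx : eval (Sum.elim x.1.rep x.2.rep) G = 0) : 0 < v.ord G := by
  obtain ⟨hle, hloc⟩ := h
  obtain ⟨g, hg, hgx⟩ := exists_form_eval_ne_zero x d
  have hg0 : g ≠ 0 := fun h => hgx (by rw [h, map_zero])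
  have hmem : quot G g ∈ localRingAt x := mem_localRingAt.2 ⟨d, G, hG, g, hg, hgx, rfl⟩
  have hval := FormValuation.hasVal_quot (v := v) hG hg hG0 hg0
  have h1 := hval.mem_ring_iff.1 (hle hmem)
  by_contra h2
  have h3 : IsUnit (Subring.inclusion hle ⟨quot G g, hmem⟩) :=
    FormValuation.HasVal.isUnit_iff (x := Subring.inclusion hle ⟨quot G g, hmem⟩) hval |>.2
      (by omega)
  exact (isUnit_localRingAt_iff hG hg hgx rfl).1 (isUnit_of_map_unit _ _ h3) hGx

end PrimeForms

/-! ### Coordinates adapted to the points -/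

section Frames

open MvPolynomial

variable {k : Type*} [Field k] {n : ℕ}

/-- The dual basis of `N` independent vectors in `kᴺ`, with both of its duality relations. -/
lemma exists_dual_family {κ : Type*} [Fintype κ] [DecidableEq κ] [Nonempty κ] {N : ℕ}
    (v : κ → Fin N → k) (hv : LinearIndependent k v) (hcard : Fintype.card κ = N) :
    ∃ ℓ : κ → Fin N → k, (∀ i j, ∑ r, ℓ i r * v j r = if i = j then 1 else 0) ∧
      (∀ r s, ∑ i, v i r * ℓ i s = if r = s then 1 else 0) := by
  classical
  let b := basisOfLinearIndependentOfCardEqFinrank hv (by simpa using hcard)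
  have hb : ∀ i, b i = v i := fun i => by simp [b]
  refine ⟨fun i r => b.repr (Pi.single r 1) i, fun i j => ?_, fun r s => ?_⟩
  · have h1 : v j = ∑ r, v j r • (Pi.single r 1 : Fin N → k) := by
      ext t
      simp [Finset.sum_apply, Pi.single_apply]
    have h2 : b.repr (v j) i = if i = j then 1 else 0 := by
      rw [← hb, b.repr_self, Finsupp.single_apply]
      simp only [eq_comm]
    rw [← h2]
    nth_rewrite 2 [h1]
    simp [map_sum, Finsupp.finsetSum_apply, mul_comm]
  · have h1 := congrFun (b.sum_repr (Pi.single s 1)) r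
    simp only [hb, Finset.sum_apply, Pi.smul_apply, smul_eq_mul, Pi.single_apply] at h1
    rw [← h1]
    exact Finset.sum_congr rfl fun i _ => mul_comm _ _

/-- Vectors `aᵢ ∈ kⁿ⁺¹` and `qᵢ ∈ kⁿ⁺²`, for `n + 2` indices `i`, in general position: the `qᵢ`
form a basis with dual basis `eta`, and the `aⱼ` satisfy one linear relation, whose coefficients
`cⱼ` are all nonzero. For each `j` the `aₗ` with `l ≠ j` form a basis, whose dual basis is
`ell j`, extended by `0` at the index `j`. -/
structure Frame (k : Type*) [Field k] (n : ℕ) where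
  /-- representatives in the first factor -/
  a : Fin (n + 2) → Fin (n + 1) → k
  /-- representatives in the second factor -/
  q : Fin (n + 2) → Fin (n + 2) → k
  /-- coefficients of the linear relation among the `aᵢ` -/
  c : Fin (n + 2) → k
  /-- dual bases in the first factor -/
  ell : Fin (n + 2) → Fin (n + 2) → Fin (n + 1) → k
  /-- dual basis in the second factor -/
  eta : Fin (n + 2) → Fin (n + 2) → k
  c_ne_zero : ∀ j, c j ≠ 0
  sum_c_mul_a : ∀ r, ∑ j, c j * a j r = 0
  ell_self : ∀ j, ell j j = 0
  ell_dual : ∀ {j l l'}, l ≠ j → l' ≠ j → ∑ r, ell j l r * a l' r = if l = l' then 1 else 0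
  sum_a_mul_ell : ∀ j r s, ∑ l, a l r * ell j l s = if r = s then 1 else 0
  eta_dual : ∀ l l', ∑ r, eta l r * q l' r = if l = l' then 1 else 0
  sum_q_mul_eta : ∀ r s, ∑ l, q l r * eta l s = if r = s then 1 else 0

/-- Points in linearly general position give a frame. -/
lemma exists_frame {p : Fin (n + 2) → ProdPoint k n (n + 1)} (hp : LinearlyGeneral p) :
    ∃ fr : Frame k n, (∀ i, fr.a i = (p i).1.rep) ∧ ∀ i, fr.q i = (p i).2.rep := by
  classical
  set a : Fin (n + 2) → Fin (n + 1) → k := fun i => (p i).1.rep with ha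
  set q : Fin (n + 2) → Fin (n + 2) → k := fun i => (p i).2.rep with hq
  have hq' : LinearIndependent k q := by
    have h := hp.2 Finset.univ (by simp)
    rw [Projectivization.independent_iff] at h
    exact h.comp (fun i => ⟨i, Finset.mem_univ i⟩) fun i j hij => by simpa using hij
  have ha' : ∀ j : Fin (n + 2), LinearIndependent k (fun l : {l // l ≠ j} => a l) := by
    intro j
    have h := hp.1 (Finset.univ.erase j) (by simp)
    rw [Projectivization.independent_iff] at h
    exact h.comp (fun l : {l // l ≠ j} => ⟨l, by simpa using l.2⟩) fun l l' hl =>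
      Subtype.ext (by simpa using hl)
  obtain ⟨eta, heta1, heta2⟩ := exists_dual_family q hq' (by simp)
  have hne : ∀ j : Fin (n + 2), Nonempty {l // l ≠ j} := fun j =>
    let ⟨l, hl⟩ := exists_ne j; ⟨⟨l, hl⟩⟩
  have hell := fun j : Fin (n + 2) => exists_dual_family (fun l : {l // l ≠ j} => a l) (ha' j)
    (by simp [Fintype.card_subtype_compl])
  choose ell hell1 hell2 using hell
  have hdep : ¬ LinearIndependent k a := fun h => by
    have := h.fintype_card_le_finrank
    simp at this
  rw [Fintype.not_linearIndependent_iff] at hdep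
  obtain ⟨c, hc, i₀, hi₀⟩ := hdep
  -- a relation with a zero coefficient would involve only `n + 1` of the vectors
  have hcne : ∀ j, c j ≠ 0 := by
    intro j hj
    have h1 := Fintype.linearIndependent_iff.1 (ha' j) (fun l => c l) (by
      rw [← hc, ← Finset.sum_erase Finset.univ (a := j) (by rw [hj, zero_smul])]
      rw [← Finset.sum_subtype (Finset.univ.erase j) (p := fun l => l ≠ j) (by simp)
        (fun l => c l • a l)])
    by_cases h : i₀ = j
    · exact hi₀ (h ▸ hj)
    · exact hi₀ (h1 ⟨i₀, h⟩)
  refine ⟨⟨a, q, c, fun j l => if h : l ≠ j then ell j ⟨l, h⟩ else 0, eta, hcne, fun r => ?_,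
    fun j => by simp, ?_, ?_, heta1, heta2⟩, fun i => rfl, fun i => rfl⟩
  · simpa [Finset.sum_apply] using congrFun hc r
  · intro j l l' hl hl'
    simp only [dif_pos hl]
    have := hell1 j ⟨l, hl⟩ ⟨l', hl'⟩
    simpa using this
  · intro j r s
    rw [← hell2 j r s, ← Finset.sum_erase Finset.univ (a := j) (by simp),
      Finset.sum_subtype (Finset.univ.erase j) (p := fun l => l ≠ j) (by simp)]
    exact Finset.sum_congr rfl fun l _ => by rw [dif_pos l.2]

namespace Frame

variable (fr : Frame k n)

/-- Apply `ell j l` to the relation `∑ cᵢ aᵢ = 0`. -/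
lemma ell_apply_self {j l : Fin (n + 2)} (hl : l ≠ j) :
    ∑ r, fr.ell j l r * fr.a j r = - (fr.c l / fr.c j) := by
  have h1 : ∑ i, fr.c i * ∑ r, fr.ell j l r * fr.a i r = 0 := by
    simp only [Finset.mul_sum]
    rw [Finset.sum_comm]
    refine Finset.sum_eq_zero fun r _ => ?_
    have := fr.sum_c_mul_a r
    calc ∑ i, fr.c i * (fr.ell j l r * fr.a i r)
        = fr.ell j l r * ∑ i, fr.c i * fr.a i r := by
          rw [Finset.mul_sum]; exact Finset.sum_congr rfl fun i _ => by ring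
      _ = 0 := by rw [this, mul_zero]
  rw [← Finset.add_sum_erase _ _ (Finset.mem_univ j)] at h1
  have h2 : ∑ i ∈ Finset.univ.erase j, fr.c i * ∑ r, fr.ell j l r * fr.a i r = fr.c l := by
    rw [Finset.sum_congr rfl fun i hi => by
      rw [fr.ell_dual hl (Finset.ne_of_mem_erase hi)]]
    simp [hl]
  rw [h2] at h1
  have := fr.c_ne_zero j
  field_simp
  linear_combination h1

/-- The linear form in the `xᵢ` with coefficients `ell j l`. -/
noncomputable def formX (j l : Fin (n + 2)) : CoordRing k n (n + 1) :=
  ∑ r, C (fr.ell j l r) * X (Sum.inl r)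

/-- The linear form in the `yᵢ` with coefficients `eta l`. -/
noncomputable def formY (l : Fin (n + 2)) : CoordRing k n (n + 1) :=
  ∑ r : Fin (n + 1 + 1), C (fr.eta l r) * X (Sum.inr r)

lemma formX_mem (j l : Fin (n + 2)) : fr.formX j l ∈ biForms k n (n + 1) (1, 0) :=
  Submodule.sum_mem _ fun r _ => by
    have := mul_mem_biForms (C_mem_biForms (n := n) (m := n + 1) (fr.ell j l r))
      (X_inl_mem_biForms r)
    simpa using this

lemma formY_mem (l : Fin (n + 2)) : fr.formY l ∈ biForms k n (n + 1) (0, 1) :=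
  Submodule.sum_mem _ fun r _ => by
    have := mul_mem_biForms (C_mem_biForms (n := n) (m := n + 1) (fr.eta l r))
      (X_inr_mem_biForms r)
    simpa using this

lemma formX_self (j : Fin (n + 2)) : fr.formX j j = 0 := by
  simp [formX, fr.ell_self]

/-- The coordinates of the point `i`. -/
def point (i : Fin (n + 2)) : Fin (n + 1) ⊕ Fin (n + 1 + 1) → k := Sum.elim (fr.a i) (fr.q i)

lemma eval_formX {j l i : Fin (n + 2)} (hl : l ≠ j) (hi : i ≠ j) :
    eval (fr.point i) (fr.formX j l) = if l = i then 1 else 0 := by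
  rw [← fr.ell_dual hl hi]
  simp [formX, point]

lemma eval_formX_self {j l : Fin (n + 2)} (hl : l ≠ j) :
    eval (fr.point j) (fr.formX j l) = - (fr.c l / fr.c j) := by
  rw [← fr.ell_apply_self hl]
  simp [formX, point]

lemma eval_formY (l i : Fin (n + 2)) :
    eval (fr.point i) (fr.formY l) = if l = i then 1 else 0 := by
  rw [← fr.eta_dual l i]
  simp [formY, point]

lemma formX_ne_zero {j l : Fin (n + 2)} (hl : l ≠ j) : fr.formX j l ≠ 0 := fun h => by
  have := fr.eval_formX hl hl
  simp [h] at this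

lemma formY_ne_zero (l : Fin (n + 2)) : fr.formY l ≠ 0 := fun h => by
  have := fr.eval_formY l l
  simp [h] at this

/-- Pullback of polynomials along `(u, y) ↦ (∑ uⱼ aⱼ, ∑ yⱼ qⱼ)`. -/
noncomputable def psi : CoordRing k n (n + 1) →ₐ[k] CoordRing k (n + 1) (n + 1) :=
  aeval (Sum.elim (fun r => ∑ j, C (fr.a j r) * X (Sum.inl j))
    (fun r => ∑ j, C (fr.q j r) * X (Sum.inr j)))

/-- The retraction `uₗ ↦ formX j l`, `yₗ ↦ formY l` of `psi`. -/
noncomputable def sec (j : Fin (n + 2)) :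
    CoordRing k (n + 1) (n + 1) →ₐ[k] CoordRing k n (n + 1) :=
  aeval (Sum.elim (fr.formX j) fr.formY)

lemma sec_psi (j : Fin (n + 2)) (f : CoordRing k n (n + 1)) : fr.sec j (fr.psi f) = f := by
  rw [← AlgHom.comp_apply]
  conv_rhs => rw [← AlgHom.id_apply (R := k) f]
  congr 1
  apply algHom_ext
  have hC : ∀ b : k, fr.sec j (C b) = C b := fun b => (fr.sec j).commutes b
  rintro (r | r)
  · simp only [AlgHom.comp_apply, psi, aeval_X, Sum.elim_inl, map_sum, map_mul, AlgHom.id_apply,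
      hC]
    simp only [sec, aeval_X, Sum.elim_inl, formX, Finset.mul_sum]
    rw [Finset.sum_comm]
    simp only [← mul_assoc, ← C_mul, ← Finset.sum_mul, ← map_sum, fr.sum_a_mul_ell]
    simp
  · simp only [AlgHom.comp_apply, psi, aeval_X, Sum.elim_inr, map_sum, map_mul, AlgHom.id_apply,
      hC]
    simp only [sec, aeval_X, Sum.elim_inr, formY, Finset.mul_sum]
    rw [Finset.sum_comm]
    simp only [← mul_assoc, ← C_mul, ← Finset.sum_mul, ← map_sum, fr.sum_q_mul_eta]
    simp

lemma psi_injective : Function.Injective fr.psi :=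
  Function.LeftInverse.injective (fr.sec_psi 0)

lemma psi_formY (l : Fin (n + 2)) : fr.psi (fr.formY l) = X (Sum.inr l) := by
  have hC : ∀ b : k, fr.psi (C b) = C b := fun b => fr.psi.commutes b
  simp only [formY, map_sum, map_mul, hC]
  simp only [psi, aeval_X, Sum.elim_inr, Finset.mul_sum]
  rw [Finset.sum_comm]
  simp only [← mul_assoc, ← C_mul, ← Finset.sum_mul, ← map_sum, fr.eta_dual]
  simp

lemma psi_formX {j l : Fin (n + 2)} (hl : l ≠ j) :
    fr.psi (fr.formX j l) = X (Sum.inl l) - C (fr.c l / fr.c j) * X (Sum.inl j) := by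
  have hC : ∀ b : k, fr.psi (C b) = C b := fun b => fr.psi.commutes b
  simp only [formX, map_sum, map_mul, hC]
  simp only [psi, aeval_X, Sum.elim_inl, Finset.mul_sum]
  rw [Finset.sum_comm]
  simp only [← mul_assoc, ← C_mul, ← Finset.sum_mul, ← map_sum]
  rw [← Finset.add_sum_erase _ _ (Finset.mem_univ j), fr.ell_apply_self hl,
    Finset.sum_congr rfl fun i hi => by rw [fr.ell_dual hl (Finset.ne_of_mem_erase hi)]]
  simp [hl]
  ring

lemma eval_psi (w : Fin (n + 2) ⊕ Fin (n + 2) → k) (f : CoordRing k n (n + 1)) :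
    eval w (fr.psi f) = eval (Sum.elim (fun r => ∑ j, fr.a j r * w (Sum.inl j))
      (fun r => ∑ j, fr.q j r * w (Sum.inr j))) f := by
  have h : (eval w).comp (fr.psi : CoordRing k n (n + 1) →+* _) =
      eval (Sum.elim (fun r => ∑ j, fr.a j r * w (Sum.inl j))
      (fun r => ∑ j, fr.q j r * w (Sum.inr j))) := by
    apply ringHom_ext
    · intro b
      simp [show fr.psi (C b) = C b from fr.psi.commutes b]
    · rintro (r | r) <;> simp [psi]
  exact congrArg (fun φ : CoordRing k n (n + 1) →+* k => φ f) h

lemma eval_psi_single (i : Fin (n + 2)) (f : CoordRing k n (n + 1)) :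
    eval (Sum.elim (fun j => if j = i then 1 else 0) (fun j => if j = i then 1 else 0))
      (fr.psi f) = eval (fr.point i) f := by
  rw [eval_psi]
  simp only [point, Sum.elim_inl, Sum.elim_inr, mul_ite, mul_one, mul_zero, Finset.sum_ite_eq',
    Finset.mem_univ, if_true]

lemma psi_mem {f : CoordRing k n (n + 1)} {d : ℕ × ℕ} (hf : f ∈ biForms k n (n + 1) d) :
    fr.psi f ∈ biForms k (n + 1) (n + 1) d := by
  rw [psi, aeval_def, eval₂_eq']
  refine Submodule.sum_mem _ fun s hs => ?_
  have h1 : ∀ i, (Sum.elim (fun r => ∑ j, C (fr.a j r) * X (Sum.inl j))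
      (fun r => ∑ j, C (fr.q j r) * X (Sum.inr j)) i : CoordRing k (n + 1) (n + 1)) ∈
      biForms k (n + 1) (n + 1) (biweight n (n + 1) i) := by
    rintro (r | r)
    · refine Submodule.sum_mem _ fun j _ => ?_
      have := mul_mem_biForms (C_mem_biForms (n := n + 1) (m := n + 1) (fr.a j r))
        (X_inl_mem_biForms j)
      rwa [zero_add] at this
    · refine Submodule.sum_mem _ fun j _ => ?_
      have := mul_mem_biForms (C_mem_biForms (n := n + 1) (m := n + 1) (fr.q j r))
        (X_inr_mem_biForms j)
      rwa [zero_add] at this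
  have h2 : (∏ i, (Sum.elim (fun r => ∑ j, C (fr.a j r) * X (Sum.inl j))
      (fun r => ∑ j, C (fr.q j r) * X (Sum.inr j)) i) ^ s i : CoordRing k (n + 1) (n + 1)) ∈
      biForms k (n + 1) (n + 1) (∑ i, s i • biweight n (n + 1) i) :=
    IsWeightedHomogeneous.prod _ _ _ fun i _ => pow_mem_biForms (h1 i) _
  have h3 : ∑ i, s i • biweight n (n + 1) i = d := by
    rw [← hf (mem_support_iff.1 hs), Finsupp.weight_apply, Finsupp.sum_fintype _ _ (by simp)]
  rw [h3] at h2
  have := mul_mem_biForms (C_mem_biForms (n := n + 1) (m := n + 1) (coeff s f)) h2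
  rwa [zero_add] at this

/-! ### The multiplicity at a point -/

/-- The weight that counts the variables other than `uᵢ` and `yᵢ`. -/
def pointWeight (n : ℕ) (i : Fin (n + 2)) : Fin (n + 1 + 1) ⊕ Fin (n + 1 + 1) → ℕ :=
  Sum.elim (fun j => if j = i then 0 else 1) (fun j => if j = i then 0 else 1)

/-- The pullback of polynomials along the family of linear maps, with parameter `T`, that fix the
point `i` and contract everything else to it as `T` goes to `0`. -/
noncomputable def contract (i : Fin (n + 2)) :
    CoordRing k n (n + 1) →+* Polynomial (CoordRing k (n + 1) (n + 1)) :=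
  (weightHom (pointWeight n i)).toRingHom.comp fr.psi.toRingHom

lemma contract_injective (i : Fin (n + 2)) : Function.Injective (fr.contract i) :=
  (weightHom_injective _).comp fr.psi_injective

lemma X_pow_dvd_contract_iff (i : Fin (n + 2)) (f : CoordRing k n (n + 1)) (N : ℕ) :
    Polynomial.X ^ N ∣ fr.contract i f ↔
      ∀ s ∈ (fr.psi f).support, N ≤ Finsupp.weight (pointWeight n i) s :=
  X_pow_dvd_weightHom_iff _ _ _

lemma X_dvd_contract_iff (i : Fin (n + 2)) (f : CoordRing k n (n + 1)) :
    Polynomial.X ∣ fr.contract i f ↔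
      ∀ s ∈ (fr.psi f).support, 1 ≤ Finsupp.weight (pointWeight n i) s := by
  rw [← X_pow_dvd_contract_iff, pow_one]

lemma not_X_dvd_contract_formX {i j : Fin (n + 2)} (h : i ≠ j) :
    ¬ Polynomial.X ∣ fr.contract i (fr.formX j i) := by
  classical
  rw [X_dvd_contract_iff, psi_formX _ h]
  intro hs
  have := hs (Finsupp.single (Sum.inl i) 1) (by
    rw [mem_support_iff, coeff_sub, coeff_C_mul, coeff_X, coeff_X, if_pos rfl,
      if_neg (by simp [Finsupp.single_left_inj, h.symm])]
    simp)
  simp [Finsupp.weight_single, pointWeight] at this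

lemma not_X_dvd_contract_formY (i : Fin (n + 2)) :
    ¬ Polynomial.X ∣ fr.contract i (fr.formY i) := by
  rw [X_dvd_contract_iff, psi_formY]
  simp [support_X, Finsupp.weight_single, pointWeight]

/-- The multiplicity at the point `i`. -/
noncomputable def pointVal (i : Fin (n + 2)) : FormValuation k n (n + 1) :=
  FormValuation.ofPrime (fr.contract i) (fr.contract_injective i) Polynomial.prime_X
    (by
      obtain ⟨j, hj⟩ := exists_ne i
      exact ⟨_, fr.formX_mem j i, fr.not_X_dvd_contract_formX hj.symm⟩)
    ⟨_, fr.formY_mem i, fr.not_X_dvd_contract_formY i⟩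
    (by
      obtain ⟨j, hj⟩ := exists_ne i
      refine ⟨_, fr.formY j, fr.formY_mem j, fr.formY i, fr.formY_mem i, ?_, ?_,
        fr.not_X_dvd_contract_formY i⟩
      · rw [X_dvd_contract_iff, psi_formY]
        simp [support_X, Finsupp.weight_single, pointWeight, hj]
      · rw [X_pow_dvd_contract_iff, psi_formY]
        simp [support_X, Finsupp.weight_single, pointWeight, hj])

lemma le_ord_pointVal_iff {i : Fin (n + 2)} {f : CoordRing k n (n + 1)} (hf : f ≠ 0) (N : ℕ) :
    N ≤ (fr.pointVal i).ord f ↔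
      ∀ s ∈ (fr.psi f).support, N ≤ Finsupp.weight (pointWeight n i) s := by
  rw [← X_pow_dvd_contract_iff]
  exact FormValuation.le_ord_ofPrime_iff hf N

lemma ord_pointVal_le_weight {i : Fin (n + 2)} {f : CoordRing k n (n + 1)}
    {s : Fin (n + 2) ⊕ Fin (n + 2) →₀ ℕ} (hs : s ∈ (fr.psi f).support) :
    (fr.pointVal i).ord f ≤ Finsupp.weight (pointWeight n i) s := by
  have hf : f ≠ 0 := by rintro rfl; simp at hs
  exact (fr.le_ord_pointVal_iff hf _).1 le_rfl s hs

lemma weight_pointWeight (i : Fin (n + 2)) (s : Fin (n + 2) ⊕ Fin (n + 2) →₀ ℕ) :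
    Finsupp.weight (pointWeight n i) s + (s (Sum.inl i) + s (Sum.inr i)) =
      ∑ j, s (Sum.inl j) + ∑ j, s (Sum.inr j) := by
  rw [weight_eq_sum, Fintype.sum_sum_type]
  simp only [pointWeight, Sum.elim_inl, Sum.elim_inr]
  rw [← Finset.add_sum_erase _ (fun j => s (Sum.inl j)) (Finset.mem_univ i),
    ← Finset.add_sum_erase _ (fun j => s (Sum.inr j)) (Finset.mem_univ i),
    ← Finset.add_sum_erase _ (fun j => s (Sum.inl j) * _) (Finset.mem_univ i),
    ← Finset.add_sum_erase _ (fun j => s (Sum.inr j) * _) (Finset.mem_univ i)]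
  have h1 : ∀ t : Fin (n + 2) → ℕ, ∑ j ∈ Finset.univ.erase i, t j * (if j = i then 0 else 1) =
      ∑ j ∈ Finset.univ.erase i, t j := fun t => Finset.sum_congr rfl fun j hj => by
    rw [if_neg (Finset.ne_of_mem_erase hj), mul_one]
  rw [h1 fun j => s (Sum.inl j), h1 fun j => s (Sum.inr j)]
  simp only [if_true, mul_zero, zero_add]
  ring

lemma sum_exponents {d : ℕ × ℕ} {f : CoordRing k n (n + 1)} (hd : f ∈ biForms k n (n + 1) d)
    {s : Fin (n + 2) ⊕ Fin (n + 2) →₀ ℕ} (hs : s ∈ (fr.psi f).support) :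
    ∑ j, s (Sum.inl j) = d.1 ∧ ∑ j, s (Sum.inr j) = d.2 := by
  have h := fr.psi_mem hd (mem_support_iff.1 hs)
  rw [weight_biweight, Prod.ext_iff] at h
  simpa [weight_eq_sum, Fintype.sum_sum_type, weightX, weightY] using h

lemma eval_point_eq_zero_of_ord_pos {i : Fin (n + 2)} {f : CoordRing k n (n + 1)}
    (h : 0 < (fr.pointVal i).ord f) : eval (fr.point i) f = 0 := by
  by_cases hf : f = 0
  · rw [hf, map_zero]
  rw [← eval_psi_single, eval_eq']
  refine Finset.sum_eq_zero fun s hs => ?_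
  have h1 := h.trans_le (fr.ord_pointVal_le_weight hs)
  rw [weight_eq_sum] at h1
  obtain ⟨t, -, ht⟩ := Finset.exists_ne_zero_of_sum_ne_zero h1.ne'
  have h2 : s t ≠ 0 := left_ne_zero_of_mul ht
  have h3 : pointWeight n i t ≠ 0 := right_ne_zero_of_mul ht
  rw [Finset.prod_eq_zero (Finset.mem_univ t), mul_zero]
  rcases t with t | t <;> simp_all [pointWeight]

lemma ord_pos_of_eval_point_eq_zero {i : Fin (n + 2)} {f : CoordRing k n (n + 1)} (hf : f ≠ 0)
    {d : ℕ × ℕ} (hd : f ∈ biForms k n (n + 1) d) (h : eval (fr.point i) f = 0) :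
    0 < (fr.pointVal i).ord f := by
  refine (fr.le_ord_pointVal_iff hf 1).2 fun s hs => ?_
  by_contra hlt
  have hs0 : Finsupp.weight (pointWeight n i) s = 0 := by omega
  -- a monomial of weight zero is a power of `uᵢ` times a power of `yᵢ`
  have key : ∀ t ∈ (fr.psi f).support, Finsupp.weight (pointWeight n i) t = 0 →
      ∀ z, t z = Sum.elim (fun j => if j = i then d.1 else 0)
        (fun j => if j = i then d.2 else 0) z := by
    intro t ht ht0
    obtain ⟨h1, h2⟩ := fr.sum_exponents hd ht
    rw [weight_eq_sum, Finset.sum_eq_zero_iff] at ht0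
    have h3 : ∀ j, j ≠ i → t (Sum.inl j) = 0 := fun j hj => by
      simpa [pointWeight, hj] using ht0 (Sum.inl j) (Finset.mem_univ _)
    have h4 : ∀ j, j ≠ i → t (Sum.inr j) = 0 := fun j hj => by
      simpa [pointWeight, hj] using ht0 (Sum.inr j) (Finset.mem_univ _)
    rw [Finset.sum_eq_single i (fun j _ hj => h3 j hj) (by simp)] at h1
    rw [Finset.sum_eq_single i (fun j _ hj => h4 j hj) (by simp)] at h2
    rintro (j | j)
    · by_cases hj : j = i
      · simp [hj, h1]
      · simp [hj, h3 j hj]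
    · by_cases hj : j = i
      · simp [hj, h2]
      · simp [hj, h4 j hj]
  rw [← eval_psi_single, eval_eq', Finset.sum_eq_single s] at h
  · rw [Finset.prod_eq_one, mul_one] at h
    · exact mem_support_iff.1 hs h
    · rintro (j | j) -
      · rw [key s hs hs0]
        by_cases hj : j = i <;> simp [hj]
      · rw [key s hs hs0]
        by_cases hj : j = i <;> simp [hj]
  · intro t ht hts
    have h1 : Finsupp.weight (pointWeight n i) t ≠ 0 := fun h0 =>
      hts (Finsupp.ext fun z => (key t ht h0 z).trans (key s hs hs0 z).symm)
    rw [weight_eq_sum] at h1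
    obtain ⟨z, -, hz⟩ := Finset.exists_ne_zero_of_sum_ne_zero h1
    have h2 : t z ≠ 0 := left_ne_zero_of_mul hz
    have h3 : pointWeight n i z ≠ 0 := right_ne_zero_of_mul hz
    rw [Finset.prod_eq_zero (Finset.mem_univ z), mul_zero]
    rcases z with z | z <;> simp_all [pointWeight]
  · exact fun h => absurd hs h

end Frame

end Frames

/-! ### Charts of the blow-up -/

section Charts

open MvPolynomial

variable {k : Type*} [Field k] {n m : ℕ}

lemma le_blowupChart (R : Subring (CoordField k n m)) (t : CoordField k n m) :
    R ≤ blowupChart R t :=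
  fun _ hx => Subring.subset_closure (Or.inl hx)

lemma div_mem_blowupChart {R : Subring (CoordField k n m)} (t : CoordField k n m) {a : R}
    (ha : a ∈ nonunits R) : (a : CoordField k n m) / t ∈ blowupChart R t :=
  Subring.subset_closure (Or.inr ⟨a, ha, rfl⟩)

lemma exists_eq_div_pow_of_mem_blowupChart {R : Subring (CoordField k n m)}
    {t : CoordField k n m} (ht : t ∈ R) (ht0 : t ≠ 0) {f : CoordField k n m}
    (hf : f ∈ blowupChart R t) : ∃ c ∈ R, ∃ N : ℕ, f = c / t ^ N := by
  induction hf using Subring.closure_induction with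
  | mem x hx =>
    rcases hx with hx | ⟨a, -, rfl⟩
    · exact ⟨x, hx, 0, by simp⟩
    · exact ⟨a, a.2, 1, by simp⟩
  | zero => exact ⟨0, R.zero_mem, 0, by simp⟩
  | one => exact ⟨1, R.one_mem, 0, by simp⟩
  | add x y _ _ hx hy =>
    obtain ⟨c, hc, N, rfl⟩ := hx
    obtain ⟨c', hc', N', rfl⟩ := hy
    refine ⟨c * t ^ N' + t ^ N * c', R.add_mem (R.mul_mem hc (R.pow_mem ht _))
      (R.mul_mem (R.pow_mem ht _) hc'), N + N', ?_⟩
    rw [div_add_div _ _ (pow_ne_zero _ ht0) (pow_ne_zero _ ht0), pow_add]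
  | neg x _ hx =>
    obtain ⟨c, hc, N, rfl⟩ := hx
    exact ⟨-c, R.neg_mem hc, N, by rw [neg_div]⟩
  | mul x y _ _ hx hy =>
    obtain ⟨c, hc, N, rfl⟩ := hx
    obtain ⟨c', hc', N', rfl⟩ := hy
    exact ⟨c * c', R.mul_mem hc hc', N + N', by rw [div_mul_div_comm, pow_add]⟩

lemma mem_ofPrime_iff {K : Type*} [Field K] {A : Subring K} {P : Ideal A} [hP : P.IsPrime]
    {f : K} : f ∈ (LocalSubring.ofPrime A P).toSubring ↔
      ∃ a b : A, b ∉ P ∧ f = (a : K) / b := by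
  have hne : ∀ b : A, b ∉ P → (b : K) ≠ 0 := fun b hb h =>
    hb (by rw [show b = 0 from Subtype.ext h]; exact P.zero_mem)
  constructor
  · intro hf
    obtain ⟨a, b, hab⟩ := IsLocalization.exists_mk'_eq P.primeCompl
      (⟨f, hf⟩ : (LocalSubring.ofPrime A P).toSubring)
    refine ⟨a, b, b.2, ?_⟩
    have h1 := IsLocalization.mk'_spec (LocalSubring.ofPrime A P).toSubring a b
    rw [hab] at h1
    rw [eq_div_iff (hne _ b.2)]
    exact congrArg Subtype.val h1
  · rintro ⟨a, b, hb, rfl⟩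
    have h1 := IsLocalization.map_units (LocalSubring.ofPrime A P).toSubring
      (⟨b, hb⟩ : P.primeCompl)
    obtain ⟨c, hc⟩ := h1.dvd (a := 1)
    have h2 : (1 : K) = b * c := congrArg Subtype.val hc
    rw [div_eq_mul_inv, ← eq_inv_of_mul_eq_one_right h2.symm]
    exact Subring.mul_mem _ (LocalSubring.le_ofPrime A P a.2) c.2

end Charts

/-! ### The points of codimension one of the blow-up -/

section Classification

open MvPolynomial

variable {k : Type*} [Field k] {n : ℕ}

namespace Frame

variable {fr : Frame k n} {p : Fin (n + 2) → ProdPoint k n (n + 1)}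

/-- The vectors of the frame are the chosen representatives of the points. -/
def Represents (fr : Frame k n) (p : Fin (n + 2) → ProdPoint k n (n + 1)) : Prop :=
  ∀ i, fr.point i = Sum.elim (p i).1.rep (p i).2.rep

lemma Represents.mem_localRingAt (h : fr.Represents p) {i : Fin (n + 2)}
    {f : CoordField k n (n + 1)} :
    f ∈ localRingAt (p i) ↔ ∃ d, ∃ G ∈ biForms k n (n + 1) d, ∃ H ∈ biForms k n (n + 1) d,
      eval (fr.point i) H ≠ 0 ∧ f = quot G H := by
  rw [h i, BlowupModel.mem_localRingAt]

lemma Represents.isUnit_iff (h : fr.Represents p) {i : Fin (n + 2)} {a : localRingAt (p i)}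
    {d : ℕ × ℕ} {G H : CoordRing k n (n + 1)} (hG : G ∈ biForms k n (n + 1) d)
    (hH : H ∈ biForms k n (n + 1) d) (hHx : eval (fr.point i) H ≠ 0)
    (ha : (a : CoordField k n (n + 1)) = quot G H) :
    IsUnit a ↔ eval (fr.point i) G ≠ 0 := by
  rw [h i] at hHx ⊢
  exact isUnit_localRingAt_iff hG hH hHx ha

lemma ord_eq_zero_of_eval_ne_zero {i : Fin (n + 2)} {f : CoordRing k n (n + 1)}
    (h : eval (fr.point i) f ≠ 0) : (fr.pointVal i).ord f = 0 := by
  by_contra h0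
  exact h (fr.eval_point_eq_zero_of_ord_pos (Nat.pos_of_ne_zero h0))

lemma Represents.exists_form (h : fr.Represents p) (i : Fin (n + 2)) (d : ℕ × ℕ) :
    ∃ g ∈ biForms k n (n + 1) d, eval (fr.point i) g ≠ 0 := by
  rw [h i]
  exact exists_form_eval_ne_zero (p i) d

lemma Represents.localRingAt_le_ring (h : fr.Represents p) (i : Fin (n + 2)) :
    localRingAt (p i) ≤ (fr.pointVal i).ring := by
  intro f hf
  obtain ⟨d, G, hG, H, hH, hHx, rfl⟩ := h.mem_localRingAt.1 hf
  exact ⟨d, G, hG, H, hH, fun h => hHx (by rw [h, map_zero]), fun _ => by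
    rw [ord_eq_zero_of_eval_ne_zero hHx]; exact Nat.zero_le _, rfl⟩

lemma Represents.isUnit_iff_hasVal (h : fr.Represents p) {i : Fin (n + 2)}
    {a : localRingAt (p i)} {r : ℤ}
    (hr : (fr.pointVal i).HasVal (a : CoordField k n (n + 1)) r) : IsUnit a ↔ r = 0 := by
  obtain ⟨d, G, hG, H, hH, hHx, ha⟩ := h.mem_localRingAt.1 a.2
  have hH0 : H ≠ 0 := fun h => hHx (by rw [h, map_zero])
  have hG0 : G ≠ 0 := ne_zero_of_quot_ne_zero (ha ▸ hr.ne_zero)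
  have h1 := FormValuation.hasVal_quot (v := fr.pointVal i) hG hH hG0 hH0
  rw [← ha] at h1
  have h2 := hr.unique h1
  rw [ord_eq_zero_of_eval_ne_zero hHx] at h2
  rw [h.isUnit_iff hG hH hHx ha]
  constructor
  · intro hGx
    rw [h2, ord_eq_zero_of_eval_ne_zero hGx]
    simp
  · intro hr0 hGx
    have := fr.ord_pos_of_eval_point_eq_zero hG0 hG hGx
    omega

/-- The valuation ring of the multiplicity at `pᵢ` dominates the local ring at `pᵢ`. -/
lemma Represents.dominates (h : fr.Represents p) (i : Fin (n + 2)) :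
    ∃ h : localRingAt (p i) ≤ (fr.pointVal i).ring, IsLocalHom (Subring.inclusion h) := by
  refine ⟨h.localRingAt_le_ring i, ⟨fun a ha => ?_⟩⟩
  by_cases ha0 : a = 0
  · subst ha0
    rw [map_zero] at ha
    exact absurd ha not_isUnit_zero
  obtain ⟨r, hr⟩ := (fr.pointVal i).exists_hasVal ((fr.pointVal i).ring_le_functionField
    (h.localRingAt_le_ring i a.2)) (fun h0 => ha0 (Subtype.ext h0))
  rw [h.isUnit_iff_hasVal hr]
  exact (FormValuation.HasVal.isUnit_iff
    (x := Subring.inclusion (h.localRingAt_le_ring i) a) hr).1 ha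

/-- A function of multiplicity at least `N` at `pᵢ` lies in the `N`-th power of the maximal ideal
of the local ring, in the form needed for the charts of the blow-up: it is a combination of
products of coordinates of which at least `N` vanish at `pᵢ`. -/
lemma Represents.div_pow_mem_blowupChart (h : fr.Represents p) {i : Fin (n + 2)}
    {t : CoordField k n (n + 1)} (ht : t ∈ localRingAt (p i)) (ht0 : t ≠ 0)
    {c : CoordField k n (n + 1)} (hc : c ∈ localRingAt (p i)) {r : ℤ}
    (hr : (fr.pointVal i).HasVal c r) {N : ℕ} (hN : N ≤ r) :
    c / t ^ N ∈ blowupChart (localRingAt (p i)) t := by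
  obtain ⟨d, G, hG, H, hH, hHx, rfl⟩ := h.mem_localRingAt.1 hc
  have hH0 : H ≠ 0 := fun h => hHx (by rw [h, map_zero])
  have hG0 : G ≠ 0 := ne_zero_of_quot_ne_zero hr.ne_zero
  have hNG : N ≤ (fr.pointVal i).ord G := by
    have := hr.unique (FormValuation.hasVal_quot hG hH hG0 hH0)
    omega
  obtain ⟨j, hj⟩ := exists_ne i
  set A := blowupChart (localRingAt (p i)) t with hA
  have hle : localRingAt (p i) ≤ A := le_blowupChart _ _
  -- the affine coordinates around `pᵢ`
  let z : Fin (n + 2) ⊕ Fin (n + 2) → CoordField k n (n + 1) :=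
    Sum.elim (fun l => quot (fr.formX j l) (fr.formX j i))
      (fun l => quot (fr.formY l) (fr.formY i))
  have hXi : eval (fr.point i) (fr.formX j i) ≠ 0 := by simp [fr.eval_formX hj.symm hj.symm]
  have hYi : eval (fr.point i) (fr.formY i) ≠ 0 := by simp [fr.eval_formY]
  have hz : ∀ e, z e ∈ localRingAt (p i) := by
    rintro (l | l)
    · exact h.mem_localRingAt.2 ⟨_, _, fr.formX_mem j l, _, fr.formX_mem j i, hXi, rfl⟩
    · exact h.mem_localRingAt.2 ⟨_, _, fr.formY_mem l, _, fr.formY_mem i, hYi, rfl⟩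
  have hzw : ∀ e, z e / t ^ pointWeight n i e ∈ A := by
    rintro (l | l)
    · by_cases hl : l = i
      · simpa [pointWeight, hl] using hle (hz (Sum.inl i))
      · simp only [pointWeight, Sum.elim_inl, if_neg hl, pow_one]
        refine div_mem_blowupChart t (a := ⟨z (Sum.inl l), hz _⟩) fun hu => ?_
        refine (h.isUnit_iff (fr.formX_mem j l) (fr.formX_mem j i) hXi rfl).1 hu ?_
        by_cases hlj : l = j
        · rw [hlj, fr.formX_self, map_zero]
        · rw [fr.eval_formX hlj hj.symm, if_neg hl]
    · by_cases hl : l = i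
      · simpa [pointWeight, hl] using hle (hz (Sum.inr i))
      · simp only [pointWeight, Sum.elim_inr, if_neg hl, pow_one]
        refine div_mem_blowupChart t (a := ⟨z (Sum.inr l), hz _⟩) fun hu => ?_
        refine (h.isUnit_iff (fr.formY_mem l) (fr.formY_mem i) hYi rfl).1 hu ?_
        rw [fr.eval_formY, if_neg hl]
  -- `g` is a form of bidegree `d` that does not vanish at `pᵢ`; expand `G / g` in the coordinates
  set g : CoordRing k n (n + 1) := fr.formX j i ^ d.1 * fr.formY i ^ d.2 with hg
  have hgx : eval (fr.point i) g ≠ 0 := by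
    rw [hg, map_mul, map_pow, map_pow]
    exact mul_ne_zero (pow_ne_zero _ hXi) (pow_ne_zero _ hYi)
  have hgd : g ∈ biForms k n (n + 1) d := by
    have := mul_mem_biForms (pow_mem_biForms (fr.formX_mem j i) d.1)
      (pow_mem_biForms (fr.formY_mem i) d.2)
    simpa using this
  have hg0 : g ≠ 0 := fun h => hgx (by rw [h, map_zero])
  have hsum : quot G g = ∑ s ∈ (fr.psi G).support,
      algebraMap (CoordRing k n (n + 1)) (CoordField k n (n + 1)) (C (coeff s (fr.psi G))) *
        ∏ e, z e ^ s e := by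
    have h1 : G = ∑ s ∈ (fr.psi G).support, C (coeff s (fr.psi G)) *
        ∏ e, (Sum.elim (fr.formX j) fr.formY e : CoordRing k n (n + 1)) ^ s e := by
      conv_lhs => rw [← fr.sec_psi j G, sec, aeval_def, eval₂_eq']
      rfl
    rw [quot]
    conv_lhs => rw [h1, map_sum, Finset.sum_div]
    refine Finset.sum_congr rfl fun s hs => ?_
    obtain ⟨hs1, hs2⟩ := fr.sum_exponents hG hs
    rw [map_mul, mul_div_assoc]
    congr 1
    rw [Fintype.prod_sum_type, Fintype.prod_sum_type, hg, ← hs1, ← hs2]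
    simp only [z, Sum.elim_inl, Sum.elim_inr, quot, div_pow, Finset.prod_div_distrib,
      Finset.prod_pow_eq_pow_sum, map_mul, map_pow, map_prod]
    rw [mul_div_mul_comm]
  -- each monomial contains at least `N` coordinates vanishing at `pᵢ`
  have key : quot G g / t ^ N ∈ A := by
    rw [hsum, Finset.sum_div]
    refine A.sum_mem fun s hs => ?_
    have hw := hNG.trans (fr.ord_pointVal_le_weight hs)
    obtain ⟨N', hN'⟩ := Nat.exists_eq_add_of_le hw
    have h2 : (∏ e, z e ^ s e) / t ^ N = (∏ e, (z e / t ^ pointWeight n i e) ^ s e) * t ^ N' := by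
      simp only [div_pow, Finset.prod_div_distrib, ← pow_mul]
      rw [Finset.prod_pow_eq_pow_sum,
        show ∑ e, pointWeight n i e * s e = N + N' by
          rw [← hN', weight_eq_sum]; exact Finset.sum_congr rfl fun e _ => mul_comm _ _, pow_add]
      have := pow_ne_zero N ht0
      have := pow_ne_zero N' ht0
      field_simp
    rw [mul_div_assoc, h2]
    refine A.mul_mem (hle ?_) (A.mul_mem (A.prod_mem fun e _ => A.pow_mem (hzw e) _)
      (A.pow_mem (hle ht) _))
    refine h.mem_localRingAt.2 ⟨0, C (coeff s (fr.psi G)), C_mem_biForms _, 1, one_mem_biForms,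
      ?_, ?_⟩
    · simp
    · simp [quot]
  have h3 : quot G H / t ^ N = quot G g / t ^ N * quot g H := by
    rw [div_mul_eq_mul_div, quot_mul_quot, mul_comm g H, ← quot_mul_quot, quot_self hg0, mul_one]
  rw [h3]
  exact A.mul_mem key (hle (h.mem_localRingAt.2 ⟨d, g, hgd, H, hH, hHx, rfl⟩))

lemma exists_eq_div_of_localRingAt_le {x : ProdPoint k n (n + 1)}
    {R : Subring (CoordField k n (n + 1))} (hR : localRingAt x ≤ R) :
    ∀ f ∈ functionField k n (n + 1), ∃ a ∈ R, ∃ b ∈ R, b ≠ 0 ∧ f = a / b :=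
  have := RingHom.ker_isPrime (eval (Sum.elim x.1.rep x.2.rep) : CoordRing k n (n + 1) →+* k)
  exists_eq_div_of_homLocalization_le (isRelevant_ker_eval x) hR

end Frame

end Classification

section Classification

open MvPolynomial

variable {k : Type*} [Field k] {n : ℕ}

namespace Frame

variable {fr : Frame k n} {p : Fin (n + 2) → ProdPoint k n (n + 1)}

/-- A prime of a ring above the local ring at `pᵢ` that contains the local equation of a form
contains that of an irreducible factor. The prime is given by its set `S` of elements. -/
lemma Represents.exists_irreducible_quot_mem (h : fr.Represents p) {i : Fin (n + 2)}
    {S : Set (CoordField k n (n + 1))}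
    (hS : ∀ f ∈ localRingAt (p i), ∀ g ∈ localRingAt (p i), f * g ∈ S → f ∈ S ∨ g ∈ S)
    (hunit : ∀ d, ∀ G ∈ biForms k n (n + 1) d, ∀ H ∈ biForms k n (n + 1) d,
      eval (fr.point i) H ≠ 0 → quot G H ∈ S → eval (fr.point i) G = 0)
    {d : ℕ × ℕ} {G H : CoordRing k n (n + 1)} (hG : G ∈ biForms k n (n + 1) d)
    (hH : H ∈ biForms k n (n + 1) d) (hHx : eval (fr.point i) H ≠ 0) (hG0 : G ≠ 0)
    (hGS : quot G H ∈ S) :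
    ∃ d, ∃ F ∈ biForms k n (n + 1) d, Irreducible F ∧ ∃ H ∈ biForms k n (n + 1) d,
      eval (fr.point i) H ≠ 0 ∧ quot F H ∈ S := by
  have hne : ∀ {H : CoordRing k n (n + 1)}, eval (fr.point i) H ≠ 0 → H ≠ 0 :=
    fun hHx h0 => hHx (by rw [h0, map_zero])
  refine form_induction (motive := fun G d => ∀ H ∈ biForms k n (n + 1) d,
    eval (fr.point i) H ≠ 0 → quot G H ∈ S → ∃ d, ∃ F ∈ biForms k n (n + 1) d, Irreducible F ∧
      ∃ H ∈ biForms k n (n + 1) d, eval (fr.point i) H ≠ 0 ∧ quot F H ∈ S)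
    ?_ ?_ hG0 hG H hH hHx hGS
  · intro f h0 hf H hH hHx hfS
    exact absurd (hunit 0 f hf H hH hHx hfS)
      ((isUnit_of_mem_biForms_zero h0 hf).map (eval (fr.point i))).ne_zero
  · intro f g d e hfi hf hg0 hg ih H hH hHx hfS
    obtain ⟨H₁, hH₁, hHx₁⟩ := h.exists_form i d
    obtain ⟨H₂, hH₂, hHx₂⟩ := h.exists_form i e
    have hH12x : eval (fr.point i) (H₁ * H₂) ≠ 0 := by
      rw [map_mul]; exact mul_ne_zero hHx₁ hHx₂
    have hm1 : quot f H₁ ∈ localRingAt (p i) := h.mem_localRingAt.2 ⟨_, f, hf, _, hH₁, hHx₁, rfl⟩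
    have hm2 : quot g H₂ ∈ localRingAt (p i) := h.mem_localRingAt.2 ⟨_, g, hg, _, hH₂, hHx₂, rfl⟩
    have hm3 : quot (H₁ * H₂) H ∈ localRingAt (p i) :=
      h.mem_localRingAt.2 ⟨_, _, mul_mem_biForms hH₁ hH₂, _, hH, hHx, rfl⟩
    have hsplit : quot (f * g) H = quot f H₁ * quot g H₂ * quot (H₁ * H₂) H := by
      rw [quot_mul_quot, quot_mul_quot, quot_eq_quot_iff (hne hHx)
        (mul_ne_zero (hne hH12x) (hne hHx))]
      ring
    rw [hsplit] at hfS
    rcases hS _ (Subring.mul_mem _ hm1 hm2) _ hm3 hfS with h1 | h1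
    · rcases hS _ hm1 _ hm2 h1 with h2 | h2
      · exact ⟨d, f, hf, hfi, H₁, hH₁, hHx₁, h2⟩
      · exact ih H₂ hH₂ hHx₂ h2
    · exact absurd (hunit _ _ (mul_mem_biForms hH₁ hH₂) _ hH hHx h1) hH12x

/-- A point of codimension one in a chart `Spec R[𝔪/t]` outside `t = 0` is the generic point of
the strict transform of an irreducible hypersurface. -/
lemma Represents.exists_eq_ring_primeVal (h : fr.Represents p) (hn : 1 ≤ n)
    {i : Fin (n + 2)} {t : CoordField k n (n + 1)} (ht : t ∈ localRingAt (p i)) (ht0 : t ≠ 0)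
    (q : Ideal (blowupChart (localRingAt (p i)) t)) [hq : q.IsPrime]
    (htq : ⟨t, le_blowupChart _ _ ht⟩ ∉ q)
    (hdvr : IsDiscreteValuationRing (LocalSubring.ofPrime _ q).toSubring) :
    ∃ (F : CoordRing k n (n + 1)) (d : ℕ × ℕ) (hF : Irreducible F)
      (hd : F ∈ biForms k n (n + 1) d),
      (LocalSubring.ofPrime _ q).toSubring = (primeVal hn (Nat.le_add_left 1 n) hF hd).ring := by
  have hle : localRingAt (p i) ≤ blowupChart (localRingAt (p i)) t := le_blowupChart _ _
  have hne : ∀ {H : CoordRing k n (n + 1)}, eval (fr.point i) H ≠ 0 → H ≠ 0 :=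
    fun hHx h0 => hHx (by rw [h0, map_zero])
  -- the prime `q` as a subset of the function field
  let S : Set (CoordField k n (n + 1)) :=
    Subtype.val '' (q : Set (blowupChart (localRingAt (p i)) t))
  have hSmul : ∀ f ∈ S, ∀ g ∈ localRingAt (p i), f * g ∈ S := by
    rintro _ ⟨f, hf, rfl⟩ g hg
    exact ⟨f * ⟨g, hle hg⟩, q.mul_mem_right _ hf, rfl⟩
  have hS : ∀ f ∈ localRingAt (p i), ∀ g ∈ localRingAt (p i), f * g ∈ S → f ∈ S ∨ g ∈ S := by
    rintro f hf g hg ⟨x, hx, hxfg⟩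
    have hx' : x = ⟨f, hle hf⟩ * ⟨g, hle hg⟩ := Subtype.ext hxfg
    rw [hx'] at hx
    rcases hq.mem_or_mem hx with h1 | h1
    exacts [Or.inl ⟨_, h1, rfl⟩, Or.inr ⟨_, h1, rfl⟩]
  have hunit : ∀ d, ∀ G ∈ biForms k n (n + 1) d, ∀ H ∈ biForms k n (n + 1) d,
      eval (fr.point i) H ≠ 0 → quot G H ∈ S → eval (fr.point i) G = 0 := by
    rintro d G hG H hH hHx ⟨x, hx, hxG⟩
    by_contra hGx
    have hm := h.mem_localRingAt.2 ⟨d, G, hG, H, hH, hHx, rfl⟩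
    have hu := (h.isUnit_iff (a := ⟨quot G H, hm⟩) hG hH hHx rfl).2 hGx
    have hx' : x = Subring.inclusion hle ⟨quot G H, hm⟩ := Subtype.ext hxG
    rw [hx'] at hx
    exact hq.ne_top (q.eq_top_of_isUnit_mem hx (hu.map (Subring.inclusion hle)))
  have htS : t ∉ S := by
    rintro ⟨x, hx, hxt⟩
    exact htq (by rwa [show x = ⟨t, hle ht⟩ from Subtype.ext hxt] at hx)
  -- the zero ideal would give a field
  obtain ⟨x, hxq, hx0⟩ : ∃ x ∈ q, x ≠ 0 := by
    by_contra! hbot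
    refine hdvr.not_isField _ ⟨exists_pair_ne _, mul_comm, ?_⟩
    rintro ⟨x, hx⟩ hx0
    obtain ⟨a, b, hb, rfl⟩ := mem_ofPrime_iff.1 hx
    have ha : (a : CoordField k n (n + 1)) ≠ 0 := fun h0 => hx0 (Subtype.ext (by simp [h0]))
    have hb' : (b : CoordField k n (n + 1)) ≠ 0 := fun h0 =>
      hb (by rw [show b = 0 from Subtype.ext h0]; exact q.zero_mem)
    refine ⟨⟨b / a, mem_ofPrime_iff.2 ⟨b, a, fun haq => ha ?_, rfl⟩⟩, Subtype.ext ?_⟩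
    · rw [hbot a haq]; rfl
    · change (a : CoordField k n (n + 1)) / b * (b / a) = 1
      field_simp
  obtain ⟨c, hc, N, hcN⟩ := exists_eq_div_pow_of_mem_blowupChart ht ht0 x.2
  have hcS : c ∈ S := by
    have := hSmul x ⟨x, hxq, rfl⟩ _ (Subring.pow_mem _ ht N)
    rwa [hcN, div_mul_cancel₀ _ (pow_ne_zero _ ht0)] at this
  obtain ⟨d, G, hG, H, hH, hHx, rfl⟩ := h.mem_localRingAt.1 hc
  have hG0 : G ≠ 0 := by
    rintro rfl
    exact hx0 (Subtype.ext (by rw [hcN]; simp [quot]))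
  obtain ⟨e, F, hF, hFi, H', hH', hHx', hFS⟩ :=
    h.exists_irreducible_quot_mem hS hunit hG hH hHx hG0 hcS
  refine ⟨F, e, hFi, hF, ?_⟩
  have hFx := hunit _ _ hF _ hH' hHx' hFS
  have hRle : localRingAt (p i) ≤ (primeVal hn (Nat.le_add_left 1 n) hFi hF).ring := by
    have := RingHom.ker_isPrime
      (eval (Sum.elim (p i).1.rep (p i).2.rep) : CoordRing k n (n + 1) →+* k)
    refine homLocalization_le_ring_primeVal (P := RingHom.ker _) ?_
    rw [RingHom.mem_ker, ← h i, hFx]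
  -- elements of the local ring outside the prime are units along `F`
  have hinv : ∀ f ∈ localRingAt (p i), f ∉ S →
      f⁻¹ ∈ (primeVal hn (Nat.le_add_left 1 n) hFi hF).ring := by
    intro f hf hfS
    obtain ⟨d', G', hG', H'', hH'', hHx'', rfl⟩ := h.mem_localRingAt.1 hf
    have hG0' : G' ≠ 0 := by
      rintro rfl
      exact hfS ⟨0, q.zero_mem, by simp [quot]⟩
    have hFG : ¬ F ∣ G' := by
      rintro ⟨K, rfl⟩
      obtain ⟨e₁, e₂, he₁, he₂, he⟩ := exists_mem_biForms_of_mul hG0' hG'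
      obtain ⟨H₂, hH₂, hHx₂⟩ := h.exists_form i e₂
      obtain rfl := biForms_degree_unique (left_ne_zero_of_mul hG0') hF he₁
      subst he
      refine hfS ?_
      have hsplit : quot (F * K) H'' = quot F H' * (quot K H₂ * quot (H' * H₂) H'') := by
        rw [quot_mul_quot, quot_mul_quot, quot_eq_quot_iff (hne hHx'')
          (mul_ne_zero (hne hHx') (mul_ne_zero (hne hHx₂) (hne hHx'')))]
        ring
      rw [hsplit]
      exact hSmul _ hFS _ (Subring.mul_mem _ (h.mem_localRingAt.2 ⟨_, K, he₂, H₂, hH₂, hHx₂, rfl⟩)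
        (h.mem_localRingAt.2 ⟨_, _, mul_mem_biForms hH' hH₂, _, hH'', hHx'', rfl⟩))
    rw [quot_inv, FormValuation.quot_mem_ring_iff hH'' hG' (hne hHx'') hG0',
      (ord_primeVal_eq_zero_iff hG0').2 hFG]
    exact Nat.zero_le _
  refine FormValuation.eq_ring_of_le hdvr ?_ (exists_eq_div_of_localRingAt_le
    (hle.trans (LocalSubring.le_ofPrime _ q)))
  have htinv := hinv t ht htS
  have hA : ∀ x : blowupChart (localRingAt (p i)) t,
      (x : CoordField k n (n + 1)) ∈ (primeVal hn (Nat.le_add_left 1 n) hFi hF).ring := by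
    intro x
    obtain ⟨c, hc, N, hcN⟩ := exists_eq_div_pow_of_mem_blowupChart ht ht0 x.2
    rw [hcN, div_eq_mul_inv, ← inv_pow]
    exact Subring.mul_mem _ (hRle hc) (Subring.pow_mem _ htinv _)
  intro f hf
  obtain ⟨a, b, hb, rfl⟩ := mem_ofPrime_iff.1 hf
  obtain ⟨c', hc', M, hcM⟩ := exists_eq_div_pow_of_mem_blowupChart ht ht0 b.2
  have hcS' : c' ∉ S := by
    rintro ⟨y, hy, hyc⟩
    have hy' : y = b * ⟨t, hle ht⟩ ^ M := by
      refine Subtype.ext ?_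
      rw [hyc, Subring.coe_mul, Subring.coe_pow, hcM]
      exact (div_mul_cancel₀ _ (pow_ne_zero _ ht0)).symm
    rw [hy'] at hy
    rcases hq.mem_or_mem hy with h1 | h1
    · exact hb h1
    · exact htq (hq.mem_of_pow_mem _ h1)
  have hbinv : ((b : CoordField k n (n + 1)))⁻¹ = c'⁻¹ * t ^ M := by
    rw [hcM, inv_div, div_eq_mul_inv, mul_comm]
  rw [div_eq_mul_inv, hbinv]
  exact Subring.mul_mem _ (hA a) (Subring.mul_mem _ (hinv _ hc' hcS')
    (Subring.pow_mem _ (hRle ht) _))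

lemma Represents.blowupChart_le_ring (h : fr.Represents p) {i : Fin (n + 2)}
    {t : CoordField k n (n + 1)} (hr : (fr.pointVal i).HasVal t 1) :
    blowupChart (localRingAt (p i)) t ≤ (fr.pointVal i).ring := by
  have hRle := h.localRingAt_le_ring i
  refine Subring.closure_le.2 ?_
  rintro f (hf | ⟨a, ha, rfl⟩)
  · exact hRle hf
  · by_cases ha0 : a = 0
    · rw [ha0]
      simp
    obtain ⟨s, hs⟩ := (fr.pointVal i).exists_hasVal
      ((fr.pointVal i).ring_le_functionField (hRle a.2)) (fun h0 => ha0 (Subtype.ext h0))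
    have h1 := hs.mem_ring_iff.1 (hRle a.2)
    have h2 : s ≠ 0 := fun h0 => ha ((h.isUnit_iff_hasVal hs).2 h0)
    have h3 := hs.mul hr.inv
    rw [← div_eq_mul_inv] at h3
    exact h3.mem_ring_iff.2 (by omega)

/-- A point of codimension one in a chart `Spec R[𝔪/t]` inside `t = 0` is the generic point of
the exceptional divisor. -/
lemma Represents.eq_ring_pointVal (h : fr.Represents p)
    {i : Fin (n + 2)} {t : CoordField k n (n + 1)} (ht : t ∈ localRingAt (p i)) (ht0 : t ≠ 0)
    (q : Ideal (blowupChart (localRingAt (p i)) t)) [hq : q.IsPrime]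
    (htq : ⟨t, le_blowupChart _ _ ht⟩ ∈ q)
    (hdvr : IsDiscreteValuationRing (LocalSubring.ofPrime _ q).toSubring) :
    (LocalSubring.ofPrime _ q).toSubring = (fr.pointVal i).ring := by
  have hle : localRingAt (p i) ≤ blowupChart (localRingAt (p i)) t := le_blowupChart _ _
  have hRle := h.localRingAt_le_ring i
  obtain ⟨r, hr⟩ := (fr.pointVal i).exists_hasVal
    ((fr.pointVal i).ring_le_functionField (hRle ht)) ht0
  have hr0 := hr.mem_ring_iff.1 (hRle ht)
  have hr1 : r = 1 := by
    rcases lt_trichotomy r 1 with h1 | h1 | h1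
    -- if `t` has multiplicity zero, it is a unit
    · have hu : IsUnit (⟨t, ht⟩ : localRingAt (p i)) :=
        (h.isUnit_iff_hasVal (a := ⟨t, ht⟩) hr).2 (by omega)
      exact absurd (q.eq_top_of_isUnit_mem htq (hu.map (Subring.inclusion hle))) hq.ne_top
    · exact h1
    · -- if `t` has multiplicity at least two, then `1/t = t/t²` lies in the chart
      have h2 := h.div_pow_mem_blowupChart ht ht0 ht hr (N := 2) (by exact_mod_cast h1)
      have h3 : t / t ^ 2 * t = 1 := by field_simp
      have h4 : (1 : blowupChart (localRingAt (p i)) t) = ⟨t / t ^ 2, h2⟩ * ⟨t, hle ht⟩ :=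
        Subtype.ext h3.symm
      exact absurd ((Ideal.eq_top_iff_one q).2 (h4 ▸ q.mul_mem_left _ htq)) hq.ne_top
  subst hr1
  have hA := h.blowupChart_le_ring hr
  refine FormValuation.eq_ring_of_le hdvr ?_ (exists_eq_div_of_localRingAt_le
    (hle.trans (LocalSubring.le_ofPrime _ q)))
  intro f hf
  obtain ⟨a, b, hb, rfl⟩ := mem_ofPrime_iff.1 hf
  have hb0 : (b : CoordField k n (n + 1)) ≠ 0 := fun h0 =>
    hb (by rw [show b = 0 from Subtype.ext h0]; exact q.zero_mem)
  obtain ⟨s, hs⟩ := (fr.pointVal i).exists_hasVal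
    ((fr.pointVal i).ring_le_functionField (hA b.2)) hb0
  have hs0 := hs.mem_ring_iff.1 (hA b.2)
  -- a denominator of positive multiplicity would be divisible by `t` in the chart
  have hs1 : s = 0 := by
    by_contra hne
    obtain ⟨c, hc, N, hcN⟩ := exists_eq_div_pow_of_mem_blowupChart ht ht0 b.2
    have hcv : (fr.pointVal i).HasVal c (s + N) := by
      have := hs.mul (hr.pow N)
      rwa [hcN, div_mul_cancel₀ _ (pow_ne_zero _ ht0), mul_one] at this
    have h1 := h.div_pow_mem_blowupChart ht ht0 hc hcv (N := N + 1) (by push_cast; omega)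
    refine hb ?_
    have h2 : b = ⟨c / t ^ (N + 1), h1⟩ * ⟨t, hle ht⟩ := by
      refine Subtype.ext ?_
      change (b : CoordField k n (n + 1)) = c / t ^ (N + 1) * t
      rw [hcN]
      field_simp
      ring
    rw [h2]
    exact q.mul_mem_left _ htq
  subst hs1
  rw [div_eq_mul_inv]
  exact Subring.mul_mem _ (hA a.2) (hs.inv.mem_ring_iff.2 (by simp))

/-- The exceptional divisor is a point of codimension one of the blow-up. -/
lemma Represents.ring_pointVal_mem_blowup (h : fr.Represents p) (i : Fin (n + 2)) :
    (fr.pointVal i).ring ∈ blowup p := by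
  obtain ⟨j, hj⟩ := exists_ne i
  have hYi : eval (fr.point i) (fr.formY i) ≠ 0 := by simp [fr.eval_formY]
  have hYj : eval (fr.point i) (fr.formY j) = 0 := by simp [fr.eval_formY, hj]
  set t := quot (fr.formY j) (fr.formY i) with htdef
  have ht : t ∈ localRingAt (p i) :=
    h.mem_localRingAt.2 ⟨_, _, fr.formY_mem j, _, fr.formY_mem i, hYi, rfl⟩
  have ht0 : t ≠ 0 := quot_ne_zero (fr.formY_ne_zero _) (fr.formY_ne_zero _)
  have htn : (⟨t, ht⟩ : localRingAt (p i)) ∈ nonunits (localRingAt (p i)) := fun hu =>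
    (h.isUnit_iff (fr.formY_mem j) (fr.formY_mem i) hYi rfl).1 hu hYj
  have hRle := h.localRingAt_le_ring i
  have hr : (fr.pointVal i).HasVal t 1 := by
    have h1 := FormValuation.hasVal_quot (v := fr.pointVal i) (fr.formY_mem j) (fr.formY_mem i)
      (fr.formY_ne_zero _) (fr.formY_ne_zero _)
    rw [ord_eq_zero_of_eval_ne_zero hYi] at h1
    have h2 : (fr.pointVal i).ord (fr.formY j) = 1 := by
      refine le_antisymm ?_ (fr.ord_pos_of_eval_point_eq_zero (fr.formY_ne_zero _)
        (fr.formY_mem j) hYj)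
      have h3 := fr.ord_pointVal_le_weight (i := i) (f := fr.formY j)
        (s := Finsupp.single (Sum.inr j) 1) (by rw [psi_formY, support_X]; simp)
      simpa [Finsupp.weight_single, pointWeight, hj] using h3
    rw [h2] at h1
    simpa using h1
  have hA := h.blowupChart_le_ring hr
  have := (fr.pointVal i).isDiscreteValuationRing_ring
  let q : Ideal (blowupChart (localRingAt (p i)) t) :=
    Ideal.comap (Subring.inclusion hA) (IsLocalRing.maximalIdeal (fr.pointVal i).ring)
  have hqp : q.IsPrime := Ideal.comap_isPrime _ _
  refine Or.inr ⟨i, ⟨t, ht⟩, htn, fun h0 => ht0 (congrArg Subtype.val h0), q, hqp, ?_⟩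
  have hqmem : ∀ b : blowupChart (localRingAt (p i)) t,
      b ∉ q ↔ IsUnit (Subring.inclusion hA b) := fun b => by
    rw [Ideal.mem_comap, IsLocalRing.mem_maximalIdeal, mem_nonunits_iff, not_not]
  refine le_antisymm ?_ ?_
  · intro f hf
    rw [mem_ofPrime_iff]
    obtain ⟨d, G, hG, H, hH, hH0, hle, rfl⟩ := hf
    obtain ⟨g, hg, hgx⟩ := h.exists_form i d
    have hg0 : g ≠ 0 := fun h => hgx (by rw [h, map_zero])
    -- write `G / H` as the quotient of `(G / g) / tᴺ` and `(H / g) / tᴺ`, of which the second is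
    -- a unit along the exceptional divisor
    set N := (fr.pointVal i).ord H with hN
    have hHg : (fr.pointVal i).HasVal (quot H g) N := by
      have h1 := FormValuation.hasVal_quot (v := fr.pointVal i) hH hg hH0 hg0
      rw [ord_eq_zero_of_eval_ne_zero hgx] at h1
      simpa using h1
    have hmH := h.mem_localRingAt.2 ⟨d, H, hH, g, hg, hgx, rfl⟩
    have hmG := h.mem_localRingAt.2 ⟨d, G, hG, g, hg, hgx, rfl⟩
    have hcH := h.div_pow_mem_blowupChart ht ht0 hmH hHg (N := N) le_rfl
    have hcG : quot G g / t ^ N ∈ blowupChart (localRingAt (p i)) t := by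
      by_cases hG0 : G = 0
      · rw [hG0, show quot (0 : CoordRing k n (n + 1)) g = 0 by simp [quot], zero_div]
        exact Subring.zero_mem _
      · have hGg := FormValuation.hasVal_quot (v := fr.pointVal i) hG hg hG0 hg0
        rw [ord_eq_zero_of_eval_ne_zero hgx] at hGg
        exact h.div_pow_mem_blowupChart ht ht0 hmG hGg (by simpa using hle hG0)
    refine ⟨⟨_, hcG⟩, ⟨_, hcH⟩, (hqmem _).2 ?_, ?_⟩
    · have h1 := hHg.mul (hr.pow N).inv
      rw [← div_eq_mul_inv, mul_one, add_neg_cancel] at h1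
      exact (FormValuation.HasVal.isUnit_iff (x := Subring.inclusion hA ⟨_, hcH⟩) h1).2 rfl
    · rw [div_div_div_cancel_right₀ (pow_ne_zero _ ht0), quot_div_quot hg0]
  · intro f hf
    obtain ⟨a, b, hb, rfl⟩ := mem_ofPrime_iff.1 hf
    obtain ⟨c, hc⟩ := ((hqmem b).1 hb).dvd (a := 1)
    have h2 : (1 : CoordField k n (n + 1)) = b * c := congrArg Subtype.val hc
    rw [div_eq_mul_inv, ← eq_inv_of_mul_eq_one_right h2.symm]
    exact Subring.mul_mem _ (hA a.2) c.2

/-- The classification of the prime divisors of the blow-up: the strict transforms of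
irreducible hypersurfaces and the exceptional divisors. -/
lemma Represents.eq_ring_of_mem_blowup (h : fr.Represents p) (hn : 1 ≤ n)
    {R : Subring (CoordField k n (n + 1))} (hR : R ∈ blowup p)
    (hdvr : IsDiscreteValuationRing R) :
    (∃ (F : CoordRing k n (n + 1)) (d : ℕ × ℕ) (hF : Irreducible F)
      (hd : F ∈ biForms k n (n + 1) d),
      R = (primeVal hn (Nat.le_add_left 1 n) hF hd).ring) ∨ ∃ i, R = (fr.pointVal i).ring := by
  rcases hR with ⟨hR, -⟩ | ⟨i, t, -, ht0, q, hq, rfl⟩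
  · exact Or.inl (exists_eq_ring_primeVal_of_mem_productModel _ _ hR hdvr)
  · have ht0' : (t : CoordField k n (n + 1)) ≠ 0 := fun h0 => ht0 (Subtype.ext h0)
    by_cases htq : (⟨t, le_blowupChart _ _ t.2⟩ : blowupChart (localRingAt (p i)) _) ∈ q
    · exact Or.inr ⟨i, h.eq_ring_pointVal t.2 ht0' q htq hdvr⟩
    · exact Or.inl (h.exists_eq_ring_primeVal hn t.2 ht0' q htq hdvr)

lemma not_dvd_formY_or {F : CoordRing k n (n + 1)} (hF : Irreducible F) {j l : Fin (n + 2)}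
    (hjl : j ≠ l) : ¬ F ∣ fr.formY j ∨ ¬ F ∣ fr.formY l := by
  by_contra! hh
  have h1 := hF.associated_of_dvd
    (irreducible_of_mem_biForms (fr.formY_ne_zero j) rfl (fr.formY_mem j)) hh.1
  have h2 := hF.associated_of_dvd
    (irreducible_of_mem_biForms (fr.formY_ne_zero l) rfl (fr.formY_mem l)) hh.2
  obtain ⟨c, hc⟩ := (h1.symm.trans h2).dvd
  have h3 := congrArg (eval (fr.point l)) hc
  rw [map_mul, fr.eval_formY, fr.eval_formY, if_pos rfl, if_neg hjl, zero_mul] at h3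
  exact one_ne_zero h3

variable (fr) in
lemma exists_not_dvd_formY (hn : 1 ≤ n) {F : CoordRing k n (n + 1)} (hF : Irreducible F)
    (i : Fin (n + 2)) : ∃ j, j ≠ i ∧ ¬ F ∣ fr.formY j := by
  have hcard : 1 < (Finset.univ.erase i).card := by simp; omega
  obtain ⟨j, hj, l, hl, hjl⟩ := Finset.one_lt_card.1 hcard
  rcases not_dvd_formY_or (fr := fr) hF hjl with h | h
  · exact ⟨j, Finset.ne_of_mem_erase hj, h⟩
  · exact ⟨l, Finset.ne_of_mem_erase hl, h⟩

lemma Represents.ring_primeVal_mem_blowup (h : fr.Represents p) {hn : 1 ≤ n}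
    {F : CoordRing k n (n + 1)} {d : ℕ × ℕ} {hF : Irreducible F}
    {hd : F ∈ biForms k n (n + 1) d} :
    (primeVal hn (Nat.le_add_left 1 n) hF hd).ring ∈ blowup p := by
  refine Or.inl ⟨ring_primeVal_mem_productModel, fun i hi => ?_⟩
  obtain ⟨j, hji, hj⟩ := fr.exists_not_dvd_formY hn hF i
  have h1 : quot (fr.formY i) (fr.formY j) ∈ (primeVal hn (Nat.le_add_left 1 n) hF hd).ring := by
    rw [FormValuation.quot_mem_ring_iff (fr.formY_mem i) (fr.formY_mem j) (fr.formY_ne_zero _)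
      (fr.formY_ne_zero _), (ord_primeVal_eq_zero_iff (fr.formY_ne_zero _)).2 hj]
    exact Nat.zero_le _
  rw [hi] at h1
  obtain ⟨e, G, hG, H, hH, hHx, he⟩ := h.mem_localRingAt.1 h1
  rw [quot_eq_quot_iff (fr.formY_ne_zero _) (fun h => hHx (by rw [h, map_zero]))] at he
  have h2 := congrArg (eval (fr.point i)) he
  rw [map_mul, map_mul, fr.eval_formY, fr.eval_formY, if_pos rfl, if_neg hji, one_mul,
    mul_zero] at h2
  exact hHx h2

end Frame

end Classification

/-! ### Divisors of forms -/

section Divisors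

open MvPolynomial

variable {k : Type*} [Field k] {n : ℕ}

lemma finsum_single_apply {α : Type*} {f : α → ℤ} (hf : f.support.Finite) (b : α) :
    (∑ᶠ a, Finsupp.single a (f a)) b = f b := by
  classical
  rw [finsum_eq_sum_of_support_subset (s := hf.toFinset) _ (fun a ha => by
    simp only [Function.mem_support, ne_eq, Finsupp.single_eq_zero] at ha
    simpa using ha), Finsupp.finsetSum_apply]
  simp only [Finsupp.single_apply, Finset.sum_ite_eq', Set.Finite.mem_toFinset,
    Function.mem_support]
  by_cases h : f b = 0 <;> simp [h]

lemma ordAlong_eq {m s : ℕ} {p : Fin s → ProdPoint k n m} {P : PrimeDivisor p}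
    {v : FormValuation k n m} (hv : P.1 = v.ring) {f : CoordField k n m} {r : ℤ}
    (hr : v.HasVal f r) : ordAlong P f = r := by
  have hex : ∃ r, HasOrd P.1 f r := ⟨r, by rw [hv]; exact FormValuation.hasOrd_ring_iff.2 hr⟩
  rw [ordAlong, dif_pos hex]
  exact (FormValuation.hasOrd_ring_iff.1 (by simpa [hv] using hex.choose_spec)).unique hr

/-- The order of a form does not depend on the trivialization of `𝒪(d)`, all of which have
value `0`. -/
lemma pullbackOrd_eq {m s : ℕ} {p : Fin s → ProdPoint k n m} {P : PrimeDivisor p}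
    {v : FormValuation k n m} (hv : P.1 = v.ring) {d : ℕ × ℕ} {F : CoordRing k n m}
    (hF : F ∈ biForms k n m d) (hF0 : F ≠ 0) : pullbackOrd d F P = v.ord F := by
  obtain ⟨g, hg, hg0, hgv⟩ := v.exists_ord_eq_zero d
  have hex : ∃ G ∈ biForms k n m d, G ≠ 0 ∧ ∀ G' ∈ biForms k n m d, quot G' G ∈ P.1 := by
    refine ⟨g, hg, hg0, fun G' hG' => ?_⟩
    rw [hv]
    exact ⟨d, G', hG', g, hg, hg0, fun _ => by rw [hgv]; exact Nat.zero_le _, rfl⟩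
  rw [pullbackOrd, dif_pos hex]
  obtain ⟨hG, hG0, hGle⟩ := hex.choose_spec
  have h1 := hv.le (hGle g hg)
  rw [FormValuation.quot_mem_ring_iff hg hG hg0 hG0, hgv] at h1
  rw [ordAlong_eq hv (FormValuation.hasVal_quot hF hG hF0 hG0)]
  omega

lemma ord_primeVal_le_of_dvd {m : ℕ} {hn : 1 ≤ n} {hm : 1 ≤ m} {F F' : CoordRing k n m}
    {hF : Irreducible F}
    {d : ℕ × ℕ} {hd : F ∈ biForms k n m d} {hF' : Irreducible F'} {d' : ℕ × ℕ}
    {hd' : F' ∈ biForms k n m d'} (h : F' ∣ F) {G : CoordRing k n m} (hG : G ≠ 0) :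
    (primeVal hn hm hF hd).ord G ≤ (primeVal hn hm hF' hd').ord G :=
  (le_ord_primeVal_iff hG _).2
    ((pow_dvd_pow_of_dvd h _).trans ((le_ord_primeVal_iff hG _).1 le_rfl))

lemma FormValuation.ord_le_of_dvd {m : ℕ} (v : FormValuation k n m) {F G : CoordRing k n m}
    (hG : G ≠ 0) (h : F ∣ G) : v.ord F ≤ v.ord G := by
  obtain ⟨c, rfl⟩ := h
  rw [v.ord_mul (left_ne_zero_of_mul hG) (right_ne_zero_of_mul hG)]
  exact Nat.le_add_right _ _

lemma ring_primeVal_congr {m : ℕ} {hn : 1 ≤ n} {hm : 1 ≤ m} {F F' : CoordRing k n m}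
    {hF : Irreducible F}
    {d : ℕ × ℕ} {hd : F ∈ biForms k n m d} {hF' : Irreducible F'} {d' : ℕ × ℕ}
    {hd' : F' ∈ biForms k n m d'} (h : Associated F F') :
    (primeVal hn hm hF hd).ring = (primeVal hn hm hF' hd').ring := by
  have key : ∀ G : CoordRing k n m, G ≠ 0 →
      (primeVal hn hm hF hd).ord G = (primeVal hn hm hF' hd').ord G := fun G hG =>
    le_antisymm (ord_primeVal_le_of_dvd h.symm.dvd hG) (ord_primeVal_le_of_dvd h.dvd hG)
  ext f
  constructor
  · rintro ⟨d, G, hG, H, hH, hH0, hle, rfl⟩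
    exact ⟨d, G, hG, H, hH, hH0, fun hG0 => by rw [← key _ hH0, ← key _ hG0]; exact hle hG0, rfl⟩
  · rintro ⟨d, G, hG, H, hH, hH0, hle, rfl⟩
    exact ⟨d, G, hG, H, hH, hH0, fun hG0 => by rw [key _ hH0, key _ hG0]; exact hle hG0, rfl⟩

lemma ring_primeVal_eq_iff {m : ℕ} {hn : 1 ≤ n} {hm : 1 ≤ m} {F F' : CoordRing k n m}
    {hF : Irreducible F}
    {d : ℕ × ℕ} {hd : F ∈ biForms k n m d} {hF' : Irreducible F'} {d' : ℕ × ℕ}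
    {hd' : F' ∈ biForms k n m d'} :
    (primeVal hn hm hF hd).ring = (primeVal hn hm hF' hd').ring ↔ Associated F F' := by
  refine ⟨fun h => ?_, ring_primeVal_congr⟩
  have h1 := FormValuation.ord_eq_of_ring_eq h hd hF.ne_zero
  rw [ord_primeVal_self] at h1
  have h2 : F' ∣ F := by
    by_contra h2
    rw [(ord_primeVal_eq_zero_iff hF.ne_zero).2 h2] at h1
    omega
  exact (hF'.associated_of_dvd hF h2).symm

lemma biForms_degree_le_of_dvd {m : ℕ} {F G : CoordRing k n m} (hG : G ≠ 0) {d e : ℕ × ℕ}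
    (hd : F ∈ biForms k n m d) (he : G ∈ biForms k n m e) (h : F ∣ G) : d ≤ e := by
  obtain ⟨c, rfl⟩ := h
  obtain ⟨e₁, e₂, h1, h2, rfl⟩ := exists_mem_biForms_of_mul hG he
  rw [biForms_degree_unique (left_ne_zero_of_mul hG) hd h1]
  exact le_self_add

namespace Frame

variable {fr : Frame k n} {p : Fin (n + 2) → ProdPoint k n (n + 1)}

/-- The strict transform of the hypersurface `F = 0`. -/
noncomputable def Represents.primeDivisor (h : fr.Represents p) (hn : 1 ≤ n)
    {F : CoordRing k n (n + 1)} {d : ℕ × ℕ} (hF : Irreducible F)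
    (hd : F ∈ biForms k n (n + 1) d) : PrimeDivisor p :=
  ⟨(primeVal hn (Nat.le_add_left 1 n) hF hd).ring, h.ring_primeVal_mem_blowup,
    FormValuation.isDiscreteValuationRing_ring _⟩

/-- The exceptional divisor over `pᵢ`. -/
noncomputable def Represents.excDivisor (h : fr.Represents p) (i : Fin (n + 2)) :
    PrimeDivisor p :=
  ⟨(fr.pointVal i).ring, h.ring_pointVal_mem_blowup i,
    FormValuation.isDiscreteValuationRing_ring _⟩

lemma Represents.primeDivisor_or_excDivisor (h : fr.Represents p) (hn : 1 ≤ n)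
    (P : PrimeDivisor p) :
    (∃ (F : CoordRing k n (n + 1)) (d : ℕ × ℕ) (hF : Irreducible F)
      (hd : F ∈ biForms k n (n + 1) d), P = h.primeDivisor hn hF hd) ∨
    ∃ i, P = h.excDivisor i := by
  rcases h.eq_ring_of_mem_blowup hn P.2.1 P.2.2 with ⟨F, d, hF, hd, he⟩ | ⟨i, he⟩
  · exact Or.inl ⟨F, d, hF, hd, Subtype.ext he⟩
  · exact Or.inr ⟨i, Subtype.ext he⟩

lemma Represents.exists_val (h : fr.Represents p) (hn : 1 ≤ n) (P : PrimeDivisor p) :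
    ∃ v : FormValuation k n (n + 1), P.1 = v.ring := by
  rcases h.primeDivisor_or_excDivisor hn P with ⟨F, d, hF, hd, rfl⟩ | ⟨i, rfl⟩
  exacts [⟨_, rfl⟩, ⟨_, rfl⟩]

lemma Represents.primeDivisor_eq_iff (h : fr.Represents p) (hn : 1 ≤ n)
    {F F' : CoordRing k n (n + 1)} {d d' : ℕ × ℕ} (hF : Irreducible F)
    (hd : F ∈ biForms k n (n + 1) d) (hF' : Irreducible F') (hd' : F' ∈ biForms k n (n + 1) d') :
    h.primeDivisor hn hF hd = h.primeDivisor hn hF' hd' ↔ Associated F F' := by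
  rw [← ring_primeVal_eq_iff (hn := hn) (hm := Nat.le_add_left 1 n) (hd := hd) (hd' := hd')
    (hF := hF) (hF' := hF')]
  exact Subtype.ext_iff

lemma ord_pointVal_formY (i j : Fin (n + 2)) :
    (fr.pointVal i).ord (fr.formY j) = if j = i then 0 else 1 := by
  split_ifs with hj
  · exact ord_eq_zero_of_eval_ne_zero (by simp [fr.eval_formY, hj])
  · refine le_antisymm ?_ (fr.ord_pos_of_eval_point_eq_zero (fr.formY_ne_zero _)
      (fr.formY_mem j) (by simp [fr.eval_formY, hj]))
    have h3 := fr.ord_pointVal_le_weight (i := i) (f := fr.formY j)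
      (s := Finsupp.single (Sum.inr j) 1) (by rw [psi_formY, support_X]; simp)
    simpa [Finsupp.weight_single, pointWeight, hj] using h3

lemma Represents.primeDivisor_ne_excDivisor (h : fr.Represents p) (hn : 1 ≤ n)
    {F : CoordRing k n (n + 1)} {d : ℕ × ℕ} (hF : Irreducible F)
    (hd : F ∈ biForms k n (n + 1) d) (i : Fin (n + 2)) :
    h.primeDivisor hn hF hd ≠ h.excDivisor i := by
  intro he
  obtain ⟨j, hji, hj⟩ := fr.exists_not_dvd_formY hn hF i
  have h1 := FormValuation.ord_eq_of_ring_eq (congrArg Subtype.val he) (fr.formY_mem j)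
    (fr.formY_ne_zero j)
  rw [(ord_primeVal_eq_zero_iff (fr.formY_ne_zero j)).2 hj, ord_pointVal_formY, if_neg hji] at h1
  omega

lemma Represents.excDivisor_injective (h : fr.Represents p) :
    Function.Injective h.excDivisor := by
  intro i j he
  by_contra hij
  have h1 := FormValuation.ord_eq_of_ring_eq (congrArg Subtype.val he) (fr.formY_mem i)
    (fr.formY_ne_zero i)
  rw [ord_pointVal_formY, ord_pointVal_formY, if_pos rfl, if_neg hij] at h1
  omega

/-- Among the linear forms `formY j` with `j ≠ i`, which vanish at `pᵢ`, one does not vanish along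
a given prime divisor other than the exceptional divisor over `pᵢ`. -/
lemma Represents.liesOver_iff (h : fr.Represents p) (hn : 1 ≤ n) (P : PrimeDivisor p)
    (i : Fin (n + 2)) : LiesOver P (p i) ↔ P = h.excDivisor i := by
  constructor
  · intro hP
    have hx : ∀ j, j ≠ i → eval (Sum.elim (p i).1.rep (p i).2.rep) (fr.formY j) = 0 := by
      intro j hj
      rw [← h i, fr.eval_formY, if_neg hj]
    rcases h.primeDivisor_or_excDivisor hn P with ⟨F, d, hF, hd, rfl⟩ | ⟨l, rfl⟩
    · obtain ⟨j, hji, hj⟩ := fr.exists_not_dvd_formY hn hF i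
      have := ord_pos_of_dominates hP (fr.formY_mem j) (fr.formY_ne_zero j) (hx j hji)
      rw [(ord_primeVal_eq_zero_iff (fr.formY_ne_zero j)).2 hj] at this
      omega
    · by_contra hne
      have hli : l ≠ i := fun h' => hne (by rw [h'])
      have := ord_pos_of_dominates hP (fr.formY_mem l) (fr.formY_ne_zero l) (hx l hli)
      rw [ord_pointVal_formY, if_pos rfl] at this
      omega
  · rintro rfl
    exact h.dominates i

lemma Represents.E_eq (h : fr.Represents p) (hn : 1 ≤ n) (i : Fin (n + 2)) :
    E p i = divClass (Finsupp.single (h.excDivisor i) 1) := by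
  have : (∑ᶠ (P : PrimeDivisor p) (_ : LiesOver P (p i)), Finsupp.single P (1 : ℤ)) =
      Finsupp.single (h.excDivisor i) 1 := by
    simp only [h.liesOver_iff hn]
    rw [finsum_eq_single _ (h.excDivisor i) fun P hP => by simp [hP]]
    simp
  rw [E, this]

/-! ### The divisor of a form -/

lemma Represents.pullbackOrd_mul (h : fr.Represents p) (hn : 1 ≤ n)
    {F G : CoordRing k n (n + 1)} {d e : ℕ × ℕ} (hF : F ∈ biForms k n (n + 1) d) (hF0 : F ≠ 0)
    (hG : G ∈ biForms k n (n + 1) e) (hG0 : G ≠ 0) (P : PrimeDivisor p) :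
    pullbackOrd (d + e) (F * G) P = pullbackOrd d F P + pullbackOrd e G P := by
  obtain ⟨v, hv⟩ := h.exists_val hn P
  rw [pullbackOrd_eq hv hF hF0, pullbackOrd_eq hv hG hG0,
    pullbackOrd_eq hv (mul_mem_biForms hF hG) (mul_ne_zero hF0 hG0), v.ord_mul hF0 hG0]
  push_cast
  rfl

lemma Represents.pullbackOrd_of_isUnit (h : fr.Represents p) (hn : 1 ≤ n)
    {F : CoordRing k n (n + 1)} (hF : F ∈ biForms k n (n + 1) 0) (hF0 : F ≠ 0)
    (P : PrimeDivisor p) : pullbackOrd 0 F P = 0 := by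
  obtain ⟨v, hv⟩ := h.exists_val hn P
  rw [pullbackOrd_eq hv hF hF0, v.ord_of_isUnit (isUnit_of_mem_biForms_zero hF0 hF)]
  rfl

open Classical in
lemma Represents.pullbackOrd_irreducible (h : fr.Represents p) (hn : 1 ≤ n)
    {F : CoordRing k n (n + 1)} {d : ℕ × ℕ} (hF : Irreducible F)
    (hd : F ∈ biForms k n (n + 1) d) (P : PrimeDivisor p) :
    pullbackOrd d F P = (Finsupp.single (h.primeDivisor hn hF hd) (1 : ℤ) +
      ∑ i, ((fr.pointVal i).ord F : ℤ) • Finsupp.single (h.excDivisor i) (1 : ℤ)) P := by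
  rw [Finsupp.add_apply, Finsupp.finsetSum_apply]
  rcases h.primeDivisor_or_excDivisor hn P with ⟨F', d', hF', hd', rfl⟩ | ⟨l, rfl⟩
  · rw [pullbackOrd_eq rfl hd hF.ne_zero, Finset.sum_eq_zero fun i _ => by
      rw [Finsupp.smul_apply, Finsupp.single_eq_of_ne (h.primeDivisor_ne_excDivisor hn hF' hd' i),
        smul_zero], add_zero, Finsupp.single_apply, h.primeDivisor_eq_iff]
    split_ifs with ha
    · rw [FormValuation.ord_eq_of_ring_eq (ring_primeVal_congr (hF' := hF) (hd' := hd) ha.symm) hd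
        hF.ne_zero,
        ord_primeVal_self]
      rfl
    · rw [(ord_primeVal_eq_zero_iff hF.ne_zero).2
        fun hdvd => ha (hF'.associated_of_dvd hF hdvd).symm]
      rfl
  · rw [pullbackOrd_eq rfl hd hF.ne_zero,
      Finsupp.single_eq_of_ne (h.primeDivisor_ne_excDivisor hn hF hd l).symm, zero_add,
      Finset.sum_eq_single l (fun i _ hi => by
        rw [Finsupp.smul_apply, Finsupp.single_eq_of_ne
          fun he => hi (h.excDivisor_injective he).symm, smul_zero]) (by simp),
      Finsupp.smul_apply, Finsupp.single_eq_same, smul_eq_mul, mul_one]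

lemma Represents.finite_support_pullbackOrd (h : fr.Represents p) (hn : 1 ≤ n)
    {F : CoordRing k n (n + 1)} {d : ℕ × ℕ} (hF0 : F ≠ 0) (hF : F ∈ biForms k n (n + 1) d) :
    (Function.support fun P : PrimeDivisor p => pullbackOrd d F P).Finite := by
  refine form_induction (motive := fun F d =>
    (Function.support fun P : PrimeDivisor p => pullbackOrd d F P).Finite) ?_ ?_ hF0 hF
  · intro f h0 hf
    convert Set.finite_empty
    ext P
    simp [h.pullbackOrd_of_isUnit hn hf h0]
  · intro f g d e hfi hf hg0 hg ih
    refine ((Finsupp.hasFiniteSupport (Finsupp.single (h.primeDivisor hn hfi hf) (1 : ℤ) +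
      ∑ i, ((fr.pointVal i).ord f : ℤ) • Finsupp.single (h.excDivisor i) (1 : ℤ))).union
      ih).subset ?_
    intro P hP
    rw [Function.mem_support, h.pullbackOrd_mul hn hf hfi.ne_zero hg hg0,
      h.pullbackOrd_irreducible hn hfi hf] at hP
    by_contra hnot
    simp only [Set.mem_union, Function.mem_support, not_or, not_not] at hnot
    exact hP (by rw [hnot.1, hnot.2, add_zero])

lemma Represents.pullbackDivisor_apply (h : fr.Represents p) (hn : 1 ≤ n)
    {F : CoordRing k n (n + 1)} {d : ℕ × ℕ} (hF0 : F ≠ 0) (hF : F ∈ biForms k n (n + 1) d)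
    (P : PrimeDivisor p) : pullbackDivisor p d F P = pullbackOrd d F P :=
  finsum_single_apply (h.finite_support_pullbackOrd hn hF0 hF) P

lemma Represents.pullbackDivisor_mul (h : fr.Represents p) (hn : 1 ≤ n)
    {F G : CoordRing k n (n + 1)} {d e : ℕ × ℕ} (hF0 : F ≠ 0) (hF : F ∈ biForms k n (n + 1) d)
    (hG0 : G ≠ 0) (hG : G ∈ biForms k n (n + 1) e) :
    pullbackDivisor p (d + e) (F * G) = pullbackDivisor p d F + pullbackDivisor p e G := by
  ext P
  rw [Finsupp.add_apply, h.pullbackDivisor_apply hn (mul_ne_zero hF0 hG0) (mul_mem_biForms hF hG),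
    h.pullbackDivisor_apply hn hF0 hF, h.pullbackDivisor_apply hn hG0 hG,
    h.pullbackOrd_mul hn hF hF0 hG hG0]

lemma Represents.pullbackDivisor_unit (h : fr.Represents p) (hn : 1 ≤ n)
    {F : CoordRing k n (n + 1)} (hF0 : F ≠ 0) (hF : F ∈ biForms k n (n + 1) 0) :
    pullbackDivisor p 0 F = 0 := by
  ext P
  rw [h.pullbackDivisor_apply hn hF0 hF, h.pullbackOrd_of_isUnit hn hF hF0]
  rfl

/-- The pullback of `F = 0` is its strict transform plus the exceptional divisors, with the
multiplicities of `F` at the points. -/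
lemma Represents.pullbackDivisor_irreducible (h : fr.Represents p) (hn : 1 ≤ n)
    {F : CoordRing k n (n + 1)} {d : ℕ × ℕ} (hF : Irreducible F)
    (hd : F ∈ biForms k n (n + 1) d) :
    pullbackDivisor p d F = Finsupp.single (h.primeDivisor hn hF hd) (1 : ℤ) +
      ∑ i, ((fr.pointVal i).ord F : ℤ) • Finsupp.single (h.excDivisor i) (1 : ℤ) := by
  ext P
  rw [h.pullbackDivisor_apply hn hF.ne_zero hd, h.pullbackOrd_irreducible hn hF hd]

lemma Represents.pullbackDivisor_pow (h : fr.Represents p) (hn : 1 ≤ n)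
    {F : CoordRing k n (n + 1)} {d : ℕ × ℕ} (hF0 : F ≠ 0) (hF : F ∈ biForms k n (n + 1) d)
    (r : ℕ) : pullbackDivisor p (r • d) (F ^ r) = (r : ℤ) • pullbackDivisor p d F := by
  induction r with
  | zero =>
    rw [zero_smul, pow_zero, h.pullbackDivisor_unit hn one_ne_zero one_mem_biForms]
    simp
  | succ r ih =>
    rw [succ_nsmul, pow_succ, h.pullbackDivisor_mul hn (pow_ne_zero _ hF0) (pow_mem_biForms hF r)
      hF0 hF, ih]
    push_cast
    rw [add_smul, one_smul]

lemma Represents.ordAlong_quot (h : fr.Represents p) (hn : 1 ≤ n)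
    {G H : CoordRing k n (n + 1)} {d : ℕ × ℕ} (hG0 : G ≠ 0) (hG : G ∈ biForms k n (n + 1) d)
    (hH0 : H ≠ 0) (hH : H ∈ biForms k n (n + 1) d) (P : PrimeDivisor p) :
    ordAlong P (quot G H) = (pullbackDivisor p d G - pullbackDivisor p d H) P := by
  obtain ⟨v, hv⟩ := h.exists_val hn P
  rw [Finsupp.sub_apply, h.pullbackDivisor_apply hn hG0 hG, h.pullbackDivisor_apply hn hH0 hH,
    pullbackOrd_eq hv hG hG0, pullbackOrd_eq hv hH hH0,
    ordAlong_eq hv (FormValuation.hasVal_quot hG hH hG0 hH0)]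

lemma Represents.isPrincipal_iff (h : fr.Represents p) (hn : 1 ≤ n) (D : WeilDivisor p) :
    IsPrincipal D ↔ ∃ d, ∃ G ∈ biForms k n (n + 1) d, ∃ H ∈ biForms k n (n + 1) d,
      G ≠ 0 ∧ H ≠ 0 ∧ D = pullbackDivisor p d G - pullbackDivisor p d H := by
  constructor
  · rintro ⟨f, ⟨d, G, hG, H, hH, hHb, rfl⟩, hf0, hD⟩
    have hH0 : H ≠ 0 := by simpa using hHb
    have hG0 := ne_zero_of_quot_ne_zero hf0
    exact ⟨d, G, hG, H, hH, hG0, hH0, Finsupp.ext fun P => by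
      rw [hD, h.ordAlong_quot hn hG0 hG hH0 hH]⟩
  · rintro ⟨d, G, hG, H, hH, hG0, hH0, rfl⟩
    exact ⟨quot G H, ⟨d, G, hG, H, hH, by simpa using hH0, rfl⟩, quot_ne_zero hG0 hH0, fun P =>
      (h.ordAlong_quot hn hG0 hG hH0 hH P).symm⟩

end Frame

end Divisors

/-! ### Degrees of divisors and the coordinates on `N¹(X)` -/

section Degrees

open MvPolynomial

variable {k : Type*} [Field k] {n : ℕ}

lemma toReal_apply {m s : ℕ} {p : Fin s → ProdPoint k n m} (D : WeilDivisor p)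
    (P : PrimeDivisor p) : toReal D P = (D P : ℝ) := by
  simp [toReal]

lemma toReal_add {m s : ℕ} {p : Fin s → ProdPoint k n m} (D D' : WeilDivisor p) :
    toReal (D + D') = toReal D + toReal D' := by
  ext P; simp [toReal_apply]

lemma toReal_sub {m s : ℕ} {p : Fin s → ProdPoint k n m} (D D' : WeilDivisor p) :
    toReal (D - D') = toReal D - toReal D' := by
  ext P; simp [toReal_apply]

lemma toReal_zsmul {m s : ℕ} {p : Fin s → ProdPoint k n m} (a : ℤ) (D : WeilDivisor p) :
    toReal (a • D) = (a : ℝ) • toReal D := by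
  ext P; simp [toReal_apply]

lemma toReal_zero {m s : ℕ} {p : Fin s → ProdPoint k n m} :
    toReal (0 : WeilDivisor p) = 0 := by
  ext P; simp [toReal_apply]

lemma toReal_single {m s : ℕ} {p : Fin s → ProdPoint k n m} (P : PrimeDivisor p) (a : ℤ) :
    toReal (Finsupp.single P a) = Finsupp.single P (a : ℝ) := by
  simp [toReal]

lemma toReal_sum {m s : ℕ} {p : Fin s → ProdPoint k n m} {ι : Type*} (t : Finset ι)
    (D : ι → WeilDivisor p) : toReal (∑ i ∈ t, D i) = ∑ i ∈ t, toReal (D i) := by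
  ext P; simp [toReal_apply, Finsupp.finsetSum_apply]

/-- The coordinates `(d₁, d₂, μ)` of a class `d₁ H₁ + d₂ H₂ - ∑ μᵢ Eᵢ`. -/
abbrev Coords (n : ℕ) : Type := ℝ × ℝ × (Fin (n + 2) → ℝ)

namespace Frame

variable {fr : Frame k n} {p : Fin (n + 2) → ProdPoint k n (n + 1)}

variable (fr) in
/-- The coordinates of the class of the strict transform of a form `F` of bidegree `d`. -/
noncomputable def formDegree (d : ℕ × ℕ) (F : CoordRing k n (n + 1)) : Coords n :=
  (d.1, d.2, fun i => (fr.pointVal i).ord F)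

open Classical in
/-- The coordinates of the class of a prime divisor. -/
noncomputable def Represents.degP (h : fr.Represents p) (hn : 1 ≤ n) (P : PrimeDivisor p) :
    Coords n :=
  if hP : ∃ x : CoordRing k n (n + 1) × (ℕ × ℕ), ∃ (hF : Irreducible x.1)
      (hd : x.1 ∈ biForms k n (n + 1) x.2), P = h.primeDivisor hn hF hd then
    fr.formDegree hP.choose.2 hP.choose.1
  else (0, 0, fun i => if P = h.excDivisor i then -1 else 0)

lemma Represents.degP_primeDivisor (h : fr.Represents p) (hn : 1 ≤ n)
    {F : CoordRing k n (n + 1)} {d : ℕ × ℕ} (hF : Irreducible F)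
    (hd : F ∈ biForms k n (n + 1) d) :
    h.degP hn (h.primeDivisor hn hF hd) = fr.formDegree d F := by
  have hP : ∃ x : CoordRing k n (n + 1) × (ℕ × ℕ), ∃ (hF' : Irreducible x.1)
      (hd' : x.1 ∈ biForms k n (n + 1) x.2),
      h.primeDivisor hn hF hd = h.primeDivisor hn hF' hd' := ⟨(F, d), hF, hd, rfl⟩
  rw [degP, dif_pos hP]
  obtain ⟨hF', hd', he⟩ := hP.choose_spec
  have ha := (h.primeDivisor_eq_iff hn hF hd hF' hd').1 he
  have h1 : hP.choose.2 = d := le_antisymm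
    (biForms_degree_le_of_dvd hF.ne_zero hd' hd ha.symm.dvd)
    (biForms_degree_le_of_dvd hF'.ne_zero hd hd' ha.dvd)
  have h2 : ∀ i, (fr.pointVal i).ord hP.choose.1 = (fr.pointVal i).ord F := fun i => le_antisymm
    (FormValuation.ord_le_of_dvd _ hF.ne_zero ha.symm.dvd)
    (FormValuation.ord_le_of_dvd _ hF'.ne_zero ha.dvd)
  simp only [formDegree, h1, h2]

lemma Represents.degP_excDivisor (h : fr.Represents p) (hn : 1 ≤ n) (i : Fin (n + 2)) :
    h.degP hn (h.excDivisor i) = (0, 0, -Pi.single i 1) := by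
  rw [degP, dif_neg]
  · ext j
    · rfl
    · rfl
    · simp only [h.excDivisor_injective.eq_iff, Pi.neg_apply, Pi.single_apply]
      by_cases hij : i = j
      · simp [hij]
      · simp [hij, Ne.symm hij]
  · rintro ⟨x, hF, hd, he⟩
    exact h.primeDivisor_ne_excDivisor hn hF hd i he.symm

/-- The coordinates of the class of a real divisor. -/
noncomputable def Represents.deg (h : fr.Represents p) (hn : 1 ≤ n) :
    (PrimeDivisor p →₀ ℝ) →ₗ[ℝ] Coords n :=
  Finsupp.linearCombination ℝ (h.degP hn)

lemma Represents.deg_single (h : fr.Represents p) (hn : 1 ≤ n) (P : PrimeDivisor p) (a : ℝ) :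
    h.deg hn (Finsupp.single P a) = a • h.degP hn P :=
  Finsupp.linearCombination_single ℝ a P

lemma Represents.deg_pullbackDivisor (h : fr.Represents p) (hn : 1 ≤ n)
    {F : CoordRing k n (n + 1)} {d : ℕ × ℕ} (hF0 : F ≠ 0) (hF : F ∈ biForms k n (n + 1) d) :
    h.deg hn (toReal (pullbackDivisor p d F)) = ((d.1 : ℝ), (d.2 : ℝ), 0) := by
  refine form_induction (motive := fun F d =>
    h.deg hn (toReal (pullbackDivisor p d F)) = ((d.1 : ℝ), (d.2 : ℝ), 0)) ?_ ?_ hF0 hF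
  · intro f hf0 hf
    rw [h.pullbackDivisor_unit hn hf0 hf, toReal_zero, map_zero]
    simp
    rfl
  · intro f g d e hfi hf hg0 hg ih
    rw [h.pullbackDivisor_mul hn hfi.ne_zero hf hg0 hg, toReal_add, map_add, ih,
      h.pullbackDivisor_irreducible hn hfi hf, toReal_add, toReal_sum, map_add, map_sum]
    simp only [toReal_zsmul, toReal_single, map_smul, h.deg_single, h.degP_primeDivisor,
      h.degP_excDivisor, Int.cast_one, one_smul]
    ext j
    · simp [formDegree, Prod.fst_sum]
    · simp [formDegree, Prod.fst_sum, Prod.snd_sum]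
    · simp [formDegree, Prod.snd_sum, Finset.sum_apply, Pi.single_apply]

lemma Represents.deg_eq_zero_of_isPrincipal (h : fr.Represents p) (hn : 1 ≤ n)
    {D : WeilDivisor p} (hD : IsPrincipal D) : h.deg hn (toReal D) = 0 := by
  obtain ⟨d, G, hG, H, hH, hG0, hH0, rfl⟩ := (h.isPrincipal_iff hn D).1 hD
  rw [toReal_sub, map_sub, h.deg_pullbackDivisor hn hG0 hG, h.deg_pullbackDivisor hn hH0 hH,
    sub_self]

/-- Every divisor is the difference of two divisors of forms plus a combination of exceptional
divisors. -/
lemma Represents.exists_decomposition (h : fr.Represents p) (hn : 1 ≤ n) (D : WeilDivisor p) :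
    ∃ d, ∃ G ∈ biForms k n (n + 1) d, ∃ e, ∃ H ∈ biForms k n (n + 1) e, ∃ c : Fin (n + 2) → ℤ,
      G ≠ 0 ∧ H ≠ 0 ∧ D = pullbackDivisor p d G - pullbackDivisor p e H +
        ∑ i, c i • Finsupp.single (h.excDivisor i) 1 := by
  induction D using Finsupp.induction_linear with
  | zero =>
    exact ⟨0, 1, one_mem_biForms, 0, 1, one_mem_biForms, 0, one_ne_zero, one_ne_zero, by simp⟩
  | add D D' hD hD' =>
    obtain ⟨d, G, hG, e, H, hH, c, hG0, hH0, rfl⟩ := hD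
    obtain ⟨d', G', hG', e', H', hH', c', hG0', hH0', rfl⟩ := hD'
    refine ⟨d + d', _, mul_mem_biForms hG hG', e + e', _, mul_mem_biForms hH hH', c + c',
      mul_ne_zero hG0 hG0', mul_ne_zero hH0 hH0', ?_⟩
    rw [h.pullbackDivisor_mul hn hG0 hG hG0' hG', h.pullbackDivisor_mul hn hH0 hH hH0' hH']
    simp only [Pi.add_apply, add_smul, Finset.sum_add_distrib]
    abel
  | single P a =>
    rcases h.primeDivisor_or_excDivisor hn P with ⟨F, d, hF, hd, rfl⟩ | ⟨l, rfl⟩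
    · have key : Finsupp.single (h.primeDivisor hn hF hd) (1 : ℤ) = pullbackDivisor p d F -
          ∑ i, ((fr.pointVal i).ord F : ℤ) • Finsupp.single (h.excDivisor i) (1 : ℤ) := by
        rw [h.pullbackDivisor_irreducible hn hF hd, add_sub_cancel_right]
      have ha : Finsupp.single (h.primeDivisor hn hF hd) a =
          a • Finsupp.single (h.primeDivisor hn hF hd) (1 : ℤ) := by simp
      have h1 : pullbackDivisor p (0 : ℕ × ℕ) (1 : CoordRing k n (n + 1)) = 0 :=
        h.pullbackDivisor_unit hn one_ne_zero one_mem_biForms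
      rcases a.eq_nat_or_neg with ⟨r, rfl | rfl⟩
      · refine ⟨r • d, F ^ r, pow_mem_biForms hd r, 0, 1, one_mem_biForms,
          fun i => - (r * (fr.pointVal i).ord F), pow_ne_zero _ hF.ne_zero, one_ne_zero, ?_⟩
        rw [ha, key, h.pullbackDivisor_pow hn hF.ne_zero hd, h1, smul_sub, Finset.smul_sum]
        simp only [neg_smul, Finset.sum_neg_distrib, mul_smul, sub_eq_add_neg, neg_zero,
          add_zero]
      · refine ⟨0, 1, one_mem_biForms, r • d, F ^ r, pow_mem_biForms hd r,
          fun i => r * (fr.pointVal i).ord F, one_ne_zero, pow_ne_zero _ hF.ne_zero, ?_⟩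
        rw [ha, key, h.pullbackDivisor_pow hn hF.ne_zero hd, h1, smul_sub, Finset.smul_sum]
        simp only [neg_smul, Finset.sum_neg_distrib, mul_smul, zero_sub, sub_neg_eq_add]
    · refine ⟨0, 1, one_mem_biForms, 0, 1, one_mem_biForms, Pi.single l a, one_ne_zero,
        one_ne_zero, ?_⟩
      rw [sub_self, zero_add, Finset.sum_eq_single l (fun i _ hi => by simp [hi]) (by simp)]
      simp

/-- Integral divisors of degree zero are principal, since the exceptional parts cancel and the two
forms have the same bidegree. -/
lemma Represents.isPrincipal_iff_deg (h : fr.Represents p) (hn : 1 ≤ n) (D : WeilDivisor p) :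
    IsPrincipal D ↔ h.deg hn (toReal D) = 0 := by
  refine ⟨h.deg_eq_zero_of_isPrincipal hn, fun hD => ?_⟩
  obtain ⟨d, G, hG, e, H, hH, c, hG0, hH0, rfl⟩ := h.exists_decomposition hn D
  rw [toReal_add, toReal_sub, map_add, map_sub, h.deg_pullbackDivisor hn hG0 hG,
    h.deg_pullbackDivisor hn hH0 hH, toReal_sum, map_sum] at hD
  simp only [toReal_zsmul, toReal_single, map_smul, h.deg_single,
      h.degP_excDivisor, Int.cast_one, one_smul] at hD
  have h1 := congrArg Prod.fst hD
  have h2 := congrArg (fun x => x.2.1) hD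
  have h3 := fun j => congrFun (congrArg (fun x => x.2.2) hD) j
  simp [Prod.fst_sum, Prod.snd_sum, Finset.sum_apply, Pi.single_apply] at h1 h2 h3
  have hde : d = e := Prod.ext (by exact_mod_cast sub_eq_zero.1 h1)
    (by exact_mod_cast sub_eq_zero.1 h2)
  subst hde
  rw [h.isPrincipal_iff hn]
  exact ⟨d, G, hG, H, hH, hG0, hH0, by simp [h3]⟩

/-- The coordinates of a class in `N¹(X)`. -/
noncomputable def Represents.coords (h : fr.Represents p) (hn : 1 ≤ n) :
    N1 p →ₗ[ℝ] Coords n :=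
  Submodule.liftQ _ (h.deg hn) <| by
    rw [Submodule.span_le]
    rintro _ ⟨D, hD, rfl⟩
    exact h.deg_eq_zero_of_isPrincipal hn hD

lemma Represents.coords_divClass (h : fr.Represents p) (hn : 1 ≤ n) (D : WeilDivisor p) :
    h.coords hn (divClass D) = h.deg hn (toReal D) :=
  Submodule.liftQ_apply _ _ _

/-- The class with given coordinates. -/
noncomputable def ofCoords (p : Fin (n + 2) → ProdPoint k n (n + 1)) : Coords n →ₗ[ℝ] N1 p :=
  (LinearMap.fst ℝ ℝ _).smulRight (H₁ p) +
    ((LinearMap.fst ℝ ℝ _).comp (LinearMap.snd ℝ ℝ _)).smulRight (H₂ p) -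
    ∑ i, (((LinearMap.proj i).comp (LinearMap.snd ℝ ℝ _)).comp
      (LinearMap.snd ℝ ℝ _)).smulRight (E p i)

lemma ofCoords_apply (v : Coords n) :
    ofCoords p v = v.1 • H₁ p + v.2.1 • H₂ p - ∑ i, v.2.2 i • E p i := by
  simp [ofCoords, LinearMap.sum_apply]

lemma Represents.coords_ofCoords (h : fr.Represents p) (hn : 1 ≤ n) (v : Coords n) :
    h.coords hn (ofCoords p v) = v := by
  have hX : h.coords hn (H₁ p) = (1, 0, 0) := by
    rw [H₁, h.coords_divClass, h.deg_pullbackDivisor hn (X_ne_zero _) (X_inl_mem_biForms 0)]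
    simp
  have hY : h.coords hn (H₂ p) = (0, 1, 0) := by
    rw [H₂, h.coords_divClass, h.deg_pullbackDivisor hn (X_ne_zero _) (X_inr_mem_biForms 0)]
    simp
  have hE : ∀ i, h.coords hn (E p i) = (0, 0, -Pi.single i 1) := fun i => by
    rw [h.E_eq hn, h.coords_divClass, toReal_single, h.deg_single, h.degP_excDivisor]
    simp
  rw [ofCoords_apply]
  simp only [map_sub, map_add, map_sum, map_smul, hX, hY, hE]
  ext j
  · simp [Prod.fst_sum]
  · simp [Prod.snd_sum, Prod.fst_sum]
  · simp [Prod.snd_sum, Finset.sum_apply, Pi.single_apply]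

lemma divClass_eq_of_isPrincipal {D D' : WeilDivisor p} (hD : IsPrincipal (D - D')) :
    divClass D = divClass D' := by
  refine (Submodule.Quotient.eq _).2 (Submodule.subset_span ⟨_, hD, ?_⟩)
  rw [toReal_sub]

lemma divClass_add (D D' : WeilDivisor p) : divClass (D + D') = divClass D + divClass D' := by
  rw [divClass, toReal_add, Submodule.Quotient.mk_add]; rfl

lemma divClass_zsmul (a : ℤ) (D : WeilDivisor p) : divClass (a • D) = (a : ℝ) • divClass D := by
  rw [divClass, toReal_zsmul, Submodule.Quotient.mk_smul]; rfl

lemma divClass_sum {ι : Type*} (t : Finset ι) (D : ι → WeilDivisor p) :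
    divClass (∑ i ∈ t, D i) = ∑ i ∈ t, divClass (D i) := by
  classical
  induction t using Finset.induction_on with
  | empty => simp [divClass, toReal_zero]
  | insert a t ha ih => rw [Finset.sum_insert ha, Finset.sum_insert ha, divClass_add, ih]

lemma Represents.ofCoords_surjective (h : fr.Represents p) (hn : 1 ≤ n) :
    Function.Surjective (ofCoords p) := by
  rw [← LinearMap.range_eq_top, eq_top_iff]
  rintro c -
  obtain ⟨x, rfl⟩ := Submodule.Quotient.mk_surjective _ c
  induction x using Finsupp.induction_linear with
  | zero => exact Submodule.zero_mem _
  | add x y hx hy => exact Submodule.add_mem _ hx hy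
  | single P a =>
    have hE : ∀ i, divClass (Finsupp.single (h.excDivisor i) 1) ∈
        LinearMap.range (ofCoords p) := fun i => by
      refine ⟨(0, 0, -Pi.single i 1), ?_⟩
      rw [← h.E_eq hn, ofCoords_apply]
      simp [Pi.single_apply]
    have hP : divClass (Finsupp.single P 1) ∈ LinearMap.range (ofCoords p) := by
      rcases h.primeDivisor_or_excDivisor hn P with ⟨F, d, hF, hd, rfl⟩ | ⟨l, rfl⟩
      · have key : Finsupp.single (h.primeDivisor hn hF hd) (1 : ℤ) +
            ∑ i, ((fr.pointVal i).ord F : ℤ) • Finsupp.single (h.excDivisor i) (1 : ℤ) =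
            pullbackDivisor p d F := (h.pullbackDivisor_irreducible hn hF hd).symm
        -- the divisor of `F` is equivalent to a combination of coordinate hyperplanes
        have hx := X_inl_mem_biForms (k := k) (m := n + 1) (0 : Fin (n + 1))
        have hy := X_inr_mem_biForms (k := k) (n := n) (0 : Fin (n + 1 + 1))
        have hx0 : (X (Sum.inl 0) : CoordRing k n (n + 1)) ≠ 0 := X_ne_zero _
        have hy0 : (X (Sum.inr 0) : CoordRing k n (n + 1)) ≠ 0 := X_ne_zero _
        have hlin : divClass (pullbackDivisor p d F) =
            (d.1 : ℝ) • H₁ p + (d.2 : ℝ) • H₂ p := by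
          have h1 := h.pullbackDivisor_mul hn (pow_ne_zero d.1 hx0) (pow_mem_biForms hx d.1)
            (pow_ne_zero d.2 hy0) (pow_mem_biForms hy d.2)
          rw [h.pullbackDivisor_pow hn hx0 hx, h.pullbackDivisor_pow hn hy0 hy] at h1
          have h2 : d.1 • ((1 : ℕ), (0 : ℕ)) + d.2 • ((0 : ℕ), (1 : ℕ)) = d := by
            ext <;> simp
          rw [h2] at h1
          have hmem := mul_mem_biForms (pow_mem_biForms hx d.1) (pow_mem_biForms hy d.2)
          rw [h2] at hmem
          have h3 := divClass_eq_of_isPrincipal ((h.isPrincipal_iff hn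
            (pullbackDivisor p d F - pullbackDivisor p d
              (X (Sum.inl 0) ^ d.1 * X (Sum.inr 0) ^ d.2))).2
            ⟨d, F, hd, _, hmem, hF.ne_zero, mul_ne_zero (pow_ne_zero _ hx0)
              (pow_ne_zero _ hy0), rfl⟩)
          rw [h3, h1, divClass_add, divClass_zsmul, divClass_zsmul]
          simp [H₁, H₂]
        have h1 := congrArg divClass key
        rw [divClass_add, hlin, divClass_sum] at h1
        rw [eq_sub_of_add_eq h1]
        refine Submodule.sub_mem _ ⟨((d.1 : ℝ), (d.2 : ℝ), 0), by rw [ofCoords_apply]; simp⟩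
          (Submodule.sum_mem _ fun i _ => ?_)
        rw [divClass_zsmul]
        exact Submodule.smul_mem _ _ (hE i)
      · exact hE l
    have : (Submodule.Quotient.mk (Finsupp.single P a) : N1 p) =
        a • divClass (Finsupp.single P 1) := by
      rw [divClass, toReal_single, ← Submodule.Quotient.mk_smul]
      simp
    rw [this]
    exact Submodule.smul_mem _ _ hP

lemma Represents.ofCoords_coords (h : fr.Represents p) (hn : 1 ≤ n) (c : N1 p) :
    ofCoords p (h.coords hn c) = c := by
  obtain ⟨v, rfl⟩ := h.ofCoords_surjective hn c
  rw [h.coords_ofCoords]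

end Frame

end Degrees

/-! ### Multiplicities of forms -/

section Multiplicities

open MvPolynomial

variable {k : Type*} [Field k] {n : ℕ}

namespace Frame

variable (fr : Frame k n)

/-- Every monomial `s` of `F` in the coordinates `u`, `y` has at least `ordᵢ F` factors other than
`uᵢ` and `yᵢ`. -/
lemma exponents_add_ord_le {d : ℕ × ℕ} {F : CoordRing k n (n + 1)}
    (hF : F ∈ biForms k n (n + 1) d) {s : Fin (n + 2) ⊕ Fin (n + 2) →₀ ℕ}
    (hs : s ∈ (fr.psi F).support) (i : Fin (n + 2)) :
    (fr.pointVal i).ord F + (s (Sum.inl i) + s (Sum.inr i)) ≤ d.1 + d.2 := by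
  obtain ⟨h1, h2⟩ := fr.sum_exponents hF hs
  rw [← h1, ← h2, ← weight_pointWeight i s]
  exact Nat.add_le_add_right (fr.ord_pointVal_le_weight hs) _

lemma psi_support_nonempty {F : CoordRing k n (n + 1)} (hF0 : F ≠ 0) :
    (fr.psi F).support.Nonempty := by
  rw [Finset.nonempty_iff_ne_empty, ne_eq, MvPolynomial.support_eq_empty]
  exact (map_ne_zero_iff _ fr.psi_injective).2 hF0

lemma ord_pointVal_le {d : ℕ × ℕ} {F : CoordRing k n (n + 1)} (hF0 : F ≠ 0)
    (hF : F ∈ biForms k n (n + 1) d) (i : Fin (n + 2)) :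
    (fr.pointVal i).ord F ≤ d.1 + d.2 := by
  obtain ⟨s, hs⟩ := fr.psi_support_nonempty hF0
  have := fr.exponents_add_ord_le hF hs i
  omega

lemma eq_sum_sec (j : Fin (n + 2)) (F : CoordRing k n (n + 1)) :
    F = ∑ s ∈ (fr.psi F).support, C (coeff s (fr.psi F)) *
      ((∏ l, fr.formX j l ^ s (Sum.inl l)) * ∏ l, fr.formY l ^ s (Sum.inr l)) := by
  conv_lhs => rw [← fr.sec_psi j F, sec, aeval_def, eval₂_eq']
  refine Finset.sum_congr rfl fun s _ => ?_
  rw [Fintype.prod_sum_type]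
  rfl

/-- A form not divisible by `formY i` has a monomial free of `uᵢ` and `yᵢ`, which bounds its
multiplicities at the other points. -/
lemma sum_ord_le_of_not_dvd_formY {d : ℕ × ℕ} {F : CoordRing k n (n + 1)}
    (hF : F ∈ biForms k n (n + 1) d) {i : Fin (n + 2)} (hi : ¬ fr.formY i ∣ F) :
    ∑ l ∈ Finset.univ.erase i, (fr.pointVal l).ord F ≤ n * (d.1 + d.2) := by
  have hex : ∃ s ∈ (fr.psi F).support, s (Sum.inl i) = 0 ∧ s (Sum.inr i) = 0 := by
    by_contra! hno
    refine hi ?_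
    rw [fr.eq_sum_sec i F]
    refine Finset.dvd_sum fun s hs => ?_
    by_cases h0 : s (Sum.inl i) = 0
    · refine dvd_mul_of_dvd_right (dvd_mul_of_dvd_right
        ((dvd_pow_self _ (hno s hs h0)).trans
          (Finset.dvd_prod_of_mem (fun l => fr.formY l ^ s (Sum.inr l)) (Finset.mem_univ i))) _) _
    · rw [Finset.prod_eq_zero (Finset.mem_univ i) (by rw [fr.formX_self, zero_pow h0])]
      simp
  obtain ⟨s, hs, h0, h0'⟩ := hex
  obtain ⟨h1, h2⟩ := fr.sum_exponents hF hs
  rw [← Finset.add_sum_erase _ _ (Finset.mem_univ i), h0, zero_add] at h1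
  rw [← Finset.add_sum_erase _ _ (Finset.mem_univ i), h0', zero_add] at h2
  have h3 := Finset.sum_le_sum fun l (_ : l ∈ Finset.univ.erase i) =>
    fr.exponents_add_ord_le hF hs l
  rw [Finset.sum_add_distrib, Finset.sum_add_distrib, h1, h2, Finset.sum_const,
    Finset.card_erase_of_mem (Finset.mem_univ i), Finset.card_univ, Fintype.card_fin,
    smul_eq_mul, show n + 2 - 1 = n + 1 from rfl, add_mul, one_mul] at h3
  omega

/-- A form not divisible by `formX j i` has a monomial free of `uᵢ` and `uⱼ`. -/
lemma sum_ord_le_of_not_dvd_formX {d : ℕ × ℕ} {F : CoordRing k n (n + 1)}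
    (hF : F ∈ biForms k n (n + 1) d) {i j : Fin (n + 2)} (hij : i ≠ j)
    (hi : ¬ fr.formX j i ∣ F) :
    ∑ l ∈ (Finset.univ.erase j).erase i, (fr.pointVal l).ord F + d.1 ≤ n * (d.1 + d.2) := by
  have hex : ∃ s ∈ (fr.psi F).support, s (Sum.inl j) = 0 ∧ s (Sum.inl i) = 0 := by
    by_contra! hno
    refine hi ?_
    rw [fr.eq_sum_sec j F]
    refine Finset.dvd_sum fun s hs => ?_
    by_cases h0 : s (Sum.inl j) = 0
    · refine dvd_mul_of_dvd_right (dvd_mul_of_dvd_left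
        ((dvd_pow_self _ (hno s hs h0)).trans
          (Finset.dvd_prod_of_mem (fun l => fr.formX j l ^ s (Sum.inl l)) (Finset.mem_univ i))) _) _
    · rw [Finset.prod_eq_zero (Finset.mem_univ j) (by rw [fr.formX_self, zero_pow h0])]
      simp
  have hmem : i ∈ Finset.univ.erase j := Finset.mem_erase.2 ⟨hij, Finset.mem_univ i⟩
  obtain ⟨s, hs, h0, h0'⟩ := hex
  obtain ⟨h1, -⟩ := fr.sum_exponents hF hs
  rw [← Finset.add_sum_erase _ _ (Finset.mem_univ j), h0, zero_add,
    ← Finset.add_sum_erase _ _ hmem, h0', zero_add] at h1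
  have h3 := Finset.sum_le_sum fun l (_ : l ∈ (Finset.univ.erase j).erase i) =>
    fr.exponents_add_ord_le hF hs l
  rw [Finset.sum_add_distrib, Finset.sum_add_distrib, h1, Finset.sum_const,
    Finset.card_erase_of_mem hmem, Finset.card_erase_of_mem (Finset.mem_univ j),
    Finset.card_univ, Fintype.card_fin, smul_eq_mul, show n + 2 - 1 - 1 = n from rfl] at h3
  omega

/-- The coordinates `u` matter only up to multiples of `c`, as `∑ cᵢ aᵢ = 0`. -/
lemma eval_psi_add_c (F : CoordRing k n (n + 1)) (u y : Fin (n + 2) → k) (τ : k) :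
    eval (Sum.elim (fun i => u i + τ * fr.c i) y) (fr.psi F) =
      eval (Sum.elim u y) (fr.psi F) := by
  rw [eval_psi, eval_psi]
  congr 2
  ext r
  rcases r with r | r
  · simp only [Sum.elim_inl, mul_add, Finset.sum_add_distrib]
    have := fr.sum_c_mul_a r
    rw [show ∑ j, fr.a j r * (τ * fr.c j) = τ * ∑ j, fr.c j * fr.a j r by
      rw [Finset.mul_sum]; exact Finset.sum_congr rfl fun j _ => by ring, this]
    simp
  · rfl

/-- The polynomial `F(x(T), y(T))` for a curve of bidegree `(n, n + 1)` through all the points has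
zeros at the points of order at least the multiplicities of `F`. In the coordinates `u`, `y` the
curve is `uᵢ = cᵢ wᵢ / (1 - wᵢ T)`, `yᵢ = zᵢ / (1 - wᵢ T)`. -/
lemma sum_ord_le [Infinite k] {d : ℕ × ℕ} {F : CoordRing k n (n + 1)} (hF0 : F ≠ 0)
    (hF : F ∈ biForms k n (n + 1) d) :
    ∑ i, (fr.pointVal i).ord F ≤ n * d.1 + (n + 1) * d.2 := by
  set Φ := fr.psi F with hΦ
  have hΦ0 : Φ ≠ 0 := (map_ne_zero_iff _ fr.psi_injective).2 hF0
  obtain ⟨x, hx⟩ : ∃ x, eval x Φ ≠ 0 := by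
    by_contra! hno
    exact hΦ0 (MvPolynomial.funext fun x => by rw [hno, map_zero])
  set w : Fin (n + 2) → k := fun i => x (Sum.inl i) / fr.c i with hw
  have hwx : ∀ i, fr.c i * w i = x (Sum.inl i) := fun i => mul_div_cancel₀ _ (fr.c_ne_zero i)
  set z : Fin (n + 2) → k := fun i => x (Sum.inr i) with hz
  obtain ⟨b, hb⟩ : ∃ b : Fin (n + 2) → ℕ, ∀ i, (fr.pointVal i).ord F + b i = d.1 + d.2 :=
    ⟨fun i => d.1 + d.2 - (fr.pointVal i).ord F, fun i =>
      Nat.add_sub_of_le (fr.ord_pointVal_le hF0 hF i)⟩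
  have hsb : ∀ s ∈ Φ.support, ∀ i, s (Sum.inl i) + s (Sum.inr i) ≤ b i := fun s hs i => by
    have := fr.exponents_add_ord_le hF hs i
    have := hb i
    omega
  -- `expand v` is `Φ(v / (1 - w T), z / (1 - w T))` with denominators cleared
  let expand : (Fin (n + 2) → k) → Polynomial k := fun v => ∑ s ∈ Φ.support,
    Polynomial.C (coeff s Φ) * ∏ i, (Polynomial.C (v i ^ s (Sum.inl i) * z i ^ s (Sum.inr i)) *
      (1 - Polynomial.C (w i) * Polynomial.X) ^ (b i - (s (Sum.inl i) + s (Sum.inr i))))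
  have heval : ∀ (v : Fin (n + 2) → k) (t : k), (∀ i, 1 - w i * t ≠ 0) →
      (expand v).eval t = (∏ i, (1 - w i * t) ^ b i) *
        eval (Sum.elim (fun i => v i / (1 - w i * t)) (fun i => z i / (1 - w i * t))) Φ := by
    intro v t ht
    simp only [expand, Polynomial.eval_finsetSum, Polynomial.eval_mul, Polynomial.eval_C,
      Polynomial.eval_prod, Polynomial.eval_pow, Polynomial.eval_sub, Polynomial.eval_one,
      Polynomial.eval_X]
    rw [eval_eq', Finset.mul_sum]
    refine Finset.sum_congr rfl fun s hs => ?_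
    rw [Fintype.prod_sum_type, mul_left_comm, ← Finset.prod_mul_distrib,
      ← Finset.prod_mul_distrib]
    congr 1
    refine Finset.prod_congr rfl fun i _ => ?_
    rw [pow_sub₀ _ (ht i) (hsb s hs i), pow_add]
    simp only [Sum.elim_inl, Sum.elim_inr, div_pow]
    have := pow_ne_zero (s (Sum.inl i)) (ht i)
    have := pow_ne_zero (s (Sum.inr i)) (ht i)
    field_simp
  have hhom : ∀ (u y : Fin (n + 2) → k) (τ : k), eval (Sum.elim (fun i => τ * u i) y) Φ =
      τ ^ d.1 * eval (Sum.elim u y) Φ := by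
    intro u y τ
    rw [eval_eq', eval_eq', Finset.mul_sum]
    refine Finset.sum_congr rfl fun s hs => ?_
    rw [Fintype.prod_sum_type, Fintype.prod_sum_type]
    simp only [Sum.elim_inl, Sum.elim_inr, mul_pow, Finset.prod_mul_distrib,
      Finset.prod_pow_eq_pow_sum]
    rw [(fr.sum_exponents hF hs).1]
    ring
  -- `cᵢ wᵢ / (1 - wᵢ T) + cᵢ / T = cᵢ / (T (1 - wᵢ T))`, so adding a multiple of `c` turns one
  -- expansion into the other
  have hkey : Polynomial.X ^ d.1 * expand (fun i => fr.c i * w i) = expand fr.c := by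
    refine Polynomial.eq_of_infinite_eval_eq _ _ ?_
    have hfin : (insert 0 (Set.range fun i => (w i)⁻¹)).Finite :=
      (Set.finite_range _).insert _
    refine hfin.infinite_compl.mono fun t ht => ?_
    simp only [Set.mem_compl_iff, Set.mem_insert_iff, Set.mem_range, not_or, not_exists] at ht
    obtain ⟨ht0, ht1⟩ := ht
    have ht2 : ∀ i, 1 - w i * t ≠ 0 := fun i h0 =>
      ht1 i (inv_eq_of_mul_eq_one_right (sub_eq_zero.1 h0).symm)
    rw [Set.mem_ofPred_eq, Polynomial.eval_mul, Polynomial.eval_pow, Polynomial.eval_X,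
      heval _ _ ht2,
      heval _ _ ht2]
    have h1 := fr.eval_psi_add_c F (fun i => fr.c i * w i / (1 - w i * t))
      (fun i => z i / (1 - w i * t)) t⁻¹
    have h2 : (fun i => fr.c i * w i / (1 - w i * t) + t⁻¹ * fr.c i) =
        fun i => t⁻¹ * (fr.c i / (1 - w i * t)) := by
      ext i
      have := ht2 i
      field_simp
      ring
    rw [h2, ← hΦ, hhom] at h1
    rw [← h1, inv_pow, mul_left_comm, mul_inv_cancel_left₀ (pow_ne_zero d.1 ht0)]
  have hne : expand (fun i => fr.c i * w i) ≠ 0 := by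
    intro h0
    have h1 := heval (fun i => fr.c i * w i) 0 (by simp)
    rw [h0] at h1
    simp only [Polynomial.eval_zero, mul_zero, sub_zero, one_pow, Finset.prod_const_one, one_mul,
      div_one, hwx] at h1
    refine hx ?_
    rw [h1]
    congr 2
    ext i
    rcases i with i | i <;> rfl
  have hdeg : (expand fr.c).natDegree ≤ ∑ i, b i - (d.1 + d.2) := by
    refine Polynomial.natDegree_sum_le_of_forall_le _ _ fun s hs => ?_
    refine (Polynomial.natDegree_C_mul_le _ _).trans ((Polynomial.natDegree_prod_le _ _).trans ?_)
    have h1 : ∑ i, (b i - (s (Sum.inl i) + s (Sum.inr i))) = ∑ i, b i - (d.1 + d.2) := by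
      rw [Finset.sum_tsub_distrib _ fun i _ => hsb s hs i, Finset.sum_add_distrib,
        (fr.sum_exponents hF hs).1, (fr.sum_exponents hF hs).2]
    rw [← h1]
    refine Finset.sum_le_sum fun i _ => (Polynomial.natDegree_C_mul_le _ _).trans ?_
    refine Polynomial.natDegree_pow_le.trans ?_
    have h2 : (1 - Polynomial.C (w i) * Polynomial.X).natDegree ≤ 1 := by compute_degree
    calc _ ≤ (b i - (s (Sum.inl i) + s (Sum.inr i))) * 1 := Nat.mul_le_mul_left _ h2
      _ = _ := mul_one _
  have hdeg' : d.1 ≤ ∑ i, b i - (d.1 + d.2) := by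
    refine le_trans ?_ hdeg
    rw [← hkey, Polynomial.natDegree_mul (pow_ne_zero _ Polynomial.X_ne_zero) hne,
      Polynomial.natDegree_X_pow]
    exact Nat.le_add_right _ _
  have hbge : d.1 + d.2 ≤ ∑ i, b i := by
    obtain ⟨s, hs⟩ := fr.psi_support_nonempty hF0
    rw [← (fr.sum_exponents hF hs).1, ← (fr.sum_exponents hF hs).2, ← Finset.sum_add_distrib]
    exact Finset.sum_le_sum fun i _ => hsb s hs i
  have hsum : ∑ i, (fr.pointVal i).ord F + ∑ i, b i = (n + 2) * (d.1 + d.2) := by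
    rw [← Finset.sum_add_distrib, Finset.sum_congr rfl fun i _ => hb i]
    simp
  have h3 : d.1 + (d.1 + d.2) ≤ ∑ i, b i := by omega
  nlinarith

end Frame

end Multiplicities

/-! ### Degree sequences of loopless multigraphs -/

section Multigraph

variable {V : Type*} [Fintype V] [DecidableEq V]

lemma sum_pi_single_one (v : V) (f : V → Prop) [DecidablePred f] :
    ∑ u, (if f u then (Pi.single v 1 : V → ℕ) u else 0) = if f v then 1 else 0 := by
  rw [Finset.sum_eq_single v]
  · simp
  · intro u _ hu
    simp [Pi.single_eq_of_ne hu]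
  · simp

/-- A function whose sum is `2 D` and whose sum over each colour class is at most `D` is the degree
function of a multigraph in which adjacent vertices have different colours. -/
lemma mem_closure_of_colour_sum_le {C : Type*} [DecidableEq C] (col : V → C) (D : ℕ) :
    ∀ a : V → ℕ, ∑ v, a v = 2 * D → (∀ c, ∑ v, (if col v = c then a v else 0) ≤ D) →
      a ∈ AddSubmonoid.closure
        {f : V → ℕ | ∃ v w, col v ≠ col w ∧ f = Pi.single v 1 + Pi.single w 1} := by
  induction D with
  | zero =>
    intro a ha _
    have : a = 0 := by
      ext v
      exact (Finset.sum_eq_zero_iff.1 ha) v (Finset.mem_univ v)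
    rw [this]
    exact zero_mem _
  | succ D ih =>
    intro a ha hcol
    -- a vertex of a tight colour class, if there is one
    obtain ⟨v, hv, hvmax⟩ : ∃ v, a v ≠ 0 ∧ ((∃ c, ∑ v, (if col v = c then a v else 0) = D + 1) →
        ∑ u, (if col u = col v then a u else 0) = D + 1) := by
      by_cases hex : ∃ c, ∑ v, (if col v = c then a v else 0) = D + 1
      · obtain ⟨c, hc⟩ := hex
        obtain ⟨v, -, hv⟩ := Finset.exists_ne_zero_of_sum_ne_zero
          (s := Finset.univ) (f := fun v => if col v = c then a v else 0) (by rw [hc]; omega)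
        rw [ite_ne_right_iff] at hv
        exact ⟨v, hv.2, fun _ => by rw [hv.1, hc]⟩
      · obtain ⟨v, -, hv⟩ := Finset.exists_ne_zero_of_sum_ne_zero
          (s := Finset.univ) (f := a) (by rw [ha]; omega)
        exact ⟨v, hv, fun h => absurd h hex⟩
    obtain ⟨w, hwv, hw⟩ : ∃ w, col v ≠ col w ∧ a w ≠ 0 := by
      by_contra! hno
      have h1 : ∑ u, (if col u = col v then a u else 0) = ∑ u, a u := by
        refine Finset.sum_congr rfl fun u _ => ?_
        split_ifs with hu
        · rfl
        · exact (hno u fun h => hu h.symm).symm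
      have := hcol (col v)
      omega
    have hne : v ≠ w := fun h => hwv (by rw [h])
    obtain ⟨b, rfl⟩ : ∃ b, a = b + (Pi.single v 1 + Pi.single w 1) := by
      refine ⟨a - (Pi.single v 1 + Pi.single w 1), (tsub_add_cancel_of_le fun u => ?_).symm⟩
      by_cases huv : u = v
      · subst huv
        simp [Pi.single_eq_of_ne hne]
        omega
      · by_cases huw : u = w
        · subst huw
          simp [Pi.single_eq_of_ne huv]
          omega
        · simp [Pi.single_eq_of_ne huv, Pi.single_eq_of_ne huw]
    have hclass : ∀ c, ∑ u, (if col u = c then (b + (Pi.single v 1 + Pi.single w 1) : V → ℕ) u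
        else 0) = ∑ u, (if col u = c then b u else 0) +
          ((if col v = c then 1 else 0) + if col w = c then 1 else 0) := by
      intro c
      rw [← sum_pi_single_one v (fun u => col u = c), ← sum_pi_single_one w (fun u => col u = c),
        ← Finset.sum_add_distrib, ← Finset.sum_add_distrib]
      refine Finset.sum_congr rfl fun u _ => ?_
      split_ifs <;> simp
    refine add_mem (ih b ?_ fun c => ?_) (AddSubmonoid.subset_closure ⟨v, w, hwv, rfl⟩)
    · simp only [Pi.add_apply, Finset.sum_add_distrib, Finset.sum_pi_single',
        Finset.mem_univ, if_true] at ha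
      omega
    · have h1 := hcol c
      have h2 := hclass c
      by_cases hvc : col v = c
      · simp only [hvc, if_true] at h2
        omega
      by_cases hwc : col w = c
      · simp only [hwc, if_true] at h2
        omega
      simp only [hvc, hwc, if_false, add_zero] at h2
      by_contra hlt
      have h3 := hvmax ⟨c, by omega⟩
      -- two tight classes leave no room for `w`
      have h4 : ∑ u, (if col u = c then (b + (Pi.single v 1 + Pi.single w 1) : V → ℕ) u else 0) +
          ∑ u, (if col u = col v then (b + (Pi.single v 1 + Pi.single w 1) : V → ℕ) u else 0) + 1 ≤
            ∑ u, (b + (Pi.single v 1 + Pi.single w 1) : V → ℕ) u := by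
        have h5 : (∑ u, if u = w then 1 else 0) = 1 := by simp
        refine le_trans (le_of_eq (congrArg _ h5.symm)) ?_
        rw [← Finset.sum_add_distrib, ← Finset.sum_add_distrib]
        refine Finset.sum_le_sum fun u _ => ?_
        by_cases huw : u = w
        · subst huw
          rw [if_neg hwc, if_neg (Ne.symm hwv), if_pos rfl]
          exact Nat.one_le_iff_ne_zero.2 hw
        · rw [if_neg huw]
          by_cases huc : col u = c
          · rw [if_pos huc, if_neg (fun h => hvc (h.symm.trans huc))]
            simp
          · rw [if_neg huc]
            split_ifs <;> simp
      omega

/-- The case of a single forbidden edge `{x, y}`; no edge is forbidden if `x = y`. -/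
lemma mem_closure_edges (x y : V) {D : ℕ} {a : V → ℕ} (ha : ∑ v, a v = 2 * D)
    (hle : ∀ v, a v ≤ D) (hxy : x ≠ y → a x + a y ≤ D) :
    a ∈ AddSubmonoid.closure {f : V → ℕ | ∃ v w, v ≠ w ∧ s(v, w) ≠ s(x, y) ∧
      f = Pi.single v 1 + Pi.single w 1} := by
  have h := mem_closure_of_colour_sum_le (fun v => if v = x then y else v) D a ha fun c => ?_
  · refine AddSubmonoid.closure_mono ?_ h
    rintro _ ⟨v, w, hvw, rfl⟩
    refine ⟨v, w, fun h => hvw (by rw [h]), fun h => hvw ?_, rfl⟩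
    rcases Sym2.eq_iff.1 h with ⟨rfl, rfl⟩ | ⟨rfl, rfl⟩ <;> simp
  · by_cases hc : x ≠ y ∧ c = y
    · obtain ⟨hne, rfl⟩ := hc
      refine le_trans (le_of_eq ?_) (hxy hne)
      rw [← Finset.sum_pair hne, ← Finset.sum_filter]
      refine Finset.sum_congr ?_ fun _ _ => rfl
      ext v
      simp only [Finset.mem_filter, Finset.mem_univ, true_and, Finset.mem_insert,
        Finset.mem_singleton]
      split_ifs with hv <;> simp [hv]
    · refine le_trans ?_ (hle c)
      rw [← Finset.sum_filter, ← Finset.sum_singleton a c]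
      refine Finset.sum_le_sum_of_subset fun v hv => ?_
      simp only [Finset.mem_filter, Finset.mem_univ, true_and] at hv
      rw [Finset.mem_singleton]
      split_ifs at hv with hvx
      · by_contra hne
        exact hc ⟨fun h => hne (by rw [hvx, h, hv]), hv.symm⟩
      · exact hv

lemma exists_between_sum_eq {lo hi : V → ℕ} (hle : lo ≤ hi) {T : ℕ} (hlo : ∑ v, lo v ≤ T)
    (hhi : T ≤ ∑ v, hi v) : ∃ a, lo ≤ a ∧ a ≤ hi ∧ ∑ v, a v = T := by
  induction T, hlo using Nat.le_induction with
  | base => exact ⟨lo, le_rfl, hle, rfl⟩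
  | succ T hT ih =>
    obtain ⟨a, h1, h2, h3⟩ := ih (by omega)
    obtain ⟨v, -, hv⟩ := Finset.exists_lt_of_sum_lt
      (show ∑ v, a v < ∑ v, hi v by omega)
    refine ⟨a + Pi.single v 1, h1.trans (le_add_of_nonneg_right bot_le), fun u => ?_, ?_⟩
    · by_cases hu : u = v
      · subst hu
        simpa using hv
      · simpa [Pi.single_eq_of_ne hu] using h2 u
    · simp [Finset.sum_add_distrib, h3]

end Multigraph

/-! ### Movable classes from multigraphs -/

section Movable

open MvPolynomial

variable {k : Type*} [Field k] {n : ℕ}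

namespace Frame

variable {fr : Frame k n} {p : Fin (n + 2) → ProdPoint k n (n + 1)}

lemma ord_pointVal_formX {i j : Fin (n + 2)} (hij : i ≠ j) (l : Fin (n + 2)) :
    (fr.pointVal l).ord (fr.formX j i) = if l = i ∨ l = j then 0 else 1 := by
  split_ifs with hl
  · refine ord_eq_zero_of_eval_ne_zero ?_
    rcases hl with rfl | rfl
    · rw [fr.eval_formX hij hij, if_pos rfl]
      exact one_ne_zero
    · rw [fr.eval_formX_self hij]
      exact neg_ne_zero.2 (div_ne_zero (fr.c_ne_zero _) (fr.c_ne_zero _))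
  · rw [not_or] at hl
    refine le_antisymm ?_ (fr.ord_pos_of_eval_point_eq_zero (fr.formX_ne_zero hij)
      (fr.formX_mem j i) ?_)
    · exact fr.ord_pointVal_le (fr.formX_ne_zero hij) (fr.formX_mem j i) l
    · rw [fr.eval_formX hij hl.2, if_neg (Ne.symm hl.1)]

/-- The degree of the divisor attached to a multigraph on `{1, …, n + 2} ∪ {*}` with vertex
degrees `a`: an edge `{i, j}` stands for the hyperplane of `ℙⁿ` through all points but `pᵢ, pⱼ`,
an edge `{i, *}` for the hyperplane of `ℙⁿ⁺¹` through all points but `pᵢ`. The index `none`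
is `*`. -/
noncomputable def multigraphDegree (a : Option (Fin (n + 2)) → ℕ) : Coords n :=
  ((∑ v, (a v : ℝ)) / 2 - a none, a none, fun i => (∑ v, (a v : ℝ)) / 2 - a (some i))

lemma multigraphDegree_add (a b : Option (Fin (n + 2)) → ℕ) :
    multigraphDegree (a + b) = multigraphDegree a + multigraphDegree b := by
  ext i <;> simp [multigraphDegree, Finset.sum_add_distrib] <;> ring

lemma multigraphDegree_zero : multigraphDegree (0 : Option (Fin (n + 2)) → ℕ) = 0 := by
  ext i <;> simp [multigraphDegree]

lemma multigraphDegree_of_sum {a : Option (Fin (n + 2)) → ℕ} {D : ℕ} (ha : ∑ v, a v = 2 * D) :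
    multigraphDegree a = ((D : ℝ) - a none, (a none : ℝ), fun i => (D : ℝ) - a (some i)) := by
  have : (∑ v, (a v : ℝ)) / 2 = D := by
    rw [← Nat.cast_sum, ha]
    push_cast
    ring
  rw [multigraphDegree, this]

lemma sum_edge {V : Type*} [Fintype V] [DecidableEq V] (v w : V) :
    ∑ u, (Pi.single v 1 + Pi.single w 1 : V → ℕ) u = 2 * 1 := by
  simp [Finset.sum_add_distrib]

/-- An edge is determined by the degree of its divisor. -/
lemma multigraphDegree_edge_injective {v w v' w' : Option (Fin (n + 2))}
    (h : multigraphDegree (Pi.single v 1 + Pi.single w 1) =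
      multigraphDegree (Pi.single v' 1 + Pi.single w' 1)) (hvw : v ≠ w) (hvw' : v' ≠ w') :
    s(v, w) = s(v', w') := by
  rw [multigraphDegree_of_sum (sum_edge v w), multigraphDegree_of_sum (sum_edge v' w')] at h
  have h' : (Pi.single v 1 + Pi.single w 1 : Option (Fin (n + 2)) → ℕ) =
      Pi.single v' 1 + Pi.single w' 1 := by
    ext u
    rcases u with _ | u
    · exact Nat.cast_injective (R := ℝ) (congrArg (fun x : Coords n => x.2.1) h)
    · exact Nat.cast_injective (R := ℝ)
        (sub_right_injective (congrFun (congrArg (fun x : Coords n => x.2.2) h) u))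
  have hv := congrFun h' v
  have hw := congrFun h' w
  simp only [Pi.add_apply, Pi.single_apply, hvw, hvw.symm, if_true, if_false] at hv hw
  rw [Sym2.eq_iff]
  by_cases h1 : v = v' <;> by_cases h2 : v = w' <;> by_cases h3 : w = v' <;>
    by_cases h4 : w = w' <;> simp_all

/-- The prime divisor of an edge, which is the strict transform of a hyperplane. -/
lemma Represents.exists_edge_of_some (h : fr.Represents p) (hn : 1 ≤ n) (i : Fin (n + 2))
    {w : Option (Fin (n + 2))} (hw : some i ≠ w) : ∃ Q : PrimeDivisor p,
      h.degP hn Q = multigraphDegree (Pi.single (some i) 1 + Pi.single w 1) := by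
  rcases w with _ | j
  · refine ⟨h.primeDivisor hn (irreducible_of_mem_biForms (fr.formY_ne_zero i) rfl
      (fr.formY_mem i)) (fr.formY_mem i), ?_⟩
    rw [h.degP_primeDivisor, multigraphDegree_of_sum (sum_edge _ _)]
    ext l
    · simp [formDegree]
    · simp [formDegree]
    · by_cases hl : i = l <;> simp [formDegree, ord_pointVal_formY, hl, eq_comm]
  · have hij : i ≠ j := fun hij => hw (by rw [hij])
    refine ⟨h.primeDivisor hn (irreducible_of_mem_biForms (fr.formX_ne_zero hij) rfl
      (fr.formX_mem j i)) (fr.formX_mem j i), ?_⟩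
    rw [h.degP_primeDivisor, multigraphDegree_of_sum (sum_edge _ _)]
    ext l
    · simp [formDegree]
    · simp [formDegree]
    · simp only [formDegree, ord_pointVal_formX hij]
      by_cases hi : l = i
      · subst hi
        simp [hij]
      · by_cases hj : l = j <;> simp_all

lemma Represents.exists_edge (h : fr.Represents p) (hn : 1 ≤ n) {v w : Option (Fin (n + 2))}
    (hw : v ≠ w) : ∃ Q : PrimeDivisor p,
      h.degP hn Q = multigraphDegree (Pi.single v 1 + Pi.single w 1) := by
  rcases v with _ | i
  · rcases w with _ | j
    · exact absurd rfl hw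
    · obtain ⟨Q, hQ⟩ := h.exists_edge_of_some hn j hw.symm
      exact ⟨Q, hQ.trans (congrArg _ (add_comm _ _))⟩
  · exact h.exists_edge_of_some hn i hw

/-- The sum of the divisors attached to the edges of a multigraph none of whose edges is `P`. -/
lemma Represents.exists_effective_of_mem_closure (h : fr.Represents p) (hn : 1 ≤ n)
    {P : PrimeDivisor p} {x y : Option (Fin (n + 2))}
    (hP : ∀ v w, v ≠ w → s(v, w) ≠ s(x, y) →
      h.degP hn P ≠ multigraphDegree (Pi.single v 1 + Pi.single w 1))
    {a : Option (Fin (n + 2)) → ℕ}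
    (ha : a ∈ AddSubmonoid.closure {f : Option (Fin (n + 2)) → ℕ | ∃ v w, v ≠ w ∧
      s(v, w) ≠ s(x, y) ∧ f = Pi.single v 1 + Pi.single w 1}) :
    ∃ D : WeilDivisor p, 0 ≤ D ∧ D P = 0 ∧ h.deg hn (toReal D) = multigraphDegree a := by
  induction ha using AddSubmonoid.closure_induction with
  | mem f hf =>
    obtain ⟨v, w, hvw, hne, rfl⟩ := hf
    obtain ⟨Q, hQ⟩ := h.exists_edge hn hvw
    refine ⟨Finsupp.single Q 1, Finsupp.single_nonneg.2 zero_le_one, ?_, ?_⟩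
    · refine Finsupp.single_eq_of_ne ?_
      rintro rfl
      exact hP v w hvw hne hQ
    · rw [toReal_single, h.deg_single, hQ]
      simp
  | zero => exact ⟨0, le_rfl, rfl, by rw [toReal_zero, map_zero, multigraphDegree_zero]⟩
  | add f g _ _ hf hg =>
    obtain ⟨D, hD, hDP, hDd⟩ := hf
    obtain ⟨D', hD', hDP', hDd'⟩ := hg
    refine ⟨D + D', add_nonneg hD hD', by rw [Finsupp.add_apply, hDP, hDP', add_zero], ?_⟩
    rw [toReal_add, map_add, hDd, hDd', multigraphDegree_add]

/-- Adding exceptional divisors to the divisor of a multigraph with vertex degrees `a i ≤ b i` at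
the points and `d₂` at `*`. -/
lemma Represents.exists_effective (h : fr.Represents p) (hn : 1 ≤ n)
    {P : PrimeDivisor p} {x y : Option (Fin (n + 2))}
    (hP : ∀ v w, v ≠ w → s(v, w) ≠ s(x, y) →
      h.degP hn P ≠ multigraphDegree (Pi.single v 1 + Pi.single w 1))
    {d₁ d₂ : ℕ} {a b : Fin (n + 2) → ℕ} (hab : a ≤ b) (hsum : ∑ i, a i = 2 * d₁ + d₂)
    (ha : ∀ i, a i ≤ d₁ + d₂) (hE : ∀ i, P = h.excDivisor i → a i = b i)
    (hxy : x ≠ y → (x.elim d₂ a : ℕ) + y.elim d₂ a ≤ d₁ + d₂) :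
    ∃ D : WeilDivisor p, 0 ≤ D ∧ D P = 0 ∧
      h.deg hn (toReal D) = ((d₁ : ℝ), (d₂ : ℝ), fun i => (d₁ : ℝ) + d₂ - b i) := by
  have hsum' : ∑ v : Option (Fin (n + 2)), (v.elim d₂ a : ℕ) = 2 * (d₁ + d₂) := by
    rw [Fintype.sum_option]
    simp only [Option.elim_none, Option.elim_some, hsum]
    ring
  have hmem := mem_closure_edges x y (a := fun v : Option (Fin (n + 2)) => (v.elim d₂ a : ℕ))
    hsum' (fun v => by
      rcases v with _ | v
      · exact Nat.le_add_left _ _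
      · exact ha v) hxy
  obtain ⟨D, hD, hDP, hDd⟩ := h.exists_effective_of_mem_closure hn hP hmem
  refine ⟨D + ∑ i, Finsupp.single (h.excDivisor i) ((b i : ℤ) - a i), add_nonneg hD
    (Finset.sum_nonneg fun i _ => Finsupp.single_nonneg.2 ?_), ?_, ?_⟩
  · exact sub_nonneg.2 (Int.ofNat_le.2 (hab i))
  · rw [Finsupp.add_apply, hDP, zero_add, Finsupp.finsetSum_apply]
    refine Finset.sum_eq_zero fun i _ => ?_
    by_cases hi : P = h.excDivisor i
    · rw [hE i hi, sub_self, Finsupp.single_zero, Finsupp.zero_apply]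
    · exact Finsupp.single_eq_of_ne hi
  · rw [toReal_add, map_add, hDd, multigraphDegree_of_sum hsum', toReal_sum, map_sum]
    simp only [toReal_single, h.deg_single, h.degP_excDivisor]
    ext l
    · simp [Prod.fst_sum]
    · simp [Prod.fst_sum, Prod.snd_sum]
    · simp [Prod.snd_sum, Finset.sum_apply, Pi.single_apply]

end Frame

end Movable

/-! ### The inequalities -/

section Inequalities

variable {k : Type*} [Field k] {n : ℕ}

/-- The cone cut out by the inequalities for movable classes, without the redundant ones. -/
def movableCoords (n : ℕ) : Set (Coords n) :=
  {v | 0 ≤ v.1 ∧ 0 ≤ v.2.1 ∧ (∀ i, v.2.2 i ≤ v.1 + v.2.1) ∧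
    ∑ i, v.2.2 i ≤ n * v.1 + (n + 1) * v.2.1 ∧ (∀ i, 0 ≤ v.2.2 i) ∧
    (∀ i j, i ≠ j →
      ∑ l ∈ (Finset.univ.erase j).erase i, v.2.2 l ≤ (n - 1) * v.1 + n * v.2.1) ∧
    ∀ i, ∑ l ∈ Finset.univ.erase i, v.2.2 l ≤ n * (v.1 + v.2.1)}

namespace Frame

variable {fr : Frame k n} {p : Fin (n + 2) → ProdPoint k n (n + 1)}

/-- For every prime divisor `P`, an integral class satisfying the inequalities contains an
effective divisor that does not contain `P`. -/
lemma Represents.exists_avoiding (h : fr.Represents p) (hn : 1 ≤ n) {d₁ d₂ : ℕ}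
    {b : Fin (n + 2) → ℕ} (hb : ∀ i, b i ≤ d₁ + d₂) (hsum : 2 * d₁ + d₂ ≤ ∑ i, b i)
    (hpair : ∀ i j, i ≠ j → d₁ ≤ ∑ l ∈ (Finset.univ.erase j).erase i, b l)
    (hone : ∀ i, d₁ + d₂ ≤ ∑ l ∈ Finset.univ.erase i, b l) (P : PrimeDivisor p) :
    ∃ D : WeilDivisor p, 0 ≤ D ∧ D P = 0 ∧
      h.deg hn (toReal D) = ((d₁ : ℝ), (d₂ : ℝ), fun i => (d₁ : ℝ) + d₂ - b i) := by
  by_cases hP : ∃ x y, x ≠ y ∧ h.degP hn P = multigraphDegree (Pi.single x 1 + Pi.single y 1)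
  · have hPE : ∀ i, P ≠ h.excDivisor i := by
      rintro i rfl
      obtain ⟨x, y, -, hP⟩ := hP
      rw [h.degP_excDivisor, multigraphDegree_of_sum (sum_edge x y)] at hP
      have h1 := congrArg (fun v : Coords n => v.1 + v.2.1) hP
      simp at h1
    -- the divisor `P` belongs to a single edge `{x, y}`, which has to be avoided
    have hgen : ∀ x y : Option (Fin (n + 2)), x ≠ y →
        h.degP hn P = multigraphDegree (Pi.single x 1 + Pi.single y 1) →
        ∀ a : Fin (n + 2) → ℕ, a ≤ b → ∑ i, a i = 2 * d₁ + d₂ →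
          (x.elim d₂ a : ℕ) + y.elim d₂ a ≤ d₁ + d₂ →
        ∃ D : WeilDivisor p, 0 ≤ D ∧ D P = 0 ∧
          h.deg hn (toReal D) = ((d₁ : ℝ), (d₂ : ℝ), fun i => (d₁ : ℝ) + d₂ - b i) :=
      fun x y hxy hd a hab ha hle => h.exists_effective hn
        (fun v w hvw hne he => hne
          (multigraphDegree_edge_injective (he.symm.trans hd) hvw hxy))
        hab ha (fun i => (hab i).trans (hb i)) (fun i hi => absurd hi (hPE i)) fun _ => hle
    have hstar : ∀ i, h.degP hn P = multigraphDegree (Pi.single (some i) 1 + Pi.single none 1) →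
        ∃ D : WeilDivisor p, 0 ≤ D ∧ D P = 0 ∧
          h.deg hn (toReal D) = ((d₁ : ℝ), (d₂ : ℝ), fun i => (d₁ : ℝ) + d₂ - b i) := by
      intro i hd
      -- the vertices `i` and `*` must not absorb more than half of the degrees
      obtain ⟨a, -, hab, ha⟩ := exists_between_sum_eq (lo := 0)
        (hi := Function.update b i (min (b i) d₁)) (fun _ => Nat.zero_le _)
        (T := 2 * d₁ + d₂) (by simp) (by
          rw [Finset.sum_update_of_mem (Finset.mem_univ i), ← Finset.erase_eq]
          rw [← Finset.add_sum_erase _ _ (Finset.mem_univ i)] at hsum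
          have := hone i
          omega)
      have hai : a i ≤ min (b i) d₁ := (hab i).trans_eq (Function.update_self _ _ _)
      refine hgen _ _ (Option.some_ne_none i) hd a (hab.trans ?_) ha ?_
      · exact update_le_self_iff.2 (min_le_left _ _)
      · simp only [Option.elim_some, Option.elim_none]
        omega
    obtain ⟨x, y, hxy, hd⟩ := hP
    rcases x with _ | i
    · rcases y with _ | i
      · exact absurd rfl hxy
      · exact hstar i (hd.trans (congrArg _ (add_comm _ _)))
    rcases y with _ | j
    · exact hstar i hd
    have hij : i ≠ j := fun hij => hxy (by rw [hij])
    have hmem : i ∈ Finset.univ.erase j := Finset.mem_erase.2 ⟨hij, Finset.mem_univ i⟩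
    -- the vertices `i` and `j` must not absorb more than half of the degrees
    obtain ⟨a, -, hab, ha⟩ := exists_between_sum_eq (lo := 0)
      (hi := Function.update b j (min (b j) (d₁ + d₂ - b i))) (fun _ => Nat.zero_le _)
      (T := 2 * d₁ + d₂)
      (by simp) (by
        rw [Finset.sum_update_of_mem (Finset.mem_univ j), ← Finset.erase_eq,
          ← Finset.add_sum_erase _ _ hmem]
        rw [← Finset.add_sum_erase _ _ (Finset.mem_univ j), ← Finset.add_sum_erase _ _ hmem]
          at hsum
        have := hpair i j hij
        have := hb i
        omega)
    have hai : a i ≤ b i := (hab i).trans_eq (Function.update_of_ne hij _ _)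
    have haj : a j ≤ min (b j) (d₁ + d₂ - b i) := (hab j).trans_eq (Function.update_self _ _ _)
    refine hgen _ _ hxy hd a (hab.trans ?_) ha ?_
    · exact update_le_self_iff.2 (min_le_left _ _)
    · simp only [Option.elim_some]
      have := hb i
      omega
  · push Not at hP
    -- no edge has to be avoided; to avoid `Eᵢ`, the vertex `i` gets its maximal degree `b i`
    obtain ⟨lo, hlo, hlosum, hE⟩ : ∃ lo : Fin (n + 2) → ℕ, lo ≤ b ∧ ∑ i, lo i ≤ 2 * d₁ + d₂ ∧
        ∀ i, P = h.excDivisor i → lo i = b i := by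
      by_cases hPE : ∃ i, P = h.excDivisor i
      · obtain ⟨i, rfl⟩ := hPE
        refine ⟨Pi.single i (b i), ?_, ?_, fun l hl => ?_⟩
        · intro l
          by_cases hl : l = i
          · subst hl
            simp
          · simp [Pi.single_eq_of_ne hl]
        · have := hb i
          simp only [Finset.sum_pi_single', Finset.mem_univ, if_true]
          omega
        · rw [h.excDivisor_injective hl, Pi.single_eq_same]
      · exact ⟨0, fun _ => Nat.zero_le _, by simp, fun i hi => absurd ⟨i, hi⟩ hPE⟩
    obtain ⟨a, hloa, hab, ha⟩ := exists_between_sum_eq hlo hlosum hsum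
    exact h.exists_effective hn (x := none) (y := none) (fun v w hvw _ => hP v w hvw) hab ha
      (fun i => (hab i).trans (hb i)) (fun i hi => le_antisymm (hab i) (hE i hi ▸ hloa i))
      fun hne => absurd rfl hne

/-- The class determines the complete linear system, so effective divisors of the same class that
avoid one prime divisor each make the class movable. -/
lemma Represents.isMovable_of_forall (h : fr.Represents p) (hn : 1 ≤ n) {v : Coords n}
    (hv : ∀ P : PrimeDivisor p, ∃ D : WeilDivisor p, 0 ≤ D ∧ D P = 0 ∧
      h.deg hn (toReal D) = v) :
    ∃ D : WeilDivisor p, IsMovable D ∧ divClass D = ofCoords p v := by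
  obtain ⟨D, hD, -, hDv⟩ := hv (h.excDivisor 0)
  have hlin : ∀ D' : WeilDivisor p, 0 ≤ D' → h.deg hn (toReal D') = v → D' ∈ linearSystem D := by
    intro D' hD' hdeg
    refine ⟨hD', (h.isPrincipal_iff_deg hn _).2 ?_⟩
    rw [toReal_sub, map_sub, hdeg, hDv, sub_self]
  refine ⟨D, ⟨⟨D, hlin D hD hDv⟩, fun P => ?_⟩, ?_⟩
  · obtain ⟨D', hD', hP, hdeg⟩ := hv P
    exact ⟨D', hlin D' hD' hdeg, hP⟩
  · rw [← hDv, ← h.coords_divClass, h.ofCoords_coords]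

/-- Integral classes satisfying the inequalities are movable. With `bᵢ = d₁ + d₂ - μᵢ` the
inequalities become those of `Represents.exists_avoiding`. -/
lemma Represents.exists_isMovable (h : fr.Represents p) (hn : 1 ≤ n) {d₁ d₂ : ℤ}
    {μ : Fin (n + 2) → ℤ}
    (hv : ((d₁ : ℝ), (d₂ : ℝ), fun i => (μ i : ℝ)) ∈ movableCoords n) :
    ∃ D : WeilDivisor p, IsMovable D ∧
      divClass D = ofCoords p ((d₁ : ℝ), (d₂ : ℝ), fun i => (μ i : ℝ)) := by
  obtain ⟨h1, h2, h3, h4, h5, h6, h7⟩ := hv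
  simp only at h1 h2 h3 h4 h5 h6 h7
  lift d₁ to ℕ using by exact_mod_cast h1
  lift d₂ to ℕ using by exact_mod_cast h2
  obtain ⟨b, hb⟩ : ∃ b : Fin (n + 2) → ℕ, ∀ i, (b i : ℤ) = d₁ + d₂ - μ i :=
    ⟨fun i => ((d₁ : ℤ) + d₂ - μ i).toNat, fun i =>
      Int.toNat_of_nonneg (sub_nonneg.2 (by exact_mod_cast h3 i))⟩
  have hbR : ∀ i, (b i : ℝ) = d₁ + d₂ - μ i := fun i => by exact_mod_cast hb i
  have hμ : (fun i => (μ i : ℝ)) = fun i => (d₁ : ℝ) + d₂ - b i := by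
    ext i
    rw [hbR]
    ring
  refine h.isMovable_of_forall hn fun P => ?_
  simp only [Int.cast_natCast, hμ] at *
  refine h.exists_avoiding hn (fun i => ?_) ?_ (fun i j hij => ?_) (fun i => ?_) P
  · have := h5 i
    have : (b i : ℝ) ≤ d₁ + d₂ := by linarith [hbR i]
    exact_mod_cast this
  · have : 2 * (d₁ : ℝ) + d₂ ≤ ∑ i, (b i : ℝ) := by
      simp only [Finset.sum_sub_distrib, Finset.sum_const, Finset.card_univ, Fintype.card_fin,
        nsmul_eq_mul] at h4
      push_cast at h4
      linarith
    exact_mod_cast this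
  · have h8 := h6 i j hij
    have : (d₁ : ℝ) ≤ ∑ l ∈ (Finset.univ.erase j).erase i, (b l : ℝ) := by
      rw [Finset.sum_sub_distrib, Finset.sum_const, Finset.card_erase_of_mem
        (Finset.mem_erase.2 ⟨hij, Finset.mem_univ i⟩), Finset.card_erase_of_mem
        (Finset.mem_univ j), Finset.card_univ, Fintype.card_fin, nsmul_eq_mul,
        show n + 2 - 1 - 1 = n from rfl] at h8
      linarith
    exact_mod_cast this
  · have h8 := h7 i
    have : (d₁ : ℝ) + d₂ ≤ ∑ l ∈ Finset.univ.erase i, (b l : ℝ) := by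
      rw [Finset.sum_sub_distrib, Finset.sum_const, Finset.card_erase_of_mem
        (Finset.mem_univ i), Finset.card_univ, Fintype.card_fin, nsmul_eq_mul,
        show n + 2 - 1 = n + 1 from rfl] at h8
      push_cast at h8
      linarith
    exact_mod_cast this

end Frame

end Inequalities

/-! ### The inequalities hold for movable divisors -/

section Necessity

variable {k : Type*} [Field k] {n : ℕ}

/-- The functional `α d₁ + β d₂ + γ ∑_{i ∈ I} μᵢ`. -/
noncomputable def facet (α β γ : ℤ) (I : Finset (Fin (n + 2))) : Coords n →ₗ[ℝ] ℝ :=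
  (α : ℝ) • LinearMap.fst ℝ ℝ _ + (β : ℝ) • (LinearMap.fst ℝ ℝ _).comp (LinearMap.snd ℝ ℝ _) +
    (γ : ℝ) • ∑ i ∈ I, ((LinearMap.proj i).comp (LinearMap.snd ℝ ℝ _)).comp (LinearMap.snd ℝ ℝ _)

lemma facet_apply (α β γ : ℤ) (I : Finset (Fin (n + 2))) (v : Coords n) :
    facet α β γ I v = α * v.1 + β * v.2.1 + γ * ∑ i ∈ I, v.2.2 i := by
  simp [facet, LinearMap.sum_apply]

lemma mem_movableCoords_iff {v : Coords n} : v ∈ movableCoords n ↔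
    0 ≤ facet 1 0 0 ∅ v ∧ 0 ≤ facet 0 1 0 ∅ v ∧ (∀ i, 0 ≤ facet 1 1 (-1) {i} v) ∧
    0 ≤ facet n (n + 1) (-1) Finset.univ v ∧ (∀ i, 0 ≤ facet 0 0 1 {i} v) ∧
    (∀ i j, i ≠ j → 0 ≤ facet (n - 1) n (-1) ((Finset.univ.erase j).erase i) v) ∧
    ∀ i, 0 ≤ facet n n (-1) (Finset.univ.erase i) v := by
  simp only [movableCoords, facet_apply, Set.mem_ofPred_eq]
  push_cast
  simp only [Finset.sum_empty, Finset.sum_singleton, one_mul, zero_mul, add_zero, zero_add,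
    neg_mul, ← sub_eq_add_neg, sub_nonneg, mul_add]

namespace Frame

variable {fr : Frame k n} {p : Fin (n + 2) → ProdPoint k n (n + 1)}

/-- A functional that is nonnegative on all prime divisors but `P` is nonnegative on movable
divisors. -/
lemma Represents.nonneg_of_isMovable (h : fr.Represents p) (hn : 1 ≤ n) {D : WeilDivisor p}
    (hD : IsMovable D) (P : PrimeDivisor p) {φ : Coords n →ₗ[ℝ] ℝ}
    (hφ : ∀ Q, Q ≠ P → 0 ≤ φ (h.degP hn Q)) : 0 ≤ φ (h.deg hn (toReal D)) := by
  obtain ⟨D', ⟨hD', hlin⟩, hP⟩ := hD.2 P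
  have h1 := (h.isPrincipal_iff_deg hn _).1 hlin
  rw [toReal_sub, map_sub, sub_eq_zero] at h1
  rw [← h1, deg, Finsupp.linearCombination_apply, Finsupp.sum, map_sum]
  refine Finset.sum_nonneg fun Q _ => ?_
  rw [map_smul, smul_eq_mul, toReal_apply]
  by_cases hQ : Q = P
  · rw [hQ, hP, Int.cast_zero, zero_mul]
  · exact mul_nonneg (Int.cast_nonneg (hD' Q)) (hφ Q hQ)

lemma facet_excDivisor (h : fr.Represents p) (hn : 1 ≤ n) (α β γ : ℤ)
    (I : Finset (Fin (n + 2))) (i : Fin (n + 2)) :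
    facet α β γ I (h.degP hn (h.excDivisor i)) = if i ∈ I then -(γ : ℝ) else 0 := by
  rw [facet_apply, h.degP_excDivisor]
  split_ifs with hi <;> simp [Finset.sum_neg_distrib, hi]

/-- The same for functionals that are nonnegative on the exceptional divisors. -/
lemma Represents.facet_nonneg (h : fr.Represents p) (hn : 1 ≤ n) {D : WeilDivisor p}
    (hD : IsMovable D) (P : PrimeDivisor p) {α β γ : ℤ} (hγ : γ ≤ 0)
    {I : Finset (Fin (n + 2))}
    (hF : ∀ (F : CoordRing k n (n + 1)) (d : ℕ × ℕ) (hF : Irreducible F)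
      (hd : F ∈ biForms k n (n + 1) d), h.primeDivisor hn hF hd ≠ P →
        0 ≤ (α : ℤ) * d.1 + β * d.2 + γ * ((∑ i ∈ I, (fr.pointVal i).ord F : ℕ) : ℤ)) :
    0 ≤ facet α β γ I (h.deg hn (toReal D)) := by
  refine h.nonneg_of_isMovable hn hD P fun Q hQ => ?_
  rcases h.primeDivisor_or_excDivisor hn Q with ⟨F, d, hFi, hd, rfl⟩ | ⟨i, rfl⟩
  · rw [h.degP_primeDivisor, facet_apply, formDegree]
    have := hF F d hFi hd hQ
    rw [← Int.cast_nonneg_iff (R := ℝ)] at this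
    push_cast at this
    exact this
  · rw [facet_excDivisor]
    split_ifs
    · exact neg_nonneg.2 (Int.cast_nonpos.2 hγ)
    · exact le_rfl

lemma Represents.not_dvd_of_ne (h : fr.Represents p) (hn : 1 ≤ n)
    {F F' : CoordRing k n (n + 1)} {d d' : ℕ × ℕ} {hF : Irreducible F}
    {hd : F ∈ biForms k n (n + 1) d} {hF' : Irreducible F'} {hd' : F' ∈ biForms k n (n + 1) d'}
    (hne : h.primeDivisor hn hF hd ≠ h.primeDivisor hn hF' hd') : ¬ F' ∣ F := fun hdvd =>
  hne ((h.primeDivisor_eq_iff hn hF hd hF' hd').2 (hF'.associated_of_dvd hF hdvd).symm)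

/-- Each inequality is nonnegative on all prime divisors but at most one: for `μᵢ ≥ 0` the exception
is `Eᵢ`, and for the last two families it is the strict transform of a hyperplane. -/
lemma Represents.deg_mem_movableCoords [Infinite k] (h : fr.Represents p) (hn : 1 ≤ n)
    {D : WeilDivisor p} (hD : IsMovable D) : h.deg hn (toReal D) ∈ movableCoords n := by
  rw [mem_movableCoords_iff]
  refine ⟨h.facet_nonneg hn hD (h.excDivisor 0) le_rfl fun F d _ _ _ => by simp,
    h.facet_nonneg hn hD (h.excDivisor 0) le_rfl fun F d _ _ _ => by simp,
    fun i => h.facet_nonneg hn hD (h.excDivisor 0) (by norm_num) fun F d hF hd _ => ?_,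
    h.facet_nonneg hn hD (h.excDivisor 0) (by norm_num) fun F d hF hd _ => ?_,
    fun i => h.nonneg_of_isMovable hn hD (h.excDivisor i) fun Q hQ => ?_,
    fun i j hij => h.facet_nonneg hn hD (h.primeDivisor hn
      (irreducible_of_mem_biForms (fr.formX_ne_zero hij) rfl (fr.formX_mem j i))
      (fr.formX_mem j i)) (by norm_num) fun F d hF hd hne => ?_,
    fun i => h.facet_nonneg hn hD (h.primeDivisor hn
      (irreducible_of_mem_biForms (fr.formY_ne_zero i) rfl (fr.formY_mem i))
      (fr.formY_mem i)) (by norm_num) fun F d hF hd hne => ?_⟩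
  · have := fr.ord_pointVal_le hF.ne_zero hd i
    rw [Finset.sum_singleton]
    omega
  · have := fr.sum_ord_le hF.ne_zero hd
    zify at this
    push_cast
    linarith
  · rcases h.primeDivisor_or_excDivisor hn Q with ⟨F, d, hFi, hd, rfl⟩ | ⟨j, rfl⟩
    · rw [h.degP_primeDivisor, facet_apply, formDegree]
      simp
    · rw [facet_excDivisor, if_neg]
      rw [Finset.mem_singleton]
      rintro rfl
      exact hQ rfl
  · have := fr.sum_ord_le_of_not_dvd_formX hd hij (h.not_dvd_of_ne hn hne)
    zify at this
    push_cast
    linarith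
  · have := fr.sum_ord_le_of_not_dvd_formY hd (h.not_dvd_of_ne hn hne)
    zify at this
    push_cast
    linarith

end Frame

end Necessity

/-! ### Cones with integral facets -/

section IntegralCone

/-- Finitely many real numbers are integral combinations of real numbers that are linearly
independent over `ℤ`. -/
lemma exists_int_basis {X : Type*} (f : X → ℝ) (t : Finset X) :
    ∃ (r : ℕ) (e : Fin r → ℝ) (m : X → Fin r → ℤ), LinearIndependent ℤ e ∧
      ∀ a ∈ t, f a = ∑ s, (m a s : ℝ) * e s := by
  classical
  set W : Submodule ℤ ℝ := Submodule.span ℤ (f '' t) with hW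
  have : Module.Finite ℤ W := Module.Finite.span_of_finite ℤ (t.finite_toSet.image f)
  let b := Module.finBasis ℤ W
  refine ⟨_, fun s => (b s : ℝ), fun a s => if h : f a ∈ W then b.repr ⟨f a, h⟩ s else 0,
    b.linearIndependent.map' W.subtype (Submodule.ker_subtype W), fun a ha => ?_⟩
  have hfa : f a ∈ W := Submodule.subset_span ⟨a, ha, rfl⟩
  have h1 := congrArg Subtype.val (b.sum_repr ⟨f a, hfa⟩)
  rw [Submodule.coe_sum] at h1
  simp only [hfa, dif_pos]
  refine h1.symm.trans (Finset.sum_congr rfl fun s _ => ?_)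
  rw [Submodule.coe_smul, zsmul_eq_mul]

variable {V : Type*} [AddCommGroup V] [Module ℝ V]

/-- A cone cut out by finitely many functionals that are integral on `Λ`. -/
def IsIntegralCone (Λ : AddSubgroup V) (C : Set V) : Prop :=
  ∃ S : Set (V →ₗ[ℝ] ℝ), S.Finite ∧ (∀ φ ∈ S, ∀ v ∈ Λ, ∃ m : ℤ, φ v = m) ∧
    C = {v | ∀ φ ∈ S, 0 ≤ φ v}

variable {Λ : AddSubgroup V}

lemma isIntegralCone_halfspace {φ : V →ₗ[ℝ] ℝ} (hφ : ∀ v ∈ Λ, ∃ m : ℤ, φ v = m) :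
    IsIntegralCone Λ {v | 0 ≤ φ v} :=
  ⟨{φ}, Set.finite_singleton φ, by simpa using hφ, by simp⟩

lemma isIntegralCone_iInter {ι : Sort*} [Finite ι] {C : ι → Set V}
    (hC : ∀ i, IsIntegralCone Λ (C i)) : IsIntegralCone Λ (⋂ i, C i) := by
  choose S hS hΛ hSC using hC
  refine ⟨⋃ i, S i, Set.finite_iUnion hS, ?_, ?_⟩
  · intro φ hφ
    obtain ⟨i, hi⟩ := Set.mem_iUnion.1 hφ
    exact hΛ i φ hi
  · ext v
    simp only [Set.mem_iInter, Set.mem_iUnion, Set.mem_ofPred_eq, hSC]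
    exact ⟨fun h φ ⟨i, hi⟩ => h i φ hi, fun h i φ hi => h φ ⟨i, hi⟩⟩

lemma IsIntegralCone.inter {C C' : Set V} (hC : IsIntegralCone Λ C) (hC' : IsIntegralCone Λ C') :
    IsIntegralCone Λ (C ∩ C') := by
  rw [Set.inter_eq_iInter]
  exact isIntegralCone_iInter fun b => by cases b <;> assumption

/-- An integral cone is generated by its lattice points: write the coefficients of a point of the
cone in a `ℤ`-basis of the group they generate and approximate that basis by rational numbers from
both sides. A functional vanishing at the point vanishes identically in the basis, and a positive
one stays positive. -/
lemma IsIntegralCone.mem_hull {C : Set V} (hC : IsIntegralCone Λ C) {v : V} (hv : v ∈ C)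
    (hspan : v ∈ Submodule.span ℝ (Λ : Set V)) :
    v ∈ PointedCone.hull ℝ (C ∩ Λ) := by
  obtain ⟨S, hSfin, hSΛ, rfl⟩ := hC
  obtain ⟨f, t, htΛ, -, rfl⟩ := Submodule.mem_span_iff_exists_finset_subset.1 hspan
  obtain ⟨r, e, m, he, hm⟩ := exists_int_basis f t
  let q : Fin r → V := fun s => ∑ a ∈ t, m a s • a
  have hq : ∀ s, q s ∈ Λ := fun s => sum_mem fun a ha => Λ.zsmul_mem (htΛ ha) _
  let T : (Fin r → ℝ) →ₗ[ℝ] V := Fintype.linearCombination ℝ q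
  have hT : ∀ e', T e' = ∑ s, e' s • q s := fun e' => Fintype.linearCombination_apply ..
  have hTe : T e = ∑ a ∈ t, f a • a := by
    rw [hT]
    simp only [q, Finset.smul_sum]
    rw [Finset.sum_comm]
    refine Finset.sum_congr rfl fun a ha => ?_
    rw [hm a ha, Finset.sum_smul]
    refine Finset.sum_congr rfl fun s _ => ?_
    rw [mul_comm, mul_smul, Int.cast_smul_eq_zsmul]
  rw [← hTe] at hv ⊢
  -- functionals positive at `T e` stay positive nearby
  have hU : ∀ᶠ e' in 𝓝 e, ∀ φ ∈ S, 0 < φ (T e) → 0 < φ (T e') := by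
    refine (Filter.eventually_all_finite hSfin).2 fun φ _ => ?_
    by_cases hφ : 0 < φ (T e)
    · have hcont : Continuous fun e' => φ (T e') :=
        (φ.comp T).continuous_of_finiteDimensional
      filter_upwards [hcont.continuousAt.eventually (lt_mem_nhds hφ)] with e' he' _ using he'
    · exact Filter.Eventually.of_forall fun e' h => absurd h hφ
  obtain ⟨ε, hε, hball⟩ := Metric.eventually_nhds_iff.1 hU
  choose l hl1 hl2 using fun s => exists_rat_btwn (sub_lt_self (e s) hε)
  choose u hu1 hu2 using fun s => exists_rat_btwn (lt_add_of_pos_right (e s) hε)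
  have hvertex : Set.univ.pi (fun s => ({(l s : ℝ), (u s : ℝ)} : Set ℝ)) ⊆
      T ⁻¹' (PointedCone.hull ℝ ({v | ∀ φ ∈ S, 0 ≤ φ v} ∩ Λ) : Set V) := by
    intro e' he'
    have hrat : ∀ s, ∃ ρ : ℚ, e' s = ρ := fun s => by
      rcases he' s (Set.mem_univ s) with h | h
      exacts [⟨_, h⟩, ⟨_, h⟩]
    choose ρ hρ using hrat
    have hclose : dist e' e < ε := by
      refine (dist_pi_lt_iff hε).2 fun s => ?_
      rw [Real.dist_eq, abs_lt]
      rcases he' s (Set.mem_univ s) with h | h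
      · rw [h]
        exact ⟨by linarith [hl1 s], by linarith [hl2 s]⟩
      · rw [Set.mem_singleton_iff.1 h]
        exact ⟨by linarith [hu1 s], by linarith [hu2 s]⟩
    have hpos : ∀ φ ∈ S, 0 ≤ φ (T e') := by
      intro φ hφ
      rcases (hv φ hφ).lt_or_eq with h0 | h0
      · exact (hball hclose φ hφ h0).le
      · choose M hM using fun s => hSΛ φ hφ (q s) (hq s)
        have hφT : ∀ e', φ (T e') = ∑ s, e' s * M s := fun e' => by
          simp only [hT, map_sum, map_smul, smul_eq_mul, hM]
        rw [hφT] at h0 ⊢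
        have hM0 : ∀ s, M s = 0 := Fintype.linearIndependent_iff.1 he M (by
          rw [h0]
          exact Finset.sum_congr rfl fun s _ => by rw [zsmul_eq_mul, mul_comm])
        simp [hM0]
    -- clear denominators
    set N : ℕ := ∏ s, (ρ s).den with hN
    have hN0 : (N : ℝ) ≠ 0 := Nat.cast_ne_zero.2 (Finset.prod_ne_zero_iff.2 fun s _ => (ρ s).den_nz)
    have hint : ∀ s, ∃ z : ℤ, (N : ℝ) * e' s = z := by
      intro s
      obtain ⟨w, hw⟩ := Finset.dvd_prod_of_mem (fun s => (ρ s).den) (Finset.mem_univ s)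
      refine ⟨w * (ρ s).num, ?_⟩
      have h1 : (ρ s : ℝ) * (ρ s).den = (ρ s).num := by exact_mod_cast Rat.mul_den_eq_num (ρ s)
      rw [hN, hw, hρ]
      push_cast
      rw [← h1]
      ring
    choose z hz using hint
    have hmem : (N : ℝ) • T e' ∈ PointedCone.hull ℝ ({v | ∀ φ ∈ S, 0 ≤ φ v} ∩ Λ) := by
      refine Submodule.subset_span ⟨fun φ hφ => ?_, ?_⟩
      · rw [map_smul]
        exact mul_nonneg (Nat.cast_nonneg _) (hpos φ hφ)
      · rw [hT, Finset.smul_sum]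
        refine sum_mem fun s _ => ?_
        rw [smul_smul, hz, Int.cast_smul_eq_zsmul]
        exact Λ.zsmul_mem (hq s) _
    have := Submodule.smul_mem _ (⟨(N : ℝ)⁻¹, by positivity⟩ : {a : ℝ // 0 ≤ a}) hmem
    rwa [Nonneg.mk_smul, smul_smul, inv_mul_cancel₀ hN0, one_smul] at this
  refine convexHull_min hvertex ((PointedCone.convex _).linear_preimage T) ?_
  rw [convexHull_pi]
  intro s _
  change e s ∈ convexHull ℝ {(l s : ℝ), (u s : ℝ)}
  rw [convexHull_pair, segment_eq_Icc ((hl2 s).trans (hu1 s)).le]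
  exact ⟨(hl2 s).le, (hu1 s).le⟩

end IntegralCone

/-! ### The movable cone -/

section Cone

variable {n : ℕ}

/-- The integral points of the coordinate space. -/
def integralCoords (n : ℕ) : AddSubgroup (Coords n) where
  carrier := {v | ∃ (a b : ℤ) (μ : Fin (n + 2) → ℤ), v = ((a : ℝ), (b : ℝ), fun i => (μ i : ℝ))}
  add_mem' := by
    rintro _ _ ⟨a, b, μ, rfl⟩ ⟨a', b', μ', rfl⟩
    exact ⟨a + a', b + b', μ + μ', by ext <;> simp⟩
  zero_mem' := ⟨0, 0, 0, by ext <;> simp⟩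
  neg_mem' := by
    rintro _ ⟨a, b, μ, rfl⟩
    exact ⟨-a, -b, -μ, by ext <;> simp⟩

lemma span_integralCoords : Submodule.span ℝ (integralCoords n : Set (Coords n)) = ⊤ := by
  rw [eq_top_iff]
  rintro ⟨a, b, μ⟩ -
  have h1 : ((1, 0, 0) : Coords n) ∈ integralCoords n := ⟨1, 0, 0, by ext <;> simp⟩
  have h2 : ((0, 1, 0) : Coords n) ∈ integralCoords n := ⟨0, 1, 0, by ext <;> simp⟩
  have h3 : ∀ i, ((0, 0, Pi.single i 1) : Coords n) ∈ integralCoords n := fun i =>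
    ⟨0, 0, Pi.single i 1, by ext j <;> simp [Pi.single_apply]⟩
  have h4 : ((a, b, μ) : Coords n) = a • (1, 0, 0) + b • (0, 1, 0) +
      ∑ i, μ i • ((0, 0, Pi.single i 1) : Coords n) := by
    ext j <;> simp [Prod.fst_sum, Prod.snd_sum, Pi.single_apply]
  rw [h4]
  exact add_mem (add_mem (Submodule.smul_mem _ _ (Submodule.subset_span h1))
    (Submodule.smul_mem _ _ (Submodule.subset_span h2)))
    (sum_mem fun i _ => Submodule.smul_mem _ _ (Submodule.subset_span (h3 i)))

lemma isIntegralCone_facet (α β γ : ℤ) (I : Finset (Fin (n + 2))) :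
    IsIntegralCone (integralCoords n) {v | 0 ≤ facet α β γ I v} := by
  refine isIntegralCone_halfspace ?_
  rintro _ ⟨a, b, μ, rfl⟩
  exact ⟨α * a + β * b + γ * ∑ i ∈ I, μ i, by rw [facet_apply]; push_cast; rfl⟩

lemma isClosed_facet (α β γ : ℤ) (I : Finset (Fin (n + 2))) :
    IsClosed {v : Coords n | 0 ≤ facet α β γ I v} :=
  isClosed_le continuous_const (facet α β γ I).continuous_of_finiteDimensional

lemma movableCoords_eq : movableCoords n = {v | 0 ≤ facet 1 0 0 ∅ v} ∩
    ({v | 0 ≤ facet 0 1 0 ∅ v} ∩ ((⋂ i, {v | 0 ≤ facet 1 1 (-1) {i} v}) ∩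
    ({v | 0 ≤ facet n (n + 1) (-1) Finset.univ v} ∩ ((⋂ i, {v | 0 ≤ facet 0 0 1 {i} v}) ∩
    ((⋂ i, ⋂ j, ⋂ _ : i ≠ j,
      {v | 0 ≤ facet (n - 1) n (-1) ((Finset.univ.erase j).erase i) v}) ∩
    ⋂ i, {v | 0 ≤ facet n n (-1) (Finset.univ.erase i) v}))))) := by
  ext v
  rw [mem_movableCoords_iff]
  simp only [Set.mem_inter_iff, Set.mem_iInter, Set.mem_ofPred_eq]

lemma isIntegralCone_movableCoords : IsIntegralCone (integralCoords n) (movableCoords n) := by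
  rw [movableCoords_eq]
  refine (isIntegralCone_facet ..).inter ((isIntegralCone_facet ..).inter
    ((isIntegralCone_iInter fun i => isIntegralCone_facet ..).inter
    ((isIntegralCone_facet ..).inter ((isIntegralCone_iInter fun i => isIntegralCone_facet ..).inter
    ((isIntegralCone_iInter fun i => isIntegralCone_iInter fun j => isIntegralCone_iInter fun _ =>
      isIntegralCone_facet ..).inter (isIntegralCone_iInter fun i => isIntegralCone_facet ..))))))

lemma isClosed_movableCoords : IsClosed (movableCoords n) := by
  rw [movableCoords_eq]
  refine (isClosed_facet ..).inter ((isClosed_facet ..).inter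
    ((isClosed_iInter fun i => isClosed_facet ..).inter
    ((isClosed_facet ..).inter ((isClosed_iInter fun i => isClosed_facet ..).inter
    ((isClosed_iInter fun i => isClosed_iInter fun j => isClosed_iInter fun _ =>
      isClosed_facet ..).inter (isClosed_iInter fun i => isClosed_facet ..))))))

lemma movableCoords_add {v w : Coords n} (hv : v ∈ movableCoords n) (hw : w ∈ movableCoords n) :
    v + w ∈ movableCoords n := by
  rw [mem_movableCoords_iff] at *
  simp only [map_add]
  exact ⟨add_nonneg hv.1 hw.1, add_nonneg hv.2.1 hw.2.1,
    fun i => add_nonneg (hv.2.2.1 i) (hw.2.2.1 i), add_nonneg hv.2.2.2.1 hw.2.2.2.1,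
    fun i => add_nonneg (hv.2.2.2.2.1 i) (hw.2.2.2.2.1 i),
    fun i j hij => add_nonneg (hv.2.2.2.2.2.1 i j hij) (hw.2.2.2.2.2.1 i j hij),
    fun i => add_nonneg (hv.2.2.2.2.2.2 i) (hw.2.2.2.2.2.2 i)⟩

lemma movableCoords_smul {v : Coords n} (hv : v ∈ movableCoords n) {a : ℝ} (ha : 0 ≤ a) :
    a • v ∈ movableCoords n := by
  rw [mem_movableCoords_iff] at *
  simp only [map_smul, smul_eq_mul]
  exact ⟨mul_nonneg ha hv.1, mul_nonneg ha hv.2.1, fun i => mul_nonneg ha (hv.2.2.1 i),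
    mul_nonneg ha hv.2.2.2.1, fun i => mul_nonneg ha (hv.2.2.2.2.1 i),
    fun i j hij => mul_nonneg ha (hv.2.2.2.2.2.1 i j hij),
    fun i => mul_nonneg ha (hv.2.2.2.2.2.2 i)⟩

namespace Frame

variable {k : Type*} [Field k] {fr : Frame k n} {p : Fin (n + 2) → ProdPoint k n (n + 1)}

lemma Represents.mem_movableCone_iff [Infinite k] (h : fr.Represents p) (hn : 1 ≤ n) (c : N1 p) :
    c ∈ movableCone p ↔ h.coords hn c ∈ movableCoords n := by
  constructor
  · intro hc
    induction hc using Submodule.span_induction with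
    | mem c hc =>
      obtain ⟨D, hD, rfl⟩ := hc
      rw [h.coords_divClass]
      exact h.deg_mem_movableCoords hn hD
    | zero =>
      rw [map_zero, mem_movableCoords_iff]
      simp
    | add c c' _ _ hc hc' =>
      rw [map_add]
      exact movableCoords_add hc hc'
    | smul a c _ hc =>
      have : h.coords hn (a • c) = (a : ℝ) • h.coords hn c := map_smul _ (a : ℝ) c
      rw [this]
      exact movableCoords_smul hc a.2
  · intro hc
    have h1 := isIntegralCone_movableCoords.mem_hull hc
      (span_integralCoords (n := n) ▸ Submodule.mem_top)
    rw [← h.ofCoords_coords hn c]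
    have h2 : PointedCone.hull ℝ (movableCoords n ∩ integralCoords n) ≤
        (movableCone p).comap (ofCoords p) := by
      refine Submodule.span_le.2 ?_
      rintro _ ⟨hv, a, b, μ, rfl⟩
      obtain ⟨D, hD, hDv⟩ := h.exists_isMovable hn hv
      exact Submodule.subset_span ⟨D, hD, hDv.symm⟩
    exact h2 h1

lemma Represents.isClosed_movableCone [Infinite k] (h : fr.Represents p) (hn : 1 ≤ n) :
    IsClosed[moduleTopology ℝ (N1 p)] (movableCone p : Set (N1 p)) := by
  have heq : (movableCone p : Set (N1 p)) = h.coords hn ⁻¹' movableCoords n := by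
    ext c
    exact h.mem_movableCone_iff hn c
  rw [heq]
  let _ : TopologicalSpace (N1 p) := moduleTopology ℝ (N1 p)
  have : IsModuleTopology ℝ (N1 p) := ⟨rfl⟩
  exact isClosed_movableCoords.preimage (IsModuleTopology.continuous_of_linearMap (h.coords hn))

end Frame

/-- The inequalities for the subsets of a given size in terms of their complements. -/
lemma mem_movableCoords_iff_forall_finset (d₁ d₂ : ℝ) (μ : Fin (n + 2) → ℝ) :
    (d₁, d₂, μ) ∈ movableCoords n ↔
      (0 ≤ d₁ ∧ 0 ≤ d₂) ∧ (∀ i, μ i ≤ d₁ + d₂) ∧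
      (∀ I : Finset (Fin (n + 2)), I.card = n + 1 ∨ I.card = n + 2 →
        ∑ i ∈ I, μ i ≤ n * d₁ + (n + 1) * d₂) ∧
      (∀ i, 0 ≤ μ i) ∧
      (∀ I : Finset (Fin (n + 2)), I.card = n → ∑ i ∈ I, μ i ≤ (n - 1) * d₁ + n * d₂) ∧
      (∀ I : Finset (Fin (n + 2)), I.card = n + 1 → ∑ i ∈ I, μ i ≤ n * (d₁ + d₂)) := by
  have hcard : ∀ I : Finset (Fin (n + 2)), I.card + Iᶜ.card = n + 2 := fun I => by
    rw [Finset.card_add_card_compl, Fintype.card_fin]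
  constructor
  · rintro ⟨h1, h2, h3, h4, h5, h6, h7⟩
    refine ⟨⟨h1, h2⟩, h3, fun I _ => ?_, h5, fun I hI => ?_, fun I hI => ?_⟩
    · exact (Finset.sum_le_univ_sum_of_nonneg h5).trans h4
    · have := hcard I
      obtain ⟨i, j, hij, hc⟩ := Finset.card_eq_two.1 (show Iᶜ.card = 2 by omega)
      have hI' : I = (Finset.univ.erase j).erase i := by
        rw [← compl_compl I, hc]
        ext l
        simp
      rw [hI']
      exact h6 i j hij
    · have := hcard I
      obtain ⟨i, hc⟩ := Finset.card_eq_one.1 (show Iᶜ.card = 1 by omega)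
      have hI' : I = Finset.univ.erase i := by
        rw [← compl_compl I, hc]
        ext l
        simp
      rw [hI']
      exact h7 i
  · rintro ⟨⟨h1, h2⟩, h3, h4, h5, h6, h7⟩
    refine ⟨h1, h2, h3, h4 _ (Or.inr (by simp)), h5, fun i j hij => h6 _ ?_, fun i => h7 _ ?_⟩
    · rw [Finset.card_erase_of_mem (Finset.mem_erase.2 ⟨hij, Finset.mem_univ i⟩),
        Finset.card_erase_of_mem (Finset.mem_univ j), Finset.card_univ, Fintype.card_fin]
      rfl
    · rw [Finset.card_erase_of_mem (Finset.mem_univ i), Finset.card_univ, Fintype.card_fin]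
      rfl

end Cone

end BlowupModel

theorem mainTheorem3 {k : Type*} [Field k] [IsAlgClosed k] [CharZero k] (n : ℕ) (hn : 1 ≤ n)
    (p : Fin (n + 2) → BlowupModel.ProdPoint k n (n + 1))
    (hp : BlowupModel.LinearlyGeneral p) :
    (∀ c : BlowupModel.N1 p, ∃! v : ℝ × ℝ × (Fin (n + 2) → ℝ),
      c = v.1 • BlowupModel.H₁ p + v.2.1 • BlowupModel.H₂ p
        - ∑ i, v.2.2 i • BlowupModel.E p i) ∧
    (∀ (d₁ d₂ : ℝ) (μ : Fin (n + 2) → ℝ),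
      d₁ • BlowupModel.H₁ p + d₂ • BlowupModel.H₂ p - ∑ i, μ i • BlowupModel.E p i
          ∈ BlowupModel.movableCone p ↔
        (0 ≤ d₁ ∧ 0 ≤ d₂) ∧
        (∀ i, μ i ≤ d₁ + d₂) ∧
        (∀ I : Finset (Fin (n + 2)), I.card = n + 1 ∨ I.card = n + 2 →
          ∑ i ∈ I, μ i ≤ n * d₁ + (n + 1) * d₂) ∧
        (∀ i, 0 ≤ μ i) ∧
        (∀ I : Finset (Fin (n + 2)), I.card = n →
          ∑ i ∈ I, μ i ≤ (n - 1) * d₁ + n * d₂) ∧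
        (∀ I : Finset (Fin (n + 2)), I.card = n + 1 →
          ∑ i ∈ I, μ i ≤ n * (d₁ + d₂))) ∧
    IsClosed[moduleTopology ℝ (BlowupModel.N1 p)]
      (BlowupModel.movableCone p : Set (BlowupModel.N1 p)) := by
  obtain ⟨fr, ha, hq⟩ := BlowupModel.exists_frame hp
  have h : fr.Represents p := fun i => by rw [BlowupModel.Frame.point, ha, hq]
  have : Infinite k := CharZero.infinite k
  refine ⟨fun c => ?_, fun d₁ d₂ μ => ?_, h.isClosed_movableCone hn⟩
  · refine ⟨h.coords hn c, ?_, fun v hv => ?_⟩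
    · exact (h.ofCoords_coords hn c).symm.trans (BlowupModel.Frame.ofCoords_apply _)
    · rw [hv.trans (BlowupModel.Frame.ofCoords_apply v).symm, h.coords_ofCoords]
  · rw [← BlowupModel.mem_movableCoords_iff_forall_finset]
    have h1 := BlowupModel.Frame.ofCoords_apply (p := p) (d₁, d₂, μ)
    rw [← h1, h.mem_movableCone_iff hn, h.coords_ofCoords]
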